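/- **Conventions.** Let $\Bbbk$ be a field of characteristic $0$. Graded means $\mathbb Z$-graded; a *pointed* graded space is a graded vector space $V$ with a distinguished $1_V\in V^0$. $S^nV$ is the $n$-th graded symmetric power. $P(n)$ is the set of partitions $\pi=B_1\sqcup\dots\sqcup B_{|\pi|}$ of $\{1,\dots,n\}$ into non-empty blocks, the blocks ordered by their greatest elements and each block ordered increasingly; $x_B=(x_{j_1},\dots,x_{j_k})$ and $\varphi(x_B)=\varphi_k(x_{j_1},\dots,x_{j_k})$ for $B=\{j_1<\dots<j_k\}$. For homogeneous $x_1,\dots,x_n$, $\varepsilon(\pi)$ is the Koszul sign of $x_1\otimes\dots\otimes x_n\mapsto x_{B_1}\otimes\dots\otimes x_{B_{|\pi|}}$, and $\varepsilon(\pi,i)=\varepsilon(\pi)(-1)^{|x_{B_1}|+\dots+|x_{B_{i-1}}|}$. **Homotopy probability spaces.** A homotopy probability algebra $(\mathcal C,\underline M,K)$ is a pointed graded space $\mathcal C$ with linear maps $M_n:S^n\mathcal C\to\mathcal C$ of degree $0$, $n\ge1$, such that $M_1=\mathrm{id}$ and $M_{n+1}(x_1,\dots,x_n,1_{\mathcal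 C})=M_n(x_1,\dots,x_n)$, and with a linear map $K$ of degree $1$ such that $K^2=0$, $K1_{\mathcal C}=0$ and $1_{\mathcal C}\notin\operatorname{im}K$. A morphism is a pointed cochain map. The ground field (in degree $0$, with iterated products and $K=0$) is an example. A homotopy probability space is such an algebra with the pointed cochain homotopy class of a morphism $\mathfrak c:\mathcal C\to\Bbbk$ (the expectation). The descendant $sL_\infty$-structure $\underline\ell^K=\ell^K_1,\ell^K_2,\dots$ on $\mathcal C$ is determined recursively by $$KM_n(x_1,\dots,x_n)=\sum_{\pi\in P(n)}\ \sum_{i:\,|B_i|=n-|\pi|+1}\varepsilon(\pi,i)\,M_{|\pi|}\big(x_{B_1},\dots,x_{B_{i-1}},\ell^K(x_{B_i}),x_{B_{i+1}},\dots,x_{B_{|\pi|}}\big).$$ **Complete spaces.** A complete space $\boldsymbol{\mathcal S}$ of homotopical random variables is a pointed graded space $\mathcal S$ with zero $sL_\infty$-structure, together with the $sL_\infty$-homotopy type of a unital $sL_\infty$-quasi-isomorphism $\underline\varphi=\varphi_1,\varphi_2,\dots$ from $(\mathcal S,1_{\mathcal S},\underline0)$ to $(\mathcal C,1_{\mathcal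 C},\underline\ell^K)$. That is, the $\varphi_n:S^n\mathcal S\to\mathcal C$ are linear maps of degree $0$ with $\sum_{\pi\in P(n)}\varepsilon(\pi)\,\ell^K_{|\pi|}(\varphi(s_{B_1}),\dots,\varphi(s_{B_{|\pi|}}))=0$ for all $n\ge1$, $\varphi_1(1_{\mathcal S})=1_{\mathcal C}$, $\varphi_{n+1}(s_1,\dots,s_n,1_{\mathcal S})=0$ for $n\ge1$, and $\varphi_1:(\mathcal S,0)\to(\mathcal C,K)$ is a quasi-isomorphism. The $sL_\infty$-homotopy type is the class under the following relation: $\underline\varphi\sim\underline{\tilde\varphi}$ if there are families $\underline\Phi(\tau)$ and $\underline\eta(\tau)$ of linear maps $S^n\mathcal S\to\mathcal C$, polynomial in $\tau$, of degrees $0$ and $-1$ respectively, with $\eta_n(\tau)$ vanishing when its last argument is $1_{\mathcal S}$, with $\underline\Phi(0)=\underline\varphi$, $\underline\Phi(1)=\underline{\tilde\varphi}$, and $$\frac{d}{d\tau}\Phi_n(s_1,\dots,s_n)=\sum_{\pi\in P(n)}\sum_{i=1}^{|\pi|}\varepsilon(\pi,i)\,\ell^K_{|\pi|}\big(\Phi(s_{B_1}),\dots,\Phi(s_{B_{i-1}}),\eta(s_{B_i}),\Phi(s_{B_{i+1}}),\dots,\Phi(s_{B_{|\pi|}})\big).$$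 **Structures on a complete space.** Fix representatives $\mathfrak c$ of the expectation and $\underline\varphi$ of the homotopy type, and a homotopy inverse $h:\mathcal C\to\mathcal S$ of $\varphi_1$, i.e. a degree-$0$ map with $hK=0$, $h\varphi_1=\mathrm{id}_{\mathcal S}$ and $\varphi_1h=\mathrm{id}_{\mathcal C}+K\beta+\beta K$ for some $\beta$ of degree $-1$ (such $h$ exist). Put $$\Pi_n(s_1,\dots,s_n)=\sum_{\pi\in P(n)}\varepsilon(\pi)\,M_{|\pi|}\big(\varphi(s_{B_1}),\dots,\varphi(s_{B_{|\pi|}})\big),\quad \mu^{\boldsymbol{\mathcal S}}_n=\mathfrak c\circ\Pi_n,\quad \iota^{\boldsymbol{\mathcal S}}=\mathfrak c\circ\varphi_1,\quad M^{\boldsymbol{\mathcal S}}_n=h\circ\Pi_n,$$ and let $m^{\boldsymbol{\mathcal S}}_n$, $n\ge2$, be the operations on $\mathcal S$ determined recursively by $$M^{\boldsymbol{\mathcal S}}_n(v_1,\dots,v_n)=\sum_{\pi}\varepsilon(\pi)\,M^{\boldsymbol{\mathcal S}}_{|\pi|}\big(v_{B_1},\dots,v_{B_{|\pi|-1}},m^{\boldsymbol{\mathcal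 S}}(v_{B_{|\pi|}})\big),$$ the sum being over all $\pi\in P(n)$ with $|B_{|\pi|}|=n-|\pi|+1$ for which $n-1$ and $n$ lie in the same block. Let $\mathcal S$ be finite-dimensional, with a homogeneous basis $\{e_\alpha\}_{\alpha\in J}$ such that $e_0=1_{\mathcal S}$. Let $\Bbbk[\![t_{\mathcal S}]\!]$ be the algebra of formal power series in the graded commutative variables $\{t^\alpha\}_{\alpha\in J}$, $t^\alpha t^\beta=(-1)^{|e_\alpha||e_\beta|}t^\beta t^\alpha$, and let $\partial_\alpha$ be its graded (left) derivation with $\partial_\alpha t^\beta=\delta_\alpha{}^\beta$. With $M^{\boldsymbol{\mathcal S}}_{\alpha_1\cdots\alpha_n}{}^\gamma$ and $m^{\boldsymbol{\mathcal S}}_{\alpha_1\cdots\alpha_n}{}^\gamma$ the structure constants of $M_n^{\boldsymbol{\mathcal S}}$ and $m_n^{\boldsymbol{\mathcal S}}$ in this basis, define elements of $\Bbbk[\![t_{\mathcal S}]\!]$ by $$A_{\alpha\beta}{}^\gamma=m^{\boldsymbol{\mathcal S}}_{\alpha\beta}{}^\gamma+\sum_{n\ge1}\frac1{n!}\sum_{\rho_1,\dots,\rho_n\in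 J}t^{\rho_n}\cdots t^{\rho_1}\,m^{\boldsymbol{\mathcal S}}_{\rho_1\cdots\rho_n\alpha\beta}{}^\gamma,\qquad T^\gamma=\sum_{n\ge1}\frac1{n!}\sum_{\rho_1,\dots,\rho_n\in J}t^{\rho_n}\cdots t^{\rho_1}\,M^{\boldsymbol{\mathcal S}}_{\rho_1\cdots\rho_n}{}^\gamma,$$ and the moment generating function $$Z_{\boldsymbol{\mathcal S}}=1+\sum_{n\ge1}\frac1{n!}\sum_{\rho_1,\dots,\rho_n\in J}t^{\rho_n}\cdots t^{\rho_1}\,\mu^{\boldsymbol{\mathcal S}}_n(e_{\rho_1},\dots,e_{\rho_n}).$$ **Theorem.** The series $T^\gamma$ determine the moment generating function up to the finitely many constants $\iota^{\boldsymbol{\mathcal S}}(e_\gamma)\in\Bbbk$: $$Z_{\boldsymbol{\mathcal S}}=1+\sum_{\gamma\in J}T^\gamma\,\iota^{\boldsymbol{\mathcal S}}(e_\gamma);$$ in particular two expectations $\mathfrak c,\mathfrak c'$ with the same values $\iota^{\boldsymbol{\mathcal S}}(e_\gamma)$ for all $\gamma$ give the same $Z_{\boldsymbol{\mathcal S}}$.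 Furthermore, for all $\alpha,\beta\in J$, $$\Big(\partial_\alpha\partial_\beta-\sum_{\gamma\in J}A_{\alpha\beta}{}^\gamma\,\partial_\gamma\Big)Z_{\boldsymbol{\mathcal S}}=0,\qquad(\partial_0-1)\,Z_{\boldsymbol{\mathcal S}}=0.$$ -/

import Mathlib

noncomputable section

namespace HoProb

universe u v w

/-! ### Graded vector spaces, graded symmetric maps and Koszul signs -/

/-- A pointed `ℤ`-graded vector space: `V = ⨁ j, V^j` with a distinguished `1_V ∈ V^0`. -/
structure PointedGradedSpace (𝕜 : Type u) (V : Type v) [Field 𝕜] [AddCommGroup V]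
    [Module 𝕜 V] where
  deg : ℤ → Submodule 𝕜 V
  isInternal : DirectSum.IsInternal deg
  one : V
  one_mem : one ∈ deg 0

/-- The Koszul sign `ε(σ)` of `x_1 ⊗ ⋯ ⊗ x_n ↦ ε(σ) x_{σ 1} ⊗ ⋯ ⊗ x_{σ n}`, where `|x_i| = d i`:
every pair of factors which is put out of order contributes `(-1)^(|x| |y|)`. -/
def permSign {n : ℕ} (d : Fin n → ℤ) (σ : Equiv.Perm (Fin n)) : ℤˣ :=
  ∏ i : Fin n, ∏ j : Fin n,
    if i < j ∧ σ j < σ i then (d (σ i) * d (σ j)).negOnePow else 1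

/-- The Koszul sign `ε(π)` of a partition `π = B_1 ⊔ ⋯ ⊔ B_r` of `{1, …, n}`, i.e. the Koszul sign
of passing from `x_1 ⊗ ⋯ ⊗ x_n` to `x_{B_1} ⊗ ⋯ ⊗ x_{B_r}`. The blocks of an `OrderedFinpartition`
are ordered by their greatest elements, and each block is ordered increasingly. -/
def partitionSign {n : ℕ} (d : Fin n → ℤ) (π : OrderedFinpartition n) : ℤˣ :=
  ∏ p : (Σ a, Fin (π.partSize a)), ∏ q : (Σ a, Fin (π.partSize a)),
    if p.1 < q.1 ∧ π.emb q.1 q.2 < π.emb p.1 p.2 then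
      (d (π.emb p.1 p.2) * d (π.emb q.1 q.2)).negOnePow else 1

/-- The total degree `|x_{B_i}|` of a block. -/
def blockDegree {n : ℕ} (d : Fin n → ℤ) (π : OrderedFinpartition n) (i : Fin π.length) : ℤ :=
  ∑ k, d (π.emb i k)

/-- The sign `ε(π, i) = ε(π) (-1)^(|x_{B_1}| + ⋯ + |x_{B_{i-1}}|)`. -/
def insertionSign {n : ℕ} (d : Fin n → ℤ) (π : OrderedFinpartition n) (i : Fin π.length) : ℤˣ :=
  partitionSign d π * (∑ j ∈ Finset.Iio i, blockDegree d π j).negOnePow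

/-- The first element of each block (the only one, if the block is a singleton). -/
def blockHead {n : ℕ} (π : OrderedFinpartition n) (j : Fin π.length) : Fin n :=
  π.emb j ⟨0, π.partSize_pos j⟩

section Graded

variable {𝕜 : Type u} {V : Type v} {W : Type w} [Field 𝕜] [AddCommGroup V] [Module 𝕜 V]
  [AddCommGroup W] [Module 𝕜 W]

/-- The multilinear map `f` is a linear map `S^n V → W` of degree `k`. -/
structure IsGradedSymm (X : PointedGradedSpace 𝕜 V) (Y : PointedGradedSpace 𝕜 W) (k : ℤ) {n : ℕ}
    (f : MultilinearMap 𝕜 (fun _ : Fin n => V) W) : Prop where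
  map_mem : ∀ (d : Fin n → ℤ) (x : Fin n → V), (∀ i, x i ∈ X.deg (d i)) →
    f x ∈ Y.deg (∑ i, d i + k)
  map_perm : ∀ (σ : Equiv.Perm (Fin n)) (d : Fin n → ℤ) (x : Fin n → V),
    (∀ i, x i ∈ X.deg (d i)) → f x = permSign d σ • f (fun i => x (σ i))

end Graded

/-- A family of operations on homogeneous elements: `φ n d x` is the value of the `n`-th operation
at `(x_1, …, x_n)`, where `d i` is the degree of `x_i`. (The degrees are recorded because they
enter the Koszul signs; only `n ≥ 1` matters.) -/
abbrev Operations (V : Type v) (W : Type w) : Type (max v w) :=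
  ∀ n : ℕ, (Fin n → ℤ) → (Fin n → V) → W

/-- A family of multilinear maps, regarded as a family of operations. -/
def ops {𝕜 : Type u} {V : Type v} {W : Type w} [Field 𝕜] [AddCommGroup V] [Module 𝕜 V]
    [AddCommGroup W] [Module 𝕜 W] (φ : ∀ n : ℕ, MultilinearMap 𝕜 (fun _ : Fin n => V) W) :
    Operations V W :=
  fun n _ x => φ n x

section Sums

variable {U : Type u} {V : Type v} {W : Type w} [AddCommGroup U] [AddCommGroup V] [AddCommGroup W]

/-- `∑_π ε(π) ψ_{|π|}(φ(x_{B_1}), …, φ(x_{B_{|π|}}))` for `φ` of degree `0`. -/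
def composeSum (ψ : Operations V W) (φ : Operations U V) : Operations U W :=
  fun n d x => ∑ π : OrderedFinpartition n, partitionSign d π •
    ψ π.length (blockDegree d π)
      (fun j => φ (π.partSize j) (fun k => d (π.emb j k)) (fun k => x (π.emb j k)))

/-- `∑ ε(π, i) φ_{|π|}(x_{B_1}, …, x_{B_{i-1}}, ℓ(x_{B_i}), x_{B_{i+1}}, …, x_{B_{|π|}})` for `ℓ` of
degree `1`, the sum being over all `π` and `i` with `|B_i| = n - |π| + 1`
(so that all the other blocks are singletons). -/
def insertSum (φ : Operations V W) (ℓ : Operations V V) : Operations V W :=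
  fun n d x => ∑ π : OrderedFinpartition n, ∑ i : Fin π.length,
    if π.partSize i + π.length = n + 1 then
      insertionSign d π i • φ π.length
        (Function.update (fun j => d (blockHead π j)) i (blockDegree d π i + 1))
        (Function.update (fun j => x (blockHead π j)) i
          (ℓ (π.partSize i) (fun k => d (π.emb i k)) (fun k => x (π.emb i k))))
    else 0

/-- `∑_π ∑_i ε(π, i) ℓ'_{|π|}(Φ(x_{B_1}), …, Φ(x_{B_{i-1}}), η(x_{B_i}), Φ(x_{B_{i+1}}), …)` for `Φ`
of degree `0` and `η` of degree `-1`. The summand for `|π| = 1` is `ℓ'_1 (η_n (x_1, …, x_n))`. -/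
def flowSum (ℓ' : Operations W W) (Φ η : Operations V W) : Operations V W :=
  fun n d x => ∑ π : OrderedFinpartition n, ∑ i : Fin π.length,
    insertionSign d π i • ℓ' π.length
      (Function.update (blockDegree d π) i (blockDegree d π i - 1))
      (Function.update
        (fun j => Φ (π.partSize j) (fun k => d (π.emb j k)) (fun k => x (π.emb j k))) i
        (η (π.partSize i) (fun k => d (π.emb i k)) (fun k => x (π.emb i k))))

end Sums

/-! ### Homotopy probability algebras and spaces -/

/-- A correlation algebra `(V, M)`: linear maps `M_n : S^n V → V` of degree `0`, `n ≥ 1`, with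
`M_1 = id` and `M_{n+1}(v_1, …, v_n, 1_V) = M_n(v_1, …, v_n)`. (`M 0` plays no role.) -/
structure CorrelationAlgebra (𝕜 : Type u) (V : Type v) [Field 𝕜] [AddCommGroup V] [Module 𝕜 V]
    extends PointedGradedSpace 𝕜 V where
  M : ∀ n : ℕ, MultilinearMap 𝕜 (fun _ : Fin n => V) V
  M_graded : ∀ n, 1 ≤ n → IsGradedSymm toPointedGradedSpace toPointedGradedSpace 0 (M n)
  M_id : ∀ x : Fin 1 → V, M 1 x = x 0
  M_unit : ∀ n, 1 ≤ n → ∀ x : Fin n → V, M (n + 1) (Fin.snoc (α := fun _ => V) x one) = M n x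

/-- A homotopy probability algebra `(V, M, K)`: a correlation algebra `(V, M)` together with a
differential `K` making `V` a pointed cochain complex. -/
structure HomotopyProbabilityAlgebra (𝕜 : Type u) (V : Type v) [Field 𝕜] [AddCommGroup V]
    [Module 𝕜 V] extends CorrelationAlgebra 𝕜 V where
  K : V →ₗ[𝕜] V
  K_mem : ∀ i, ∀ x ∈ deg i, K x ∈ deg (i + 1)
  K_K : ∀ x, K (K x) = 0
  K_one : K one = 0
  one_notMem_range : one ∉ LinearMap.range K

/-- The ground field, concentrated in degree `0`, as a pointed graded space. -/
def groundSpace (𝕜 : Type u) [Field 𝕜] : PointedGradedSpace 𝕜 𝕜 where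
  deg i := if i = 0 then ⊤ else ⊥
  isInternal := by
    rw [DirectSum.isInternal_submodule_iff_iSupIndep_and_iSup_eq_top]
    constructor
    · intro i
      beta_reduce
      by_cases hi : i = 0
      · have : (⨆ (j : ℤ) (_ : j ≠ i), (if j = 0 then (⊤ : Submodule 𝕜 𝕜) else ⊥)) = ⊥ := by
          simp only [iSup_eq_bot]
          intro j hj
          rw [if_neg (by rintro rfl; exact hj hi.symm)]
        rw [this]
        exact disjoint_bot_right
      · rw [if_neg hi]
        exact disjoint_bot_left
    · exact eq_top_iff.2 (le_iSup_of_le 0 (by simp))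
  one := 1
  one_mem := by simp

/-- The ground field as a homotopy probability algebra: `M_n` is the iterated product, `K = 0`. -/
def ground (𝕜 : Type u) [Field 𝕜] : HomotopyProbabilityAlgebra 𝕜 𝕜 where
  toPointedGradedSpace := groundSpace 𝕜
  M n := MultilinearMap.mkPiAlgebra 𝕜 (Fin n) 𝕜
  M_graded n _ := by
    have key : ∀ (i : ℤ) (x : 𝕜), x ∈ (groundSpace 𝕜).deg i → i ≠ 0 → x = 0 := by
      intro i x hx hi
      simpa [groundSpace, hi] using hx
    constructor
    · intro d x hx
      by_cases h : ∀ i, d i = 0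
      · simp [groundSpace, h]
      · push Not at h
        obtain ⟨i, hi⟩ := h
        have : MultilinearMap.mkPiAlgebra 𝕜 (Fin n) 𝕜 x = 0 := by
          rw [MultilinearMap.mkPiAlgebra_apply]
          exact Finset.prod_eq_zero (Finset.mem_univ i) (key _ _ (hx i) hi)
        rw [this]
        exact Submodule.zero_mem _
    · intro σ d x hx
      simp only [MultilinearMap.mkPiAlgebra_apply, Equiv.prod_comp σ x]
      by_cases h : ∀ i, d i = 0
      · simp [permSign, h]
      · push Not at h
        obtain ⟨i, hi⟩ := h
        rw [Finset.prod_eq_zero (Finset.mem_univ i) (key _ _ (hx i) hi), smul_zero]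
  M_id x := by simp
  M_unit n _ x := by
    simp [MultilinearMap.mkPiAlgebra_apply, Fin.prod_univ_castSucc, groundSpace]
  K := 0
  K_mem i x _ := by simp
  K_K x := by simp
  K_one := by simp
  one_notMem_range := by simp [groundSpace]

section PAlg

variable {𝕜 : Type u} {V : Type v} {W : Type w} [Field 𝕜] [AddCommGroup V] [Module 𝕜 V]
  [AddCommGroup W] [Module 𝕜 W]

/-- A morphism of homotopy probability algebras: a pointed cochain map. -/
structure PAlgHom (A : HomotopyProbabilityAlgebra 𝕜 V) (B : HomotopyProbabilityAlgebra 𝕜 W) where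
  toLinearMap : V →ₗ[𝕜] W
  map_mem : ∀ i, ∀ x ∈ A.deg i, toLinearMap x ∈ B.deg i
  map_K : ∀ x, toLinearMap (A.K x) = B.K (toLinearMap x)
  map_one : toLinearMap A.one = B.one

/-- `f` and `g` are pointed cochain homotopic. -/
def PAlgHom.Homotopic {A : HomotopyProbabilityAlgebra 𝕜 V} {B : HomotopyProbabilityAlgebra 𝕜 W}
    (f g : PAlgHom A B) : Prop :=
  ∃ s : V →ₗ[𝕜] W, (∀ i, ∀ x ∈ A.deg i, s x ∈ B.deg (i - 1)) ∧ s A.one = 0 ∧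
    ∀ x, g.toLinearMap x = f.toLinearMap x + s (A.K x) + B.K (s x)

end PAlg

/-- A homotopy probability space: a homotopy probability algebra together with the homotopy type
`[c]` of a morphism (the expectation) to the ground field. -/
structure HomotopyProbabilitySpace (𝕜 : Type u) (C : Type v) [Field 𝕜] [AddCommGroup C]
    [Module 𝕜 C] where
  algebra : HomotopyProbabilityAlgebra 𝕜 C
  expectation : Quot (PAlgHom.Homotopic (A := algebra) (B := ground 𝕜))

/-- The descendant `ℓ^K` of a homotopy probability algebra, defined by recursion on `n` from
`K M_n(x_1, …, x_n) = ∑ ε(π, i) M_{|π|}(x_{B_1}, …, ℓ^K(x_{B_i}), …, x_{B_{|π|}})`, the sum being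
over all `π` and `i` with `|B_i| = n - |π| + 1`; the summand for `|π| = 1` is
`ℓ^K_n(x_1, …, x_n)`. -/
def descendant {𝕜 : Type u} {V : Type v} [Field 𝕜] [AddCommGroup V] [Module 𝕜 V]
    (A : HomotopyProbabilityAlgebra 𝕜 V) (n : ℕ) (d : Fin n → ℤ) (x : Fin n → V) : V :=
  A.K (A.M n x) - ∑ π : OrderedFinpartition n, ∑ i : Fin π.length,
    if _h : π.partSize i + π.length = n + 1 ∧ π.length ≠ 1 then
      insertionSign d π i • A.M π.length
        (Function.update (fun j => x (blockHead π j)) i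
          (descendant A (π.partSize i) (fun k => d (π.emb i k)) (fun k => x (π.emb i k))))
    else 0
termination_by n
decreasing_by
  have := i.pos
  omega

/-! ### Unital `sL∞`-morphisms and their homotopies -/

section SL

variable {𝕜 : Type u} {V : Type v} {W : Type w} [Field 𝕜] [AddCommGroup V] [Module 𝕜 V]
  [AddCommGroup W] [Module 𝕜 W]

/-- A unital `sL∞`-morphism `φ = φ_1, φ_2, …` from `(V, 1_V, ℓ)` to `(W, 1_W, ℓ')`.
(`φ 0` plays no role.) -/
structure UnitalSLMorphism (X : PointedGradedSpace 𝕜 V) (ℓ : Operations V V)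
    (Y : PointedGradedSpace 𝕜 W) (ℓ' : Operations W W) where
  φ : ∀ n : ℕ, MultilinearMap 𝕜 (fun _ : Fin n => V) W
  graded : ∀ n, 1 ≤ n → IsGradedSymm X Y 0 (φ n)
  relation : ∀ n, 1 ≤ n → ∀ (d : Fin n → ℤ) (x : Fin n → V), (∀ i, x i ∈ X.deg (d i)) →
    composeSum ℓ' (ops φ) n d x = insertSum (ops φ) ℓ n d x
  map_one : φ 1 (fun _ => X.one) = Y.one
  map_unit : ∀ n, 1 ≤ n → ∀ x : Fin n → V, φ (n + 1) (Fin.snoc (α := fun _ => V) x X.one) = 0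

/-- The first component `φ_1` as a linear map. -/
def UnitalSLMorphism.linear {X : PointedGradedSpace 𝕜 V} {ℓ : Operations V V}
    {Y : PointedGradedSpace 𝕜 W} {ℓ' : Operations W W} (f : UnitalSLMorphism X ℓ Y ℓ') :
    V →ₗ[𝕜] W :=
  (MultilinearMap.ofSubsingleton 𝕜 V W (0 : Fin 1)).symm (f.φ 1)

/-- Multilinear maps `V^n → W` depending polynomially on a parameter `τ`: `∑ k, τ^k f_k`. -/
abbrev PolyFamily (𝕜 : Type u) (V : Type v) (W : Type w) [Field 𝕜] [AddCommGroup V] [Module 𝕜 V]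
    [AddCommGroup W] [Module 𝕜 W] (n : ℕ) : Type (max v w) :=
  ℕ →₀ MultilinearMap 𝕜 (fun _ : Fin n => V) W

/-- The value at `τ`. -/
def PolyFamily.eval {n : ℕ} (p : PolyFamily 𝕜 V W n) (τ : 𝕜) :
    MultilinearMap 𝕜 (fun _ : Fin n => V) W :=
  p.sum fun k f => τ ^ k • f

/-- The value at `τ` of the derivative `d/dτ`. -/
def PolyFamily.evalDeriv {n : ℕ} (p : PolyFamily 𝕜 V W n) (τ : 𝕜) :
    MultilinearMap 𝕜 (fun _ : Fin n => V) W :=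
  p.sum fun k f => ((k : 𝕜) * τ ^ (k - 1)) • f

/-- `ψ` is reached from `φ` at time `1` by the homotopy flow generated by a polynomial family `η` of
unital `sL∞`-homotopies. -/
def UnitalSLMorphism.Homotopic {X : PointedGradedSpace 𝕜 V} {ℓ : Operations V V}
    {Y : PointedGradedSpace 𝕜 W} {ℓ' : Operations W W} (φ ψ : UnitalSLMorphism X ℓ Y ℓ') : Prop :=
  ∃ (η Φ : ∀ n : ℕ, PolyFamily 𝕜 V W n),
    (∀ n, 1 ≤ n → ∀ τ, IsGradedSymm X Y (-1) ((η n).eval τ)) ∧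
    (∀ (n : ℕ) (τ : 𝕜) (x : Fin n → V),
      (η (n + 1)).eval τ (Fin.snoc (α := fun _ => V) x X.one) = 0) ∧
    (∀ n, 1 ≤ n → ∀ τ, IsGradedSymm X Y 0 ((Φ n).eval τ)) ∧
    (∀ n, 1 ≤ n → ∀ (τ : 𝕜) (d : Fin n → ℤ) (x : Fin n → V), (∀ i, x i ∈ X.deg (d i)) →
      (Φ n).evalDeriv τ x =
        insertSum (ops fun k => (η k).eval τ) ℓ n d x
          + flowSum ℓ' (ops fun k => (Φ k).eval τ) (ops fun k => (η k).eval τ) n d x) ∧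
    (∀ n, 1 ≤ n → (Φ n).eval 0 = φ.φ n) ∧
    (∀ n, 1 ≤ n → (Φ n).eval 1 = ψ.φ n)

/-- The cohomology `ker δ / im δ` of `(V, δ)`. -/
abbrev Cohomology (δ : V →ₗ[𝕜] V) : Type v :=
  LinearMap.ker δ ⧸ (LinearMap.range δ).comap (LinearMap.ker δ).subtype

/-- The map induced on cohomology by a cochain map. -/
def cohomologyMap {δ : V →ₗ[𝕜] V} {δ' : W →ₗ[𝕜] W} (f : V →ₗ[𝕜] W)
    (hf : ∀ x, f (δ x) = δ' (f x)) : Cohomology δ →ₗ[𝕜] Cohomology δ' :=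
  Submodule.mapQ _ _
    (f.restrict (p := LinearMap.ker δ) (q := LinearMap.ker δ') (fun x hx => by
      rw [LinearMap.mem_ker] at hx ⊢
      rw [← hf, hx, map_zero]))
    (by
      rintro ⟨x, hx⟩ ⟨y, hy⟩
      exact ⟨f y, by rw [← hf, hy]; rfl⟩)

/-- `f` is a cochain map inducing an isomorphism on cohomology. -/
def IsQuasiIso (δ : V →ₗ[𝕜] V) (δ' : W →ₗ[𝕜] W) (f : V →ₗ[𝕜] W) : Prop :=
  ∃ hf : ∀ x, f (δ x) = δ' (f x), Function.Bijective (cohomologyMap f hf)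

end SL

section Complete

variable {𝕜 : Type u} {C : Type v} {S : Type w} [Field 𝕜] [AddCommGroup C] [Module 𝕜 C]
  [AddCommGroup S] [Module 𝕜 S]

/-- A unital `sL∞`-quasi-isomorphism from `(S, 1_S, 0)` (zero `sL∞`-structure) to the descendant
`(C, 1_C, ℓ^K)` of a homotopy probability algebra. -/
structure SLQuasiIso (X : PointedGradedSpace 𝕜 S) (A : HomotopyProbabilityAlgebra 𝕜 C) extends
    UnitalSLMorphism X (fun _ _ _ => 0) A.toPointedGradedSpace (descendant A) where
  isQuasiIso : IsQuasiIso 0 A.K toUnitalSLMorphism.linear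

/-- `sL∞`-homotopic quasi-isomorphisms. -/
def SLQuasiIso.Homotopic {X : PointedGradedSpace 𝕜 S} {A : HomotopyProbabilityAlgebra 𝕜 C}
    (φ ψ : SLQuasiIso X A) : Prop :=
  φ.toUnitalSLMorphism.Homotopic ψ.toUnitalSLMorphism

end Complete

/-- A complete space of homotopical random variables: a unital `sL∞`-algebra `(S, 1_S, 0)` with
zero structure, together with the homotopy type of a unital `sL∞`-quasi-isomorphism into the
descendant of `A`. -/
structure CompleteRVSpace {𝕜 : Type u} {C : Type v} [Field 𝕜] [AddCommGroup C] [Module 𝕜 C]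
    (A : HomotopyProbabilityAlgebra 𝕜 C) (S : Type w) [AddCommGroup S] [Module 𝕜 S] where
  space : PointedGradedSpace 𝕜 S
  homotopyType : Quot (SLQuasiIso.Homotopic (X := space) (A := A))

section Existence

variable {𝕜 : Type u} {V : Type v} {W : Type w} [Field 𝕜] [AddCommGroup V] [Module 𝕜 V]
  [AddCommGroup W] [Module 𝕜 W]

theorem PointedGradedSpace.induction (X : PointedGradedSpace 𝕜 V) {p : V → Prop}
    (h0 : p 0) (hd : ∀ i, ∀ x ∈ X.deg i, p x) (ha : ∀ x y, p x → p y → p (x + y)) (x : V) : p x := by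
  have hx : x ∈ ⨆ i, X.deg i := by
    rw [X.isInternal.submodule_iSup_eq_top]; trivial
  exact Submodule.iSup_induction X.deg (motive := p) hx hd h0 ha

theorem PointedGradedSpace.exists_proj (X : PointedGradedSpace 𝕜 V) :
    ∃ p : ℤ → V →ₗ[𝕜] V, (∀ i x, p i x ∈ X.deg i) ∧ (∀ i, ∀ x ∈ X.deg i, p i x = x) ∧
      ∀ i j, ∀ x ∈ X.deg i, i ≠ j → p j x = 0 := by
  let := X.isInternal.chooseDecomposition
  refine ⟨fun i => (X.deg i).subtype ∘ₗ DirectSum.component 𝕜 ℤ (fun i => X.deg i) i ∘ₗ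
    (DirectSum.decomposeLinearEquiv X.deg).toLinearMap, fun i x => Subtype.property _, ?_, ?_⟩
  · intro i x hx
    exact DirectSum.decompose_of_mem_same X.deg hx
  · intro i j x hx hij
    exact DirectSum.decompose_of_mem_ne X.deg hx hij

theorem exists_homogeneousPart (X : PointedGradedSpace 𝕜 V) (k : ℤ) (g : V →ₗ[𝕜] W)
    (p : ℤ → W →ₗ[𝕜] W) : ∃ g' : V →ₗ[𝕜] W, ∀ i, ∀ x ∈ X.deg i, g' x = p (i + k) (g x) := by
  let := X.isInternal.chooseDecomposition
  refine ⟨DirectSum.toModule 𝕜 ℤ W (fun i => p (i + k) ∘ₗ g ∘ₗ (X.deg i).subtype) ∘ₗ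
    (DirectSum.decomposeLinearEquiv X.deg).toLinearMap, ?_⟩
  intro i x hx
  simp only [LinearMap.comp_apply, LinearEquiv.coe_coe, DirectSum.decomposeLinearEquiv_apply]
  rw [DirectSum.decompose_of_mem X.deg hx, ← DirectSum.lof_eq_of 𝕜, DirectSum.toModule_lof]
  rfl

/-- A quasi-isomorphism from a complex with zero differential has a homotopy inverse. -/
theorem exists_homotopyInverse_aux (X : PointedGradedSpace 𝕜 W) (Y : PointedGradedSpace 𝕜 V)
    (K : V →ₗ[𝕜] V) (hK : ∀ i, ∀ x ∈ Y.deg i, K x ∈ Y.deg (i + 1)) (hKK : ∀ x, K (K x) = 0)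
    (f : W →ₗ[𝕜] V) (hf : ∀ i, ∀ x ∈ X.deg i, f x ∈ Y.deg i) (hq : IsQuasiIso 0 K f) :
    ∃ h : V →ₗ[𝕜] W, (∀ i, ∀ x ∈ Y.deg i, h x ∈ X.deg i) ∧ (∀ x, h (K x) = 0) ∧
      (∀ s, h (f s) = s) ∧ ∃ β : V →ₗ[𝕜] V, (∀ i, ∀ x ∈ Y.deg i, β x ∈ Y.deg (i - 1)) ∧
        ∀ x, f (h x) = x + K (β x) + β (K x) := by
  obtain ⟨hc, hinj, hsurj⟩ := hq
  have hKf : ∀ s, K (f s) = 0 := fun s => by rw [← hc]; simp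
  have inj : ∀ s, f s ∈ LinearMap.range K → s = 0 := by
    intro s hs
    have hs0 : s ∈ LinearMap.ker (0 : W →ₗ[𝕜] W) := by simp
    have h1 : cohomologyMap f hc (Submodule.Quotient.mk ⟨s, hs0⟩) = 0 := by
      rw [cohomologyMap, Submodule.mapQ_apply, Submodule.Quotient.mk_eq_zero]
      exact hs
    have h2 := hinj (h1.trans (map_zero _).symm)
    rw [Submodule.Quotient.mk_eq_zero] at h2
    obtain ⟨y, hy⟩ := h2
    simpa using hy.symm
  have surj : ∀ y, K y = 0 → ∃ s, y - f s ∈ LinearMap.range K := by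
    intro y hy
    obtain ⟨q, hq⟩ := hsurj (Submodule.Quotient.mk ⟨y, hy⟩)
    obtain ⟨⟨s, hs⟩, rfl⟩ := Submodule.Quotient.mk_surjective _ q
    rw [cohomologyMap, Submodule.mapQ_apply, eq_comm, Submodule.Quotient.eq] at hq
    exact ⟨s, hq⟩
  obtain ⟨g, hg⟩ := LinearMap.exists_leftInverse_of_injective
    ((LinearMap.range K).mkQ ∘ₗ f) (by
      rw [LinearMap.ker_eq_bot']
      intro s hs
      exact inj s (by simpa using hs))
  obtain ⟨σ', hσ'⟩ := LinearMap.exists_rightInverse_of_surjective K.rangeRestrict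
    (LinearMap.range_rangeRestrict K)
  obtain ⟨σ, hσ⟩ := LinearMap.exists_extend σ'
  have hσK : ∀ x, K (σ (K x)) = K x := by
    intro x
    have h1 : σ (K x) = σ' (K.rangeRestrict x) := by
      rw [← hσ]; rfl
    have h2 := congrArg Subtype.val (LinearMap.congr_fun hσ' (K.rangeRestrict x))
    rw [h1]
    exact h2
  set h₁ : V →ₗ[𝕜] W := g ∘ₗ (LinearMap.range K).mkQ with hh₁
  have h₁K : ∀ x, h₁ (K x) = 0 := by
    intro x
    have : (LinearMap.range K).mkQ (K x) = 0 := by simp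
    rw [hh₁, LinearMap.comp_apply, this, map_zero]
  have h₁f : ∀ s, h₁ (f s) = s := fun s => LinearMap.congr_fun hg s
  set h₀ : V →ₗ[𝕜] W := h₁ ∘ₗ (LinearMap.id - σ ∘ₗ K) with hh₀
  have h₀v : ∀ x, h₀ x = h₁ (x - σ (K x)) := fun x => rfl
  set β₀ : V →ₗ[𝕜] V := - (σ ∘ₗ (LinearMap.id - σ ∘ₗ K - f ∘ₗ h₀)) with hβ₀
  have β₀v : ∀ x, β₀ x = - σ (x - σ (K x) - f (h₀ x)) := fun x => rfl
  have h₀K : ∀ x, h₀ (K x) = 0 := fun x => by rw [h₀v, hKK, map_zero, sub_zero, h₁K]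
  have h₀f : ∀ s, h₀ (f s) = s := fun s => by rw [h₀v, hKf, map_zero, sub_zero, h₁f]
  have hh : ∀ x, f (h₀ x) = x + K (β₀ x) + β₀ (K x) := by
    intro x
    have hz : K (x - σ (K x)) = 0 := by rw [map_sub, hσK, sub_self]
    obtain ⟨s, w, hw⟩ := surj _ hz
    have hs : s = h₀ x := by
      have : h₁ (x - σ (K x) - f s) = 0 := by rw [← hw, h₁K]
      rw [map_sub, h₁f, sub_eq_zero] at this
      rw [h₀v, this]
    subst hs
    rw [β₀v, β₀v, h₀K, hKK, map_neg, ← hw, hσK, hw]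
    simp only [map_zero, sub_zero]
    abel
  obtain ⟨p, hp1, hp2, hp3⟩ := X.exists_proj
  obtain ⟨q, hq1, hq2, hq3⟩ := Y.exists_proj
  have qf : ∀ i s, q i (f s) = f (p i s) := by
    intro i
    refine X.induction (by simp) ?_ (fun x y hx hy => by simp only [map_add, hx, hy])
    intro j s hs
    by_cases hij : j = i
    · subst hij
      rw [hp2 _ _ hs, hq2 _ _ (hf _ _ hs)]
    · rw [hp3 _ _ _ hs hij, hq3 _ _ _ (hf _ _ hs) hij, map_zero]
  have qK : ∀ i x, q (i + 1) (K x) = K (q i x) := by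
    intro i
    refine Y.induction (by simp) ?_ (fun x y hx hy => by simp only [map_add, hx, hy])
    intro j s hs
    by_cases hij : j = i
    · subst hij
      rw [hq2 _ _ hs, hq2 _ _ (hK _ _ hs)]
    · rw [hq3 _ _ _ hs hij, hq3 _ _ _ (hK _ _ hs) (by simpa using hij), map_zero]
  obtain ⟨h, hh'⟩ := exists_homogeneousPart Y 0 h₀ p
  obtain ⟨β, hβ'⟩ := exists_homogeneousPart Y (-1) β₀ q
  simp only [add_zero] at hh'
  refine ⟨h, ?_, ?_, ?_, β, ?_, ?_⟩
  · intro i x hx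
    rw [hh' i x hx]; exact hp1 _ _
  · refine Y.induction (by simp) ?_ (fun x y hx hy => by simp only [map_add, hx, hy, add_zero])
    intro i x hx
    rw [hh' _ _ (hK i x hx), h₀K, map_zero]
  · refine X.induction (by simp) ?_ (fun x y hx hy => by simp only [map_add, hx, hy])
    intro i x hx
    rw [hh' _ _ (hf i x hx), h₀f, hp2 _ _ hx]
  · intro i x hx
    rw [hβ' i x hx]; exact hq1 _ _
  · refine Y.induction (by simp) ?_ (fun x y hx hy => by
      simp only [map_add, hx, hy]; abel)
    intro i x hx
    rw [hh' i x hx, hβ' i x hx, hβ' _ _ (hK i x hx), ← qf, hh, map_add, map_add, hq2 _ _ hx]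
    have h1 := qK (i + -1) (β₀ x)
    rw [show i + -1 + 1 = i by ring] at h1
    rw [h1, show i + 1 + -1 = i by ring]

end Existence

section Complete

variable {𝕜 : Type u} {C : Type v} {S : Type w} [Field 𝕜] [AddCommGroup C] [Module 𝕜 C]
  [AddCommGroup S] [Module 𝕜 S]

/-- A homotopy inverse `h` of `f = φ_1 : (S, 0) → (C, K)`: a cochain map of degree `0` with
`h f = id` and `f h = id + K β + β K` for some `β` of degree `-1`. -/
structure HomotopyInverse {X : PointedGradedSpace 𝕜 S} {A : HomotopyProbabilityAlgebra 𝕜 C}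
    (φ : SLQuasiIso X A) where
  h : C →ₗ[𝕜] S
  h_mem : ∀ i, ∀ x ∈ A.deg i, h x ∈ X.deg i
  h_K : ∀ x, h (A.K x) = 0
  left_inv : ∀ s, h (φ.linear s) = s
  right_inv : ∃ β : C →ₗ[𝕜] C, (∀ i, ∀ x ∈ A.deg i, β x ∈ A.deg (i - 1)) ∧
    ∀ x, φ.linear (h x) = x + A.K (β x) + β (A.K x)

/-- Homotopy inverses exist. -/
theorem nonempty_homotopyInverse {X : PointedGradedSpace 𝕜 S}
    {A : HomotopyProbabilityAlgebra 𝕜 C} (φ : SLQuasiIso X A) : Nonempty (HomotopyInverse φ) := by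
  obtain ⟨h, h1, h2, h3, h4⟩ := exists_homotopyInverse_aux X A.toPointedGradedSpace A.K A.K_mem
    A.K_K φ.linear (fun i x hx => by
      have := (φ.graded 1 le_rfl).map_mem (fun _ => i) (fun _ => x) (fun _ => hx)
      simpa [UnitalSLMorphism.linear] using this) φ.isQuasiIso
  exact ⟨⟨h, h1, h2, h3, h4⟩⟩

/-- The correlation densities
`Π_n(s_1, …, s_n) = ∑_π ε(π) M_{|π|}(φ(s_{B_1}), …, φ(s_{B_{|π|}}))`. -/
def correlationDensity {X : PointedGradedSpace 𝕜 S} {A : HomotopyProbabilityAlgebra 𝕜 C}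
    (φ : SLQuasiIso X A) : Operations S C :=
  composeSum (ops A.M) (ops φ.φ)

/-- The moment morphism `μ_n = c ∘ Π_n`. -/
def moment {X : PointedGradedSpace 𝕜 S} {A : HomotopyProbabilityAlgebra 𝕜 C}
    (c : PAlgHom A (ground 𝕜)) (φ : SLQuasiIso X A) : Operations S 𝕜 :=
  fun n d s => c.toLinearMap (correlationDensity φ n d s)

/-- The expectation `ι = c ∘ φ_1` on `S`. -/
def iota {X : PointedGradedSpace 𝕜 S} {A : HomotopyProbabilityAlgebra 𝕜 C}
    (c : PAlgHom A (ground 𝕜)) (φ : SLQuasiIso X A) : S →ₗ[𝕜] 𝕜 :=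
  c.toLinearMap ∘ₗ φ.linear

/-- The correlation algebra structure `M_n = h ∘ Π_n` on `S`. -/
def correlationM {X : PointedGradedSpace 𝕜 S} {A : HomotopyProbabilityAlgebra 𝕜 C}
    {φ : SLQuasiIso X A} (h : HomotopyInverse φ) : Operations S S :=
  fun n d s => h.h (correlationDensity φ n d s)

end Complete

/-- The operations `m_2, m_3, …` determined by the family `M_1, M_2, …` through
`M_n(v_1, …, v_n) = ∑_π ε(π) M_{|π|}(v_{B_1}, …, v_{B_{|π|-1}}, m(v_{B_{|π|}}))`, the sum being over
all `π` such that `|B_{|π|}| = n - |π| + 1` and `n - 1` and `n` belong to the same block (which is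
then the last block `B_{|π|}`); the summand for `|π| = 1` is `m_n(v_1, …, v_n)`.
(The values for `n < 2` play no role.) -/
def mOps {S : Type w} [AddCommGroup S] (M : Operations S S) :
    (n : ℕ) → (Fin n → ℤ) → (Fin n → S) → S
  | 0, _, _ => 0
  | 1, _, _ => 0
  | n + 2, d, v =>
    M (n + 2) d v - ∑ π : OrderedFinpartition (n + 2),
      if _h : π.partSize (π.index (Fin.last (n + 1))) + π.length = n + 3 ∧
          π.index (Fin.last n).castSucc = π.index (Fin.last (n + 1)) ∧ π.length ≠ 1 then
        partitionSign d π • M π.length (blockDegree d π)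
          (Function.update (fun j => v (blockHead π j)) (π.index (Fin.last (n + 1)))
            (mOps M (π.partSize (π.index (Fin.last (n + 1)))) (fun k => d (π.emb _ k))
              (fun k => v (π.emb _ k))))
      else 0
termination_by n => n
decreasing_by
  have := (π.index (Fin.last (n + 1))).pos
  omega

/-! ### Formal power series in graded commutative variables -/

section Series

/-- The formal power series algebra `𝕜[[t^α : α ∈ J]]` in graded commutative variables `t^α` whose
degrees have the parities of the `deg α`: power series in the even variables, whose coefficients
are elements of the exterior algebra on the odd variables. -/
abbrev Series (𝕜 : Type u) [Field 𝕜] {J : Type v} (deg : J → ℤ) : Type (max u v) :=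
  MvPowerSeries {α : J // Even (deg α)} (ExteriorAlgebra 𝕜 ({α : J // ¬ Even (deg α)} →₀ 𝕜))

variable {𝕜 : Type u} [Field 𝕜] {J : Type v} {deg : J → ℤ}

/-- The variable `t^α`. -/
def coord (α : J) : Series 𝕜 deg :=
  if h : Even (deg α) then MvPowerSeries.X ⟨α, h⟩
  else MvPowerSeries.C (ExteriorAlgebra.ι 𝕜 (Finsupp.single ⟨α, h⟩ 1))

/-- The graded (left) derivation `∂_α = ∂/∂t^α`. For `t^α` even it is the usual formal partial
derivative; for `t^α` odd it acts on the coefficients as the left contraction (an odd derivation of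
the exterior algebra) with the linear form that takes the value `1` at `t^α` and `0` at the other
odd variables. -/
def pderiv (α : J) (F : Series 𝕜 deg) : Series 𝕜 deg :=
  if h : Even (deg α) then
    fun m => (m ⟨α, h⟩ + 1) • MvPowerSeries.coeff (m + Finsupp.single ⟨α, h⟩ 1) F
  else
    fun m => CliffordAlgebra.contractLeft
      (Finsupp.lapply ⟨α, h⟩ : ({α : J // ¬ Even (deg α)} →₀ 𝕜) →ₗ[𝕜] 𝕜)
      (MvPowerSeries.coeff m F)

/-- The reversed product `t^{ρ_n} ⋯ t^{ρ_1}`. -/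
def revMonomial {n : ℕ} (ρ : Fin n → J) : Series 𝕜 deg :=
  (List.ofFn fun i => coord (ρ i)).reverse.prod

/-- The infinite sum `∑_n F_n` of formal power series, coefficient by coefficient: for every
exponent of the even variables, only finitely many `F_n` may contribute. -/
def formalSum (F : ℕ → Series 𝕜 deg) : Series 𝕜 deg :=
  fun m => ∑ᶠ n, MvPowerSeries.coeff m (F n)

/-- `∑_{n ≥ 1} 1/n! ∑_{ρ_1, …, ρ_n} t^{ρ_n} ⋯ t^{ρ_1} a_{ρ_1 ⋯ ρ_n}`. -/
def generatingSeries [Fintype J] (a : ∀ n : ℕ, (Fin n → J) → 𝕜) : Series 𝕜 deg :=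
  formalSum fun n => ((n + 1).factorial : 𝕜)⁻¹ •
    ∑ ρ : Fin (n + 1) → J, a (n + 1) ρ • revMonomial ρ

end Series

section Tensors

variable {𝕜 : Type u} {C : Type v} {S : Type w} [Field 𝕜] [AddCommGroup C] [Module 𝕜 C]
  [AddCommGroup S] [Module 𝕜 S] {J : Type*} [Fintype J]

/-- The structure constants `m_{α_1 ⋯ α_n}^γ` of a family of operations in the basis `e`, where
`e_α` has degree `deg α`. -/
def structureConstant (deg : J → ℤ) (e : Module.Basis J 𝕜 S) (m : Operations S S) (n : ℕ)
    (ρ : Fin n → J) (γ : J) : 𝕜 :=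
  e.repr (m n (fun i => deg (ρ i)) (fun i => e (ρ i))) γ

variable {X : PointedGradedSpace 𝕜 S} {A : HomotopyProbabilityAlgebra 𝕜 C} {φ : SLQuasiIso X A}

/-- The moment generating function
`Z = 1 + ∑_{n ≥ 1} 1/n! ∑ t^{ρ_n} ⋯ t^{ρ_1} μ_n(e_{ρ_1}, …, e_{ρ_n})`. -/
def momentGeneratingFunction (deg : J → ℤ) (e : Module.Basis J 𝕜 S) (c : PAlgHom A (ground 𝕜))
    (φ : SLQuasiIso X A) : Series 𝕜 deg :=
  1 + generatingSeries fun n ρ => moment c φ n (fun i => deg (ρ i)) (fun i => e (ρ i))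

/-- The affine flat coordinates `T^γ = ∑_{n ≥ 1} 1/n! ∑ t^{ρ_n} ⋯ t^{ρ_1} M_{ρ_1 ⋯ ρ_n}^γ`. -/
def flatCoordinate (deg : J → ℤ) (e : Module.Basis J 𝕜 S) (h : HomotopyInverse φ) (γ : J) :
    Series 𝕜 deg :=
  generatingSeries fun n ρ => structureConstant deg e (correlationM h) n ρ γ

/-- The connection coefficients
`A_{αβ}^γ = m_{αβ}^γ + ∑_{n ≥ 1} 1/n! ∑ t^{ρ_n} ⋯ t^{ρ_1} m_{ρ_1 ⋯ ρ_n α β}^γ`. -/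
def connection (deg : J → ℤ) (e : Module.Basis J 𝕜 S) (h : HomotopyInverse φ) (α β γ : J) :
    Series 𝕜 deg :=
  algebraMap 𝕜 _ (structureConstant deg e (mOps (correlationM h)) 2 ![α, β] γ) +
    generatingSeries fun n ρ =>
      structureConstant deg e (mOps (correlationM h)) (n + 2) (Fin.append ρ ![α, β]) γ

end Tensors

end HoProb

end

open HoProb

noncomputable section

namespace HoProb

open List

/-! ### Signed sums over set partitions of a list -/

/-! Everything is reduced to functions of lists of basis labels. Let μ(ρ_1, …, ρ_n) be the moments,
with μ() = 1, and let `genSeries` send a function f of lists to its exponential generating series.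
For graded symmetric f, the derivation ∂_β acts by f ↦ f(·, β) (`pderiv_genSeries`). A product of
series is a signed sum over the splittings of a list into two sublists (`genSeries_mul`). The
theorem thus amounts to three identities for μ.

(1) μ_n = ι ∘ M_n for n ≥ 1. Since φ_1 h = id + Kβ + βK and c ∘ K = 0, it suffices that K Π_n = 0.
By the definition of the descendant, K Π_n is a sum over partitions and then over groupings of their
blocks, where ℓ^K takes all the φ-values of one group. By associativity
(`partitionSum_partitionSum`) the coarse partition may be chosen first and its blocks refined
afterwards. The inner sum over the refinements of the group under ℓ^K is then the left side of the
sL∞-morphism relation, which is zero because 𝒮 has zero structure (`blockwiseSum_insertTerms`,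
`K_correlationDensity`).

(2) Applying ι to the recursion for m and expanding the value of m in the basis gives μ(l, α, β) =
Σ_γ Σ_{l = u ⊔ B} ± m(B, α, β)^γ μ(u, γ) (`momentList_append_pair`). This is the second order
equation, coefficient by coefficient.

(3) μ(l, 0) = μ(l): a unit in a block with other entries kills φ, so the unit stands alone, φ_1
sends it to 1_C, and M_{n+1}(…, 1_C) = M_n.

The Koszul signs are handled by building partitions one letter at a time. A new first letter either
opens a block in front or is put at the head of an existing block, at the cost of passing the
earlier blocks (`partitionSum`; `sum_partitionSign` identifies this with the sum over
`OrderedFinpartition`). Identities of signed sums then become identities between insertion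
operators, proved by induction on the list for arbitrary summands Ψ. The infinite sums make sense
because a monomial with more than |J| odd letters vanishes. -/

/-- The sign `(-1)^(ab)`. -/
def koszul (a b : ℤ) : ℤˣ := (a * b).negOnePow

theorem koszul_comm (a b : ℤ) : koszul a b = koszul b a := by rw [koszul, koszul, mul_comm]

theorem koszul_add_left (a b c : ℤ) : koszul (a + b) c = koszul a c * koszul b c := by
  rw [koszul, add_mul, Int.negOnePow_add]; rfl

theorem koszul_add_right (a b c : ℤ) : koszul a (b + c) = koszul a b * koszul a c := by
  rw [koszul, mul_add, Int.negOnePow_add]; rfl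

@[simp] theorem koszul_mul_self (a b : ℤ) : koszul a b * koszul a b = 1 := Int.units_mul_self _

@[simp] theorem koszul_zero_left (a : ℤ) : koszul 0 a = 1 := by simp [koszul]

@[simp] theorem koszul_zero_right (a : ℤ) : koszul a 0 = 1 := by simp [koszul]

theorem map_units_smul' {W W' : Type*} [AddCommGroup W] [AddCommGroup W'] (g : W →+ W') (s : ℤˣ)
    (w : W) : g (s • w) = s • g w := by
  rw [Units.smul_def, Units.smul_def, map_zsmul]

section

variable {ι κ W W' : Type*} [AddCommGroup W] [AddCommGroup W'] (d : ι → ℤ)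

/-- The total degree of a list of labels. -/
def listDeg (l : List ι) : ℤ := (l.map d).sum

@[simp] theorem listDeg_nil : listDeg d [] = 0 := rfl

@[simp] theorem listDeg_cons (a : ι) (l : List ι) : listDeg d (a :: l) = d a + listDeg d l := by
  simp [listDeg]

@[simp] theorem listDeg_append (l l' : List ι) :
    listDeg d (l ++ l') = listDeg d l + listDeg d l' := by
  simp [listDeg]

theorem listDeg_perm {l l' : List ι} (h : l ~ l') : listDeg d l = listDeg d l' :=
  (h.map d).sum_eq

theorem listDeg_map (g : κ → ι) (l : List κ) : listDeg d (l.map g) = listDeg (d ∘ g) l := by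
  simp [listDeg]

theorem listDeg_flatten (P : List (List ι)) :
    listDeg d P.flatten = listDeg (listDeg d) P := by
  induction P with
  | nil => rfl
  | cons B P ih => simp [ih]

/-- The signed sum of the values of `Ψ` at the partitions which arise from `P` by adding `a` on the
left of one of its blocks. -/
def insertMid (a : ι) : (List (List ι) → W) → List (List ι) → W
  | _, [] => 0
  | Ψ, B :: P => Ψ ((a :: B) :: P) +
      koszul (d a) (listDeg d B) • insertMid a (fun P' => Ψ (B :: P')) P

/-- The signed sum of the values of `Ψ` at the partitions which arise from `P` by adding `a` on the
left, as a new block or as the first element of one of the blocks. -/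
def insertFirst (a : ι) (Ψ : List (List ι) → W) (P : List (List ι)) : W :=
  Ψ ([a] :: P) + insertMid d a Ψ P

/-- The signed sum `∑_π ε(π) Ψ(π)` over the partitions of a list. -/
def partitionSum : (List (List ι) → W) → List ι → W
  | Ψ, [] => Ψ []
  | Ψ, a :: l => partitionSum (insertFirst d a Ψ) l

@[simp] theorem insertMid_nil (a : ι) (Ψ : List (List ι) → W) : insertMid d a Ψ [] = 0 := rfl

theorem insertMid_cons (a : ι) (Ψ : List (List ι) → W) (B : List ι) (P : List (List ι)) :
    insertMid d a Ψ (B :: P) = Ψ ((a :: B) :: P) +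
      koszul (d a) (listDeg d B) • insertMid d a (fun P' => Ψ (B :: P')) P := rfl

@[simp] theorem partitionSum_nil (Ψ : List (List ι) → W) : partitionSum d Ψ [] = Ψ [] := rfl

theorem partitionSum_cons (a : ι) (l : List ι) (Ψ : List (List ι) → W) :
    partitionSum d Ψ (a :: l) = partitionSum d (insertFirst d a Ψ) l := rfl

@[simp] theorem partitionSum_singleton (a : ι) (Ψ : List (List ι) → W) :
    partitionSum d Ψ [a] = Ψ [[a]] := by
  simp [partitionSum_cons, insertFirst]

theorem insertMid_add (a : ι) (Ψ Ψ' : List (List ι) → W) (P : List (List ι)) :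
    insertMid d a (fun P => Ψ P + Ψ' P) P = insertMid d a Ψ P + insertMid d a Ψ' P := by
  induction P generalizing Ψ Ψ' with
  | nil => simp
  | cons B P ih => simp only [insertMid_cons, ih, smul_add]; abel

theorem insertMid_map (g : W →+ W') (a : ι) (Ψ : List (List ι) → W) (P : List (List ι)) :
    insertMid d a (fun P => g (Ψ P)) P = g (insertMid d a Ψ P) := by
  induction P generalizing Ψ with
  | nil => simp
  | cons B P ih => simp only [insertMid_cons, ih, map_add, map_units_smul']

theorem insertMid_smul (s : ℤˣ) (a : ι) (Ψ : List (List ι) → W) (P : List (List ι)) :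
    insertMid d a (fun P => s • Ψ P) P = s • insertMid d a Ψ P :=
  insertMid_map d (DistribSMul.toAddMonoidHom W s) a Ψ P

theorem insertMid_zero (a : ι) (P : List (List ι)) :
    insertMid d a (fun _ => (0 : W)) P = 0 :=
  insertMid_map d (0 : W →+ W) a (fun _ => 0) P

theorem insertFirst_add (a : ι) (Ψ Ψ' : List (List ι) → W) (P : List (List ι)) :
    insertFirst d a (fun P => Ψ P + Ψ' P) P = insertFirst d a Ψ P + insertFirst d a Ψ' P := by
  simp only [insertFirst, insertMid_add]; abel

theorem insertFirst_map (g : W →+ W') (a : ι) (Ψ : List (List ι) → W) (P : List (List ι)) :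
    insertFirst d a (fun P => g (Ψ P)) P = g (insertFirst d a Ψ P) := by
  simp only [insertFirst, insertMid_map, map_add]

theorem partitionSum_add (Ψ Ψ' : List (List ι) → W) (l : List ι) :
    partitionSum d (fun P => Ψ P + Ψ' P) l = partitionSum d Ψ l + partitionSum d Ψ' l := by
  induction l generalizing Ψ Ψ' with
  | nil => simp
  | cons a l ih =>
    simp only [partitionSum_cons, ← ih]
    congr 1
    funext P
    exact insertFirst_add d a Ψ Ψ' P

theorem partitionSum_map (g : W →+ W') (Ψ : List (List ι) → W) (l : List ι) :
    partitionSum d (fun P => g (Ψ P)) l = g (partitionSum d Ψ l) := by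
  induction l generalizing Ψ with
  | nil => simp
  | cons a l ih =>
    simp only [partitionSum_cons, ← ih]
    congr 1
    funext P
    exact insertFirst_map d g a Ψ P

theorem partitionSum_smul (s : ℤˣ) (Ψ : List (List ι) → W) (l : List ι) :
    partitionSum d (fun P => s • Ψ P) l = s • partitionSum d Ψ l :=
  partitionSum_map d (DistribSMul.toAddMonoidHom W s) Ψ l

theorem partitionSum_zero (l : List ι) : partitionSum d (fun _ => (0 : W)) l = 0 :=
  partitionSum_map d (0 : W →+ W) (fun _ => 0) l

/-- A partition of the list `l`: its blocks are non-empty and have the elements of `l`. -/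
def IsPartitionOf (P : List (List ι)) (l : List ι) : Prop :=
  P.flatten ~ l ∧ ∀ B ∈ P, B ≠ []

/-- The tail of a partition is a partition of its own flattening, so the induction continues with
that shorter ground list. -/
theorem insertMid_mem (a : ι) (U : AddSubgroup W) (l : List ι) (P : List (List ι))
    (hP : IsPartitionOf P l) (Ψ : List (List ι) → W)
    (h : ∀ P, IsPartitionOf P (a :: l) → Ψ P ∈ U) : insertMid d a Ψ P ∈ U := by
  induction P generalizing Ψ l with
  | nil => exact U.zero_mem
  | cons B P ih =>
    obtain ⟨h1, h2⟩ := hP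
    rw [insertMid_cons]
    refine U.add_mem (h _ ⟨?_, ?_⟩) ?_
    · simpa using h1
    · simp only [mem_cons, forall_eq_or_imp] at h2 ⊢
      exact ⟨by simp, h2.2⟩
    · rw [Units.smul_def]
      refine U.zsmul_mem (ih P.flatten ⟨Perm.refl _, fun B hB => h2 B (by simp [hB])⟩ _ ?_) _
      intro P' hP'
      refine h _ ⟨?_, ?_⟩
      · rw [flatten_cons] at h1 ⊢
        refine (hP'.1.append_left B).trans ?_
        exact perm_middle.trans (h1.cons a)
      · simp only [mem_cons, forall_eq_or_imp] at h2 ⊢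
        exact ⟨h2.1, hP'.2⟩

theorem insertFirst_mem (a : ι) (U : AddSubgroup W) (l : List ι) (P : List (List ι))
    (hP : IsPartitionOf P l) (Ψ : List (List ι) → W)
    (h : ∀ P, IsPartitionOf P (a :: l) → Ψ P ∈ U) : insertFirst d a Ψ P ∈ U := by
  refine U.add_mem (h _ ⟨by simpa using hP.1, ?_⟩) (insertMid_mem d a U l P hP Ψ h)
  simpa using hP.2

/-- Only genuine partitions of `l` are ever reached. With `U = ⊥` this yields congruence, and with
`U` a graded piece it controls degrees. -/
theorem partitionSum_mem (U : AddSubgroup W) (Ψ : List (List ι) → W) (l : List ι)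
    (h : ∀ P, IsPartitionOf P l → Ψ P ∈ U) : partitionSum d Ψ l ∈ U := by
  induction l generalizing Ψ with
  | nil => exact h _ ⟨by simp, by simp⟩
  | cons a l ih => exact ih _ fun P hP => insertFirst_mem d a U l P hP Ψ h

/-- The difference of the two summands lies in the zero subgroup at every partition of `l`. -/
theorem partitionSum_congr {Ψ Ψ' : List (List ι) → W} {l : List ι}
    (h : ∀ P, IsPartitionOf P l → Ψ P = Ψ' P) : partitionSum d Ψ l = partitionSum d Ψ' l := by
  have := partitionSum_mem d (⊥ : AddSubgroup W) (fun P => Ψ P + (-1 : ℤˣ) • Ψ' P) l (by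
    intro P hP
    simp [h P hP])
  rw [partitionSum_add, partitionSum_smul] at this
  simpa [add_neg_eq_zero] using this

theorem insertMid_comp_map (g : κ → ι) (a : κ) (Ψ : List (List ι) → W) (P : List (List κ)) :
    insertMid d (g a) Ψ (P.map (List.map g)) =
      insertMid (d ∘ g) a (fun P => Ψ (P.map (List.map g))) P := by
  induction P generalizing Ψ with
  | nil => rfl
  | cons B P ih =>
    simp only [List.map_cons, insertMid_cons, ih, listDeg_map]
    rfl

/-- Naturality in the labels. -/
theorem partitionSum_comp_map (g : κ → ι) (Ψ : List (List ι) → W) (l : List κ) :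
    partitionSum d Ψ (l.map g) = partitionSum (d ∘ g) (fun P => Ψ (P.map (List.map g))) l := by
  induction l generalizing Ψ with
  | nil => rfl
  | cons a l ih =>
    simp only [List.map_cons, partitionSum_cons, ih]
    congr 1
    funext P
    simp [insertFirst, insertMid_comp_map]

end

section

variable {ι W : Type*} [AddCommGroup W] (d : ι → ℤ)

/-! ### Associativity -/

/-- The signed sum over the ways of adding `a` on the left of an inner block of a partition into
partitions. -/
def insertInner (a : ι) : (List (List (List ι)) → W) → List (List (List ι)) → W
  | _, [] => 0
  | Ψ, P :: T => insertMid d a (fun P' => Ψ (P' :: T)) P +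
      koszul (d a) (listDeg (listDeg d) P) • insertInner a (fun T' => Ψ (P :: T')) T

theorem insertInner_cons (a : ι) (Ψ : List (List (List ι)) → W) (P : List (List ι))
    (T : List (List (List ι))) :
    insertInner d a Ψ (P :: T) = insertMid d a (fun P' => Ψ (P' :: T)) P +
      koszul (d a) (listDeg (listDeg d) P) • insertInner d a (fun T' => Ψ (P :: T')) T := rfl

theorem insertInner_add (a : ι) (Ψ Ψ' : List (List (List ι)) → W) (T : List (List (List ι))) :
    insertInner d a (fun P => Ψ P + Ψ' P) T = insertInner d a Ψ T + insertInner d a Ψ' T := by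
  induction T generalizing Ψ Ψ' with
  | nil => simp [insertInner]
  | cons B P ih => simp only [insertInner_cons, insertMid_add, ih, smul_add]; abel

theorem insertInner_smul (s : ℤˣ) (a : ι) (Ψ : List (List (List ι)) → W)
    (T : List (List (List ι))) :
    insertInner d a (fun P => s • Ψ P) T = s • insertInner d a Ψ T := by
  induction T generalizing Ψ with
  | nil => simp [insertInner]
  | cons B P ih =>
    simp only [insertInner_cons, insertMid_smul, ih, smul_add, smul_smul, mul_comm]

/-- The iterated signed sum over the partitions of each of the blocks of a partition. -/
def blockwiseSum : (List (List (List ι)) → W) → List (List ι) → W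
  | Ψ, [] => Ψ []
  | Ψ, B :: Q => partitionSum d (fun P => blockwiseSum (fun T => Ψ (P :: T)) Q) B

theorem blockwiseSum_cons (Ψ : List (List (List ι)) → W) (B : List ι) (Q : List (List ι)) :
    blockwiseSum d Ψ (B :: Q) =
      partitionSum d (fun P => blockwiseSum d (fun T => Ψ (P :: T)) Q) B := rfl

theorem blockwiseSum_add (Ψ Ψ' : List (List (List ι)) → W) (Q : List (List ι)) :
    blockwiseSum d (fun P => Ψ P + Ψ' P) Q = blockwiseSum d Ψ Q + blockwiseSum d Ψ' Q := by
  induction Q generalizing Ψ Ψ' with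
  | nil => rfl
  | cons B Q ih => simp only [blockwiseSum_cons, ih, partitionSum_add]

theorem blockwiseSum_smul (s : ℤˣ) (Ψ : List (List (List ι)) → W) (Q : List (List ι)) :
    blockwiseSum d (fun P => s • Ψ P) Q = s • blockwiseSum d Ψ Q := by
  induction Q generalizing Ψ with
  | nil => rfl
  | cons B Q ih => simp only [blockwiseSum_cons, ih, partitionSum_smul]

theorem blockwiseSum_zero (Q : List (List ι)) :
    blockwiseSum d (fun _ => (0 : W)) Q = 0 := by
  induction Q with
  | nil => rfl
  | cons B Q ih => simp only [blockwiseSum_cons, ih, partitionSum_zero]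

theorem insertMid_blockwiseSum (a : ι) (Ψ : List (List (List ι)) → List (List ι) → W)
    (P Q : List (List ι)) :
    insertMid d a (fun P => blockwiseSum d (fun T => Ψ T P) Q) P =
      blockwiseSum d (fun T => insertMid d a (Ψ T) P) Q := by
  induction P generalizing Ψ with
  | nil => simp [blockwiseSum_zero]
  | cons B P ih =>
    simp only [insertMid_cons, blockwiseSum_add, blockwiseSum_smul]
    rw [ih (fun T P' => Ψ T (B :: P'))]

/-- The signed sum over the ways of adding `a` on the left of a partition into partitions. -/
def insertNested (a : ι) (Ψ : List (List (List ι)) → W) (T : List (List (List ι))) : W :=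
  insertFirst (listDeg d) [a] Ψ T + insertInner d a Ψ T

theorem insertMid_insertMid_comm {κ : Type*} (d' : κ → ℤ) (a : ι) (b : κ)
    (G : List (List ι) → List (List κ) → W) (P : List (List ι)) (T : List (List κ)) :
    insertMid d a (fun P => insertMid d' b (G P) T) P =
      insertMid d' b (fun T => insertMid d a (fun P => G P T) P) T := by
  induction P generalizing G with
  | nil => simp [insertMid_zero]
  | cons B P ih =>
    simp only [insertMid_cons, insertMid_add, insertMid_smul]
    rw [ih (fun P => G (B :: P))]

theorem insertMid_partitionSum_comm {κ : Type*} (d' : κ → ℤ) (a : ι)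
    (G : List (List κ) → List (List ι) → W) (P : List (List ι)) (l : List κ) :
    insertMid d a (fun P => partitionSum d' (fun T => G T P) l) P =
      partitionSum d' (fun T => insertMid d a (G T) P) l := by
  induction P generalizing G with
  | nil => simp [partitionSum_zero]
  | cons B P ih =>
    simp only [insertMid_cons, partitionSum_add, partitionSum_smul]
    rw [ih (fun T P => G T (B :: P))]

/-- All the partitions produced have the same total degree, larger by that of `a`, so the sign is
constant over the sum. -/
theorem insertMid_koszul_smul (c : ℤ) (a : ι) (Ψ : List (List ι) → W) (P : List (List ι)) :
    insertMid d a (fun P => koszul c (listDeg (listDeg d) P) • Ψ P) P =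
      koszul c (d a + listDeg (listDeg d) P) • insertMid d a Ψ P := by
  induction P generalizing Ψ with
  | nil => simp
  | cons B P ih =>
    simp only [insertMid_cons, listDeg_cons, koszul_add_right, mul_smul, insertMid_smul] at ih ⊢
    simp only [ih, smul_add, smul_smul]
    simp only [mul_comm, mul_left_comm]

/-- After `B` has been put into an outer block as a new inner block, `a` either enters `B` itself or
another inner block. In the second case the two insertions may be exchanged, which costs the sign of
`a` against `B`. -/
theorem insertMid_insertInner (a : ι) (B : List ι) (Ψ : List (List (List ι)) → W)
    (T : List (List (List ι))) :
    insertMid (listDeg d) B (insertInner d a Ψ) T = insertMid (listDeg d) (a :: B) Ψ T +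
      koszul (d a) (listDeg d B) • insertInner d a (insertMid (listDeg d) B Ψ) T := by
  induction T generalizing Ψ with
  | nil => simp [insertInner]
  | cons P T ih =>
    simp only [insertMid_cons, insertInner_cons, insertMid_add, insertMid_smul, ih]
    rw [insertMid_koszul_smul,
      insertMid_insertMid_comm d (listDeg d) a B (fun P' T' => Ψ (P' :: T')), insertInner_add,
      insertInner_smul]
    simp only [listDeg_cons, koszul_add_left, koszul_add_right, smul_add, smul_smul,
      koszul_comm (listDeg d B) (d a)]
    simp only [← mul_assoc, koszul_mul_self, one_mul]
    simp only [mul_comm, mul_assoc]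
    abel

/-- Grouping blocks does not look inside them: enlarging a block and then grouping is the same as
grouping and then enlarging an inner block. -/
theorem insertMid_partitionSum (a : ι) (Ψ : List (List (List ι)) → W) (P : List (List ι)) :
    insertMid d a (partitionSum (listDeg d) Ψ) P =
      partitionSum (listDeg d) (insertInner d a Ψ) P := by
  induction P generalizing Ψ with
  | nil => rfl
  | cons B P ih =>
    rw [insertMid_cons, partitionSum_cons, partitionSum_cons]
    have : (fun P' => partitionSum (listDeg d) Ψ (B :: P')) =
      partitionSum (listDeg d) (insertFirst (listDeg d) B Ψ) := rfl
    rw [this, ih, ← partitionSum_smul, ← partitionSum_add]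
    congr 1
    funext T
    simp only [insertFirst, insertMid_insertInner]
    have : (insertFirst (listDeg d) B Ψ) = fun T => Ψ ([B] :: T) + insertMid (listDeg d) B Ψ T := rfl
    rw [this, insertInner_add, insertInner_cons]
    simp [insertMid_cons]
    abel

theorem insertFirst_partitionSum (a : ι) (Ψ : List (List (List ι)) → W) (P : List (List ι)) :
    insertFirst d a (partitionSum (listDeg d) Ψ) P =
      partitionSum (listDeg d) (insertNested d a Ψ) P := by
  rw [insertFirst, insertMid_partitionSum, partitionSum_cons, ← partitionSum_add]
  rfl

/-- When `a` has joined a block of `Q`, a partition of this block has `a` either as an inner block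
of its own or inside an inner block. These are the two terms on the right. -/
theorem insertMid_blockwiseSum_self (a : ι) (Ψ : List (List (List ι)) → W) (Q : List (List ι)) :
    insertMid d a (blockwiseSum d Ψ) Q =
      blockwiseSum d (fun T => insertMid (listDeg d) [a] Ψ T + insertInner d a Ψ T) Q := by
  induction Q generalizing Ψ with
  | nil => simp [insertInner, blockwiseSum]
  | cons B Q ih =>
    rw [insertMid_cons, blockwiseSum_cons, blockwiseSum_cons, partitionSum_cons]
    have key : insertMid d a (fun P' => blockwiseSum d Ψ (B :: P')) Q =
        partitionSum d (fun P => insertMid d a (blockwiseSum d (fun T => Ψ (P :: T))) Q) B :=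
      insertMid_partitionSum_comm d d a (fun P => blockwiseSum d (fun T => Ψ (P :: T))) Q B
    rw [key, ← partitionSum_smul, ← partitionSum_add]
    -- Here it matters that `P` is a partition of `B`: the cost for `a` to pass `P` is then the cost
    -- to pass `B`.
    refine partitionSum_congr d fun P hP => ?_
    rw [ih, insertFirst, insertMid_blockwiseSum d a (fun T P => Ψ (P :: T)), ← blockwiseSum_smul,
      ← blockwiseSum_add, ← blockwiseSum_add]
    congr 1
    funext T
    rw [insertMid_cons, insertInner_cons, ← listDeg_flatten, listDeg_perm d hP.1]
    simp [smul_add]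
    abel

theorem insertFirst_blockwiseSum (a : ι) (Ψ : List (List (List ι)) → W) (Q : List (List ι)) :
    insertFirst d a (blockwiseSum d Ψ) Q = blockwiseSum d (insertNested d a Ψ) Q := by
  rw [insertFirst, insertMid_blockwiseSum_self, blockwiseSum_cons, partitionSum_singleton,
    ← blockwiseSum_add]
  congr 1
  funext T
  simp only [insertNested, insertFirst]
  abel

/-- A partition of the blocks of a partition is the same as a coarser partition together with a
partition of each of its blocks. -/
theorem partitionSum_partitionSum (Ψ : List (List (List ι)) → W) (l : List ι) :
    partitionSum d (partitionSum (listDeg d) Ψ) l = partitionSum d (blockwiseSum d Ψ) l := by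
  induction l generalizing Ψ with
  | nil => rfl
  | cons a l ih =>
    rw [partitionSum_cons, partitionSum_cons]
    -- Both orders of summation absorb the new letter through the same operator `insertNested`, so
    -- the induction hypothesis applies to a new summand.
    have e1 : insertFirst d a (partitionSum (listDeg d) Ψ) =
      partitionSum (listDeg d) (insertNested d a Ψ) := funext (insertFirst_partitionSum d a Ψ)
    have e2 : insertFirst d a (blockwiseSum d Ψ) = blockwiseSum d (insertNested d a Ψ) :=
      funext (insertFirst_blockwiseSum d a Ψ)
    rw [e1, e2, ih]

end

section

variable {ι W W' : Type*} [AddCommGroup W] [AddCommGroup W'] (d : ι → ℤ)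

/-! ### Graded symmetry -/

/-- `Ψ` is graded symmetric in the blocks and in the entries of each block. -/
structure IsBlockSymm (Ψ : List (List ι) → W) : Prop where
  block : ∀ u B B' v, Ψ (u ++ B :: B' :: v) =
    koszul (listDeg d B) (listDeg d B') • Ψ (u ++ B' :: B :: v)
  entry : ∀ u p a b q v, Ψ (u ++ (p ++ a :: b :: q) :: v) =
    koszul (d a) (d b) • Ψ (u ++ (p ++ b :: a :: q) :: v)

variable {d}

theorem IsBlockSymm.cons {Ψ : List (List ι) → W} (h : IsBlockSymm d Ψ) (B : List ι) :
    IsBlockSymm d fun P => Ψ (B :: P) where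
  block u := h.block (B :: u)
  entry u := h.entry (B :: u)

/-- If `a` enters one of the two exchanged blocks, the exchange sign of the enlarged pair has an
extra factor, which is exactly the change in the cost for `a` to reach its place. -/
theorem IsBlockSymm.insertMid_block {Ψ : List (List ι) → W} (h : IsBlockSymm d Ψ) (a : ι)
    (u : List (List ι)) (B B' : List ι) (v : List (List ι)) :
    insertMid d a Ψ (u ++ B :: B' :: v) =
      koszul (listDeg d B) (listDeg d B') • insertMid d a Ψ (u ++ B' :: B :: v) := by
  induction u generalizing Ψ with
  | nil =>
    have e : (fun v => Ψ (B :: B' :: v)) = fun v =>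
      koszul (listDeg d B) (listDeg d B') • Ψ (B' :: B :: v) := funext (h.block [] B B')
    have e1 := h.block [] (a :: B) B' v
    have e2 := h.block [] B (a :: B') v
    simp only [nil_append] at e1 e2
    simp only [nil_append, insertMid_cons, e1, e2, e, insertMid_smul]
    simp only [listDeg_cons, koszul_add_left, koszul_add_right, smul_add, smul_smul,
      koszul_comm (listDeg d B) (d a)]
    simp only [← mul_assoc, koszul_mul_self, one_mul]
    simp only [mul_comm, mul_assoc]
    abel
  | cons C u ih =>
    have e1 := h.block ((a :: C) :: u) B B' v
    simp only [cons_append] at e1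
    simp only [cons_append, insertMid_cons, ih (h.cons C), e1, smul_add, smul_smul, mul_comm]

theorem IsBlockSymm.insertMid_entry {Ψ : List (List ι) → W} (h : IsBlockSymm d Ψ) (x : ι)
    (u : List (List ι)) (p : List ι) (a b : ι) (q : List ι) (v : List (List ι)) :
    insertMid d x Ψ (u ++ (p ++ a :: b :: q) :: v) =
      koszul (d a) (d b) • insertMid d x Ψ (u ++ (p ++ b :: a :: q) :: v) := by
  induction u generalizing Ψ with
  | nil =>
    have e : (fun v => Ψ ((p ++ a :: b :: q) :: v)) = fun v =>
      koszul (d a) (d b) • Ψ ((p ++ b :: a :: q) :: v) := funext (h.entry [] p a b q)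
    have e1 := h.entry [] (x :: p) a b q v
    simp only [nil_append, cons_append] at e1
    have e2 : listDeg d (p ++ a :: b :: q) = listDeg d (p ++ b :: a :: q) :=
      listDeg_perm d ((Perm.swap _ _ _).append_left p)
    simp only [nil_append, insertMid_cons, e, e1, e2, insertMid_smul, smul_add, smul_smul,
      mul_comm]
  | cons C u ih =>
    have e1 := h.entry ((x :: C) :: u) p a b q v
    simp only [cons_append] at e1
    simp only [cons_append, insertMid_cons, ih (h.cons C), e1, smul_add, smul_smul, mul_comm]

/-- Stability under insertion lets an induction absorb the letters in front of an exchanged pair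
into `Ψ`. -/
theorem IsBlockSymm.insertFirst {Ψ : List (List ι) → W} (h : IsBlockSymm d Ψ) (a : ι) :
    IsBlockSymm d (insertFirst d a Ψ) where
  block u B B' v := by
    have e1 := h.block ([a] :: u) B B' v
    simp only [cons_append] at e1
    rw [HoProb.insertFirst, h.insertMid_block, e1, ← smul_add]
    rfl
  entry u p x y q v := by
    have e1 := h.entry ([a] :: u) p x y q v
    simp only [cons_append] at e1
    rw [HoProb.insertFirst, h.insertMid_entry, e1, ← smul_add]
    rfl

/-- When both letters enter the same block, symmetry in the entries gives the sign. When they enter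
different blocks, the letter going further must pass the other one in just one of the two orders. -/
theorem IsBlockSymm.insertMid_insertMid {Ψ : List (List ι) → W} (h : IsBlockSymm d Ψ) (a b : ι)
    (P : List (List ι)) :
    insertMid d b (insertMid d a Ψ) P = koszul (d a) (d b) • insertMid d a (insertMid d b Ψ) P := by
  induction P generalizing Ψ with
  | nil => simp
  | cons B P ih =>
    have e1 := h.entry [] [] a b B P
    simp only [nil_append] at e1
    simp only [insertMid_cons, insertMid_add, insertMid_smul, ih (h.cons B), e1]
    simp only [listDeg_cons, koszul_add_right, smul_add, smul_smul,
      koszul_comm (d b) (d a)]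
    simp only [← mul_assoc, koszul_mul_self, one_mul]
    simp only [mul_comm, mul_assoc]
    abel

/-- Beyond the previous lemma there are the cases with new blocks: `[a], [b]` uses symmetry in the
blocks, `[a, b]` uses symmetry in the entries, and the mixed cases match term by term. -/
theorem IsBlockSymm.insertFirst_insertFirst {Ψ : List (List ι) → W} (h : IsBlockSymm d Ψ)
    (a b : ι) (P : List (List ι)) :
    HoProb.insertFirst d b (HoProb.insertFirst d a Ψ) P =
      koszul (d a) (d b) • HoProb.insertFirst d a (HoProb.insertFirst d b Ψ) P := by
  have e0 : ∀ x, HoProb.insertFirst d x Ψ = fun P => Ψ ([x] :: P) + insertMid d x Ψ P :=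
    fun _ => rfl
  have e1 := h.entry [] [] a b [] P
  have e2 := h.block [] [a] [b] P
  simp only [nil_append] at e1 e2
  simp only [HoProb.insertFirst, e0, insertMid_add, insertMid_cons, h.insertMid_insertMid a b, e1,
    e2]
  simp only [listDeg_cons, listDeg_nil, add_zero, smul_add, smul_smul, koszul_comm (d b) (d a),
    koszul_mul_self, one_smul]
  abel

/-- A function on lists which is graded symmetric. -/
def IsListSymm (d : ι → ℤ) (f : List ι → W) : Prop :=
  ∀ u a b v, f (u ++ a :: b :: v) = koszul (d a) (d b) • f (u ++ b :: a :: v)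

theorem IsListSymm.append {f : List ι → W} (h : IsListSymm d f) (w : List ι) :
    IsListSymm d fun l => f (l ++ w) := by
  intro u a b v
  simpa using h u a b (v ++ w)

theorem IsListSymm.map {f : List ι → W} (h : IsListSymm d f) (g : W →+ W') :
    IsListSymm d fun l => g (f l) := by
  intro u a b v
  simp only [h u a b v, map_units_smul']

theorem IsBlockSymm.isListSymm {Ψ : List (List ι) → W} (h : IsBlockSymm d Ψ) :
    IsListSymm d (partitionSum d Ψ) := by
  intro u a b v
  induction u generalizing Ψ with
  | nil =>
    simp only [nil_append, partitionSum_cons, ← partitionSum_smul]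
    congr 1
    funext P
    exact h.insertFirst_insertFirst a b P
  | cons x u ih =>
    simp only [cons_append, partitionSum_cons]
    exact ih (h.insertFirst x)

/-! ### Appending a unit -/

theorem insertMid_append (a : ι) (Ψ : List (List ι) → W) (P Q : List (List ι)) :
    insertMid d a Ψ (P ++ Q) = insertMid d a (fun P => Ψ (P ++ Q)) P +
      koszul (d a) (listDeg (listDeg d) P) • insertMid d a (fun Q => Ψ (P ++ Q)) Q := by
  induction P generalizing Ψ with
  | nil => simp
  | cons B P ih =>
    simp only [cons_append, insertMid_cons, ih, listDeg_cons, koszul_add_right, smul_add, smul_smul,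
      add_assoc]

theorem insertMid_eq_zero (a : ι) (Ψ : List (List ι) → W) (P : List (List ι))
    (h : ∀ u B v, P = u ++ B :: v → Ψ (u ++ (a :: B) :: v) = 0) : insertMid d a Ψ P = 0 := by
  induction P generalizing Ψ with
  | nil => rfl
  | cons B P ih =>
    rw [insertMid_cons, ih, smul_zero, add_zero]
    · exact h [] B P rfl
    · intro u C v hP
      exact h (B :: u) C v (by simp [hP])

/-- This is the mechanism for the unit: if `Ψ` vanishes whenever `o` ends a larger block, only the
partitions with `[o]` as a separate last block survive. -/
theorem partitionSum_append_singleton (o : ι) (Ψ : List (List ι) → W)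
    (h : ∀ u B v, B ≠ [] → Ψ (u ++ (B ++ [o]) :: v) = 0) (l : List ι) :
    partitionSum d Ψ (l ++ [o]) = partitionSum d (fun P => Ψ (P ++ [[o]])) l := by
  induction l generalizing Ψ with
  | nil => simp
  | cons a l ih =>
    rw [cons_append, partitionSum_cons, partitionSum_cons, ih]
    · congr 1
      funext P
      -- If `a` joins the final block `[o]`, the result `[a, o]` is a block on which `Ψ` vanishes.
      have := h P [a] [] (by simp)
      simp only [singleton_append] at this
      simp only [insertFirst, insertMid_append]
      simp [insertMid_cons, this]
    · intro u B v hB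
      rw [insertFirst, insertMid_eq_zero, add_zero]
      · exact h ([a] :: u) B v hB
      · intro u' B' v' e
        -- The block that receives `a` lies before, at, or after the block ending in `o`. In each
        -- case the latter still has another entry.
        rw [append_eq_append_iff] at e
        rcases e with ⟨w, rfl, e⟩ | ⟨w, rfl, e⟩
        · rcases w with _ | ⟨C, w⟩
          · simp only [nil_append, cons.injEq] at e
            obtain ⟨rfl, rfl⟩ := e
            simpa using h u (a :: B) v (by simp)
          · simp only [cons_append, cons.injEq] at e
            obtain ⟨rfl, rfl⟩ := e
            simpa using h u B (w ++ (a :: B') :: v') hB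
        · rcases w with _ | ⟨C, w⟩
          · simp only [nil_append, cons.injEq] at e
            obtain ⟨rfl, rfl⟩ := e
            simpa using h u' (a :: B) v' (by simp)
          · simp only [cons_append, cons.injEq] at e
            obtain ⟨rfl, rfl⟩ := e
            simpa using h (u' ++ (a :: B') :: w) B v hB

/-! ### Sums over the partitions with a distinguished last block -/

/-- The signed sum of `F(u, B)` over the ways of splitting a list into two complementary sublists
`u` and `B`. -/
def splitSum (d : ι → ℤ) : (List ι → List ι → W) → List ι → W
  | F, [] => F [] []
  | F, a :: l => splitSum d (fun u B => F (a :: u) B + koszul (d a) (listDeg d u) • F u (a :: B)) l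

theorem splitSum_comp_map {κ : Type*} (g : κ → ι) (F : List ι → List ι → W) (l : List κ) :
    splitSum d F (l.map g) = splitSum (d ∘ g) (fun u B => F (u.map g) (B.map g)) l := by
  induction l generalizing F with
  | nil => rfl
  | cons a l ih =>
    simp only [map_cons, splitSum, ih, listDeg_map]
    rfl

theorem splitSum_map (g : W →+ W') (F : List ι → List ι → W) (l : List ι) :
    splitSum d (fun u B => g (F u B)) l = g (splitSum d F l) := by
  induction l generalizing F with
  | nil => rfl
  | cons a l ih => simp only [splitSum, ← ih, map_add, map_units_smul']

theorem splitSum_sum {κ : Type*} (s : Finset κ) (F : κ → List ι → List ι → W) (l : List ι) :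
    splitSum d (fun u B => ∑ k ∈ s, F k u B) l = ∑ k ∈ s, splitSum d (F k) l := by
  induction l generalizing F with
  | nil => rfl
  | cons a l ih =>
    simp only [splitSum, ← ih, Finset.sum_add_distrib, Finset.smul_sum]

theorem splitSum_congr {F F' : List ι → List ι → W} {l : List ι}
    (h : ∀ u B, u ++ B ~ l → F u B = F' u B) : splitSum d F l = splitSum d F' l := by
  induction l generalizing F F' with
  | nil => exact h [] [] (by simp)
  | cons a l ih =>
    refine ih fun u B hu => ?_
    rw [h _ _ (hu.cons a), h _ _ (perm_middle.trans (hu.cons a))]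

/-- The partition with the blocks `{a}`, `a ∈ u`, and the last block `B`. -/
def lastBlock (u B : List ι) : List (List ι) := u.map (fun a => [a]) ++ [B]

/-- If only singletons followed by one block ending in `x, y` contribute, each earlier letter has
two choices: a singleton of its own, in front, or the head of the last block, after passing the
singletons. This is the recursion of `splitSum`. -/
theorem partitionSum_eq_splitSum (x y : ι) (Ψ : List (List ι) → W)
    (h : ∀ P, (∀ B ∈ P, B ≠ []) → (∀ u B, P ≠ lastBlock u (B ++ [x, y])) → Ψ P = 0)
    (l : List ι) (hl : x ∉ l) :
    partitionSum d Ψ (l ++ [x, y]) = splitSum d (fun u B => Ψ (lastBlock u (B ++ [x, y]))) l := by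
  induction l generalizing Ψ with
  | nil =>
    -- Its last block has one element, whereas an admissible last block has at least two.
    have : Ψ [[x], [y]] = 0 := by
      refine h _ (by simp) fun u B e => ?_
      have := congrArg getLast? e
      simp [lastBlock] at this
      have := congrArg length this
      simp at this
    simp [partitionSum_cons, insertFirst, insertMid_cons, splitSum, lastBlock, this]
  | cons a l ih =>
    simp only [mem_cons, not_or] at hl
    rw [cons_append, partitionSum_cons, ih _ _ hl.2, splitSum]
    · congr 1
      funext u B
      have e : listDeg (listDeg d) (u.map fun a => [a]) = listDeg d u := by
        rw [listDeg_map]; congr 1; funext a; simp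
      simp only [insertFirst, lastBlock, insertMid_append, e]
      -- If `a` joined one of the singletons, a block of two elements would stand before the last
      -- block, and `Ψ` vanishes there.
      rw [insertMid_eq_zero]
      · simp [insertMid_cons]
      · intro u' B' v' e'
        have hB' : B'.length = 1 := by
          have : B' ∈ u.map fun a => [a] := by simp [e']
          obtain ⟨z, -, rfl⟩ := mem_map.1 this
          rfl
        have hne : ∀ C ∈ u' ++ B' :: v', C ≠ [] := by
          rw [← e']
          simp
        refine h _ ?_ fun u₂ B₂ e₂ => ?_
        · simp only [mem_append, mem_cons] at hne ⊢
          rintro C ((hC | rfl | hC) | rfl | hC)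
          · exact hne C (Or.inl hC)
          · simp
          · exact hne C (Or.inr (Or.inr hC))
          · simp
          · simp at hC
        · have := append_inj_left' e₂ rfl
          have : a :: B' ∈ u₂.map fun a => [a] := by simp [← this]
          obtain ⟨z, -, hz⟩ := mem_map.1 this
          simp only [cons.injEq] at hz
          simp [← hz.2] at hB'
    · intro P hP hP'
      rw [insertFirst, h, insertMid_eq_zero, add_zero]
      · rintro u' B' v' rfl
        have hB' : B' ≠ [] := hP B' (by simp)
        refine h _ ?_ fun u₂ B₂ e₂ => ?_
        · simp only [mem_append, mem_cons] at hP ⊢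
          rintro C (hC | rfl | hC)
          · exact hP C (Or.inl hC)
          · simp
          · exact hP C (Or.inr (Or.inr hC))
        · rcases eq_nil_or_concat v' with rfl | ⟨w, z, rfl⟩
          · obtain ⟨e₃, e₄⟩ := append_inj' e₂ rfl
            rcases B₂ with _ | ⟨c, B₂⟩
            -- The enlarged block could be `[x, y]` only if `a = x`, which `x ∉ l` excludes.
            · simp only [nil_append, cons.injEq] at e₄
              exact hl.1 e₄.1.1.symm
            · simp only [cons_append, cons.injEq] at e₄
              exact hP' u₂ B₂ (by rw [lastBlock, e₃, e₄.1.2])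
          · rw [concat_eq_append, lastBlock, ← cons_append, ← append_assoc] at e₂
            have := append_inj_left' e₂ rfl
            have : a :: B' ∈ u₂.map fun a => [a] := by simp [← this]
            obtain ⟨z, -, hz⟩ := mem_map.1 this
            simp only [cons.injEq] at hz
            exact hB' hz.2.symm
      · simpa using hP
      · intro u B e
        rcases u with _ | ⟨c, u⟩
        · simp [lastBlock] at e
          have := congrArg length e.1
          simp at this
        · simp only [lastBlock, map_cons, cons_append, cons.injEq] at e
          exact hP' u B e.2

end

section

/-! ### Sums over ordered partitions as sums over the partitions of a list -/

/-- The list of the blocks of an ordered partition. -/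
def blockList {n : ℕ} (π : OrderedFinpartition n) : List (List (Fin n)) :=
  ofFn fun i => ofFn (π.emb i)

theorem index_emb {n : ℕ} (π : OrderedFinpartition n) (i : Fin π.length) (k : Fin (π.partSize i)) :
    π.index (π.emb i k) = i := by
  by_contra hne
  exact π.emb_ne_emb_of_ne hne (π.emb_invEmbedding (π.emb i k))

/-- Indexing the inversions by elements rather than by positions in blocks makes signs comparable
when the element `0` is added. -/
theorem partitionSign_eq {n : ℕ} (d : Fin n → ℤ) (π : OrderedFinpartition n) :
    partitionSign d π = ∏ i : Fin n, ∏ j : Fin n,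
      if (π.index i : ℕ) < π.index j ∧ j < i then koszul (d i) (d j) else 1 := by
  rw [partitionSign]
  refine Fintype.prod_equiv π.equivSigma _ _ fun p => ?_
  refine Fintype.prod_equiv π.equivSigma _ _ fun q => ?_
  simp [OrderedFinpartition.equivSigma, index_emb, koszul]

theorem listDeg_ofFn {ι : Type*} (d : ι → ℤ) {n : ℕ} (f : Fin n → ι) :
    listDeg d (ofFn f) = ∑ i, d (f i) := by
  simp [listDeg, List.sum_ofFn]

theorem sum_blockDegree {n : ℕ} (d : Fin n → ℤ) (π : OrderedFinpartition n)
    (s : Finset (Fin π.length)) :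
    ∑ i ∈ s, blockDegree d π i = ∑ k : Fin n, if π.index k ∈ s then d k else 0 := by
  rw [← π.sum_sigma_eq_sum, ← Finset.sum_subset (Finset.subset_univ s)]
  · refine Finset.sum_congr rfl fun i hi => ?_
    simp [blockDegree, index_emb, hi]
  · intro i _ hi
    simp [index_emb, hi]

theorem koszul_sum_right {ι : Type*} (a : ℤ) (s : Finset ι) (f : ι → ℤ) :
    koszul a (∑ i ∈ s, f i) = ∏ i ∈ s, koszul a (f i) := by
  classical
  induction s using Finset.induction_on with
  | empty => simp
  | insert i s hi ih => rw [Finset.sum_insert hi, Finset.prod_insert hi, koszul_add_right, ih]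

theorem index_extendLeft_zero {n : ℕ} (π : OrderedFinpartition n) :
    π.extendLeft.index 0 = (0 : Fin (π.length + 1)) :=
  index_emb π.extendLeft (0 : Fin (π.length + 1)) ⟨0, Nat.one_pos⟩

theorem index_extendLeft_succ {n : ℕ} (π : OrderedFinpartition n) (j : Fin n) :
    π.extendLeft.index j.succ = (π.index j).succ := by
  have := index_emb π.extendLeft (π.index j).succ (π.invEmbedding j)
  rw [← this]
  congr 1
  change j.succ = (π.emb (π.index j) (π.invEmbedding j)).succ
  simp

theorem ofFn_emb_extendMiddle_self {n : ℕ} (π : OrderedFinpartition n) (k : Fin π.length) :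
    ofFn ((π.extendMiddle k).emb k) = 0 :: (ofFn (π.emb k)).map Fin.succ := by
  have e : (π.extendMiddle k).partSize k = π.partSize k + 1 := by simp
  rw [ofFn_congr e, ofFn_succ, map_ofFn]
  simp only [OrderedFinpartition.extendMiddle, dite_true, Function.comp_apply, cons.injEq]
  exact ⟨rfl, rfl⟩

theorem ofFn_emb_extendMiddle_of_ne {n : ℕ} (π : OrderedFinpartition n) (k i : Fin π.length)
    (h : i ≠ k) :
    ofFn ((π.extendMiddle k).emb i) = (ofFn (π.emb i)).map Fin.succ := by
  have e : (π.extendMiddle k).partSize i = π.partSize i := by simp [h]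
  rw [ofFn_congr e, map_ofFn]
  simp [OrderedFinpartition.extendMiddle, h]
  rfl

theorem index_eq_of_mem {n : ℕ} (π : OrderedFinpartition n) (i : Fin π.length) (j : Fin n)
    (h : j ∈ ofFn (π.emb i)) : π.index j = i := by
  obtain ⟨k, rfl⟩ := (mem_ofFn' _ _).1 h
  exact index_emb π i k

theorem index_extendMiddle_succ {n : ℕ} (π : OrderedFinpartition n) (k : Fin π.length)
    (j : Fin n) : (π.extendMiddle k).index j.succ = π.index j := by
  refine index_eq_of_mem _ _ _ ?_
  have hj : j ∈ ofFn (π.emb (π.index j)) := (mem_ofFn' _ _).2 ⟨π.invEmbedding j, by simp⟩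
  by_cases h : π.index j = k
  · have := ofFn_emb_extendMiddle_self π (π.index j)
    subst h
    rw [this]
    exact mem_cons_of_mem _ (mem_map_of_mem hj)
  · have := ofFn_emb_extendMiddle_of_ne π k (π.index j) h
    rw [this]
    exact mem_map_of_mem hj

theorem blockList_extendLeft {n : ℕ} (π : OrderedFinpartition n) :
    blockList π.extendLeft = [0] :: (blockList π).map (List.map Fin.succ) := by
  unfold blockList
  rw [map_ofFn]
  refine (ofFn_succ (n := π.length)).trans ?_
  congr 1
  congr 1
  funext i
  exact (map_ofFn (f := π.emb i) (g := Fin.succ)).symm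

theorem blockList_extendMiddle {n : ℕ} (π : OrderedFinpartition n) (k : Fin π.length) :
    blockList (π.extendMiddle k) =
      ofFn (Function.update (fun i => (ofFn (π.emb i)).map Fin.succ) k
        (0 :: (ofFn (π.emb k)).map Fin.succ)) := by
  refine congrArg ofFn (funext fun i : Fin π.length => ?_)
  by_cases h : i = k
  · subst h
    rw [Function.update_self]
    exact ofFn_emb_extendMiddle_self π i
  · rw [Function.update_of_ne h]
    exact ofFn_emb_extendMiddle_of_ne π k i h

theorem partitionSign_extendLeft {n : ℕ} (d : Fin (n + 1) → ℤ) (π : OrderedFinpartition n) :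
    partitionSign d π.extendLeft = partitionSign (fun i => d i.succ) π := by
  rw [partitionSign_eq, partitionSign_eq]
  have h0 : (π.extendLeft.index 0 : ℕ) = 0 := by rw [index_extendLeft_zero]; rfl
  have h1 : ∀ j : Fin n, (π.extendLeft.index j.succ : ℕ) = π.index j + 1 := fun j => by
    rw [index_extendLeft_succ]; rfl
  simp only [Fin.prod_univ_succ, h0, h1]
  simp

/-- The new inversions pair `0`, which is smaller than everything, with all the elements of the
blocks before the one it joins. -/
theorem partitionSign_extendMiddle {n : ℕ} (d : Fin (n + 1) → ℤ) (π : OrderedFinpartition n)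
    (k : Fin π.length) :
    partitionSign d (π.extendMiddle k) =
      koszul (d 0) (∑ i ∈ Finset.Iio k, blockDegree (fun i => d i.succ) π i) *
        partitionSign (fun i => d i.succ) π := by
  rw [partitionSign_eq, partitionSign_eq, sum_blockDegree, koszul_sum_right,
    ← Finset.prod_mul_distrib]
  have h0 : ((π.extendMiddle k).index 0 : ℕ) = k :=
    congrArg Fin.val (OrderedFinpartition.index_extendMiddle_zero π k)
  have h1 : ∀ j : Fin n, ((π.extendMiddle k).index j.succ : ℕ) = π.index j := fun j =>
    congrArg Fin.val (index_extendMiddle_succ π k j)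
  simp only [Fin.prod_univ_succ, h0, h1]
  simp only [Fin.not_lt_zero, and_false, if_false, Fin.succ_pos, and_true, Fin.succ_lt_succ_iff,
    Finset.prod_const_one, one_mul, Finset.mem_Iio]
  refine Finset.prod_congr rfl fun i _ => ?_
  simp only [← Fin.val_fin_lt]
  congr 1
  split_ifs <;> simp [koszul_comm]

theorem sum_Iio_succ {r : ℕ} (k : Fin r) (f : Fin (r + 1) → ℤ) :
    ∑ i ∈ Finset.Iio k.succ, f i = f 0 + ∑ i ∈ Finset.Iio k, f i.succ := by
  have h : ∀ {m : ℕ} (k : Fin m), Finset.Iio k = Finset.univ.filter (· < k) := fun k => by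
    ext; simp
  rw [h, h, Finset.sum_filter, Finset.sum_filter, Fin.sum_univ_succ]
  simp

theorem sum_Iio_zero {r : ℕ} (f : Fin (r + 1) → ℤ) : ∑ i ∈ Finset.Iio 0, f i = 0 := by
  rw [show Finset.Iio (0 : Fin (r + 1)) = ∅ by ext; simp, Finset.sum_empty]

theorem insertMid_ofFn {ι W : Type*} [AddCommGroup W] (d : ι → ℤ) (a : ι) {r : ℕ}
    (Ψ : List (List ι) → W) (B : Fin r → List ι) :
    insertMid d a Ψ (ofFn B) = ∑ k, koszul (d a) (∑ i ∈ Finset.Iio k, listDeg d (B i)) •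
      Ψ (ofFn (Function.update B k (a :: B k))) := by
  induction r generalizing Ψ with
  | zero => simp
  | succ r ih =>
    rw [ofFn_succ, insertMid_cons, ih, Fin.sum_univ_succ, Finset.smul_sum]
    congr 1
    · simp [ofFn_succ, sum_Iio_zero]
    · refine Finset.sum_congr rfl fun k _ => ?_
      rw [smul_smul, ← koszul_add_right, ofFn_succ]
      congr 2
      · rw [sum_Iio_succ]
      · congr 2
        funext i
        by_cases h : i = k
        · subst h; simp
        · rw [Function.update_of_ne h, Function.update_of_ne (by simpa using h)]

/-- Blocks are ordered by their greatest elements. A new block `{0}` therefore comes first, and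
adding `0` to a block leaves its maximum, hence the order, unchanged. These are the two kinds of
insertion in `partitionSum`, with the same signs. -/
theorem sum_partitionSign {n : ℕ} {W : Type*} [AddCommGroup W] (d : Fin n → ℤ)
    (Ψ : List (List (Fin n)) → W) :
    ∑ π : OrderedFinpartition n, partitionSign d π • Ψ (blockList π) =
      partitionSum d Ψ (finRange n) := by
  induction n with
  | zero =>
    rw [Fintype.sum_unique, partitionSign_eq]
    simp [blockList]
  | succ n ih =>
    rw [← (OrderedFinpartition.extendEquiv n).sum_comp, Fintype.sum_sigma, finRange_succ,
      partitionSum_cons, partitionSum_comp_map, ← ih]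
    refine Finset.sum_congr rfl fun π _ => ?_
    rw [Fintype.sum_option]
    change partitionSign d π.extendLeft • Ψ (blockList π.extendLeft) +
      ∑ k, partitionSign d (π.extendMiddle k) • Ψ (blockList (π.extendMiddle k)) = _
    simp only [partitionSign_extendLeft, partitionSign_extendMiddle, blockList_extendLeft,
      blockList_extendMiddle]
    rw [insertFirst, smul_add]
    congr 1
    rw [blockList, map_ofFn, insertMid_ofFn, Finset.smul_sum]
    refine Finset.sum_congr rfl fun k _ => ?_
    rw [smul_smul, mul_comm]
    congr 3
    refine Finset.sum_congr rfl fun i _ => ?_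
    simp [blockDegree, listDeg_ofFn]

end

/-! ### Operations as functions on lists -/

section

variable {U V W : Type*}

/-- A family of operations as a function on lists of vectors with their degrees. -/
def opList (ψ : Operations V W) (l : List (ℤ × V)) : W :=
  ψ l.length (fun i => (l.get i).1) (fun i => (l.get i).2)

theorem opList_ofFn (ψ : Operations V W) {n : ℕ} (f : Fin n → ℤ × V) :
    opList ψ (ofFn f) = ψ n (fun i => (f i).1) (fun i => (f i).2) := by
  have key : ∀ (l : List (ℤ × V)) (h : l.length = n), (∀ i, l.get (Fin.cast h.symm i) = f i) →
      opList ψ l = ψ n (fun i => (f i).1) (fun i => (f i).2) := by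
    rintro l rfl h
    obtain rfl : f = l.get := funext fun i => (h i).symm
    rfl
  exact key _ (length_ofFn) fun i => by simp

/-- The value of an operation of degree `0` at a block, together with its degree. -/
def blockOp (φ : Operations U V) (B : List (ℤ × U)) : ℤ × V := (listDeg Prod.fst B, opList φ B)

theorem composeSum_eq [AddCommGroup U] [AddCommGroup V] [AddCommGroup W] (ψ : Operations V W)
    (φ : Operations U V) {n : ℕ} (d : Fin n → ℤ) (x : Fin n → U) :
    composeSum ψ φ n d x = partitionSum Prod.fst (fun P => opList ψ (P.map (blockOp φ)))
      (ofFn fun i => (d i, x i)) := by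
  have : (ofFn fun i => (d i, x i)) = (finRange n).map fun i => (d i, x i) := by
    rw [ofFn_eq_map]
  rw [this, partitionSum_comp_map, ← sum_partitionSign]
  refine Finset.sum_congr rfl fun π _ => ?_
  congr 1
  simp only [blockList, map_ofFn, opList_ofFn, Function.comp_apply, blockOp, listDeg_ofFn]
  rfl

theorem opList_composeSum [AddCommGroup U] [AddCommGroup V] [AddCommGroup W] (ψ : Operations V W)
    (φ : Operations U V) (l : List (ℤ × U)) :
    opList (composeSum ψ φ) l =
      partitionSum Prod.fst (fun P => opList ψ (P.map (blockOp φ))) l := by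
  rw [opList, composeSum_eq]
  congr 1
  exact ofFn_get l

end

/-! ### Multilinear maps evaluated at lists -/

section

variable {𝕜 V W : Type*} [Field 𝕜] [AddCommGroup V] [Module 𝕜 V] [AddCommGroup W] [Module 𝕜 W]

theorem append_cons_eq_ofFn {α : Type*} (u v : List α) (x y : α) :
    u ++ x :: v = ofFn (Function.update (u ++ y :: v).get ⟨u.length, by simp⟩ x) := by
  refine ext_getElem (by simp [add_assoc]) fun i h₁ h₂ => ?_
  simp only [List.getElem_ofFn, Function.update_apply, Fin.mk.injEq]
  split_ifs with h
  · subst h; simp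
  · rcases lt_or_gt_of_ne h with h | h
    · simp [getElem_append_left h]
    · obtain ⟨k, rfl⟩ := Nat.exists_eq_add_of_lt h
      simp [getElem_append_right, add_assoc]

/-- Linearity in one entry with its recorded degree held fixed. It moves sums and signs out of an
argument without naming the position. -/
theorem exists_slot (M : ∀ n : ℕ, MultilinearMap 𝕜 (fun _ : Fin n => V) W) (u v : List (ℤ × V))
    (k : ℤ) : ∃ g : V →ₗ[𝕜] W, ∀ x, opList (ops M) (u ++ (k, x) :: v) = g x := by
  refine ⟨(M _).toLinearMap (fun i => ((u ++ (k, 0) :: v).get i).2) ⟨u.length, by simp⟩,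
    fun x => ?_⟩
  rw [append_cons_eq_ofFn u v (k, x) (k, 0), opList_ofFn, MultilinearMap.toLinearMap_apply, ops]
  congr 1
  funext i
  by_cases h : i = ⟨u.length, by simp⟩
  · subst h; simp
  · simp [Function.update_of_ne h]

/-- `ops` ignores the recorded degrees, so they may be altered freely. -/
theorem opList_ops_congr (M : ∀ n : ℕ, MultilinearMap 𝕜 (fun _ : Fin n => V) W)
    (l l' : List (ℤ × V)) (h : l.map Prod.snd = l'.map Prod.snd) :
    opList (ops M) l = opList (ops M) l' := by
  have key : ∀ l : List (ℤ × V), opList (ops M) l =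
      opList (ops M) ((l.map Prod.snd).map fun x => ((0 : ℤ), x)) := by
    intro l
    conv_lhs => rw [← ofFn_get l]
    conv_rhs => rw [← ofFn_get l, map_ofFn, map_ofFn]
    rw [opList_ofFn, opList_ofFn]
    rfl
  rw [key l, h, ← key l']

/-- A transposition of neighbours inverts exactly one pair. -/
theorem permSign_swap {n : ℕ} (d : Fin n → ℤ) (k : ℕ) (hk : k + 1 < n) :
    permSign d (Equiv.swap ⟨k, by omega⟩ ⟨k + 1, hk⟩) =
      koszul (d ⟨k, by omega⟩) (d ⟨k + 1, hk⟩) := by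
  set a : Fin n := ⟨k, by omega⟩ with ha
  set b : Fin n := ⟨k + 1, hk⟩ with hb
  have hav : (a : ℕ) = k := rfl
  have hbv : (b : ℕ) = k + 1 := rfl
  rw [permSign, Finset.prod_eq_single a, Finset.prod_eq_single b]
  · rw [Equiv.swap_apply_left, Equiv.swap_apply_right, if_pos, koszul_comm]
    · rfl
    · constructor <;> simp [Fin.lt_def, hav, hbv]
  · intro j _ hj
    rw [if_neg]
    rintro ⟨h1, h2⟩
    have hj' : (j : ℕ) ≠ k + 1 := fun h => hj (Fin.ext h)
    have hja : j ≠ a := h1.ne'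
    rw [Equiv.swap_apply_left, Equiv.swap_apply_of_ne_of_ne hja hj] at h2
    rw [Fin.lt_def] at h1 h2
    omega
  · simp
  · intro i _ hi
    refine Finset.prod_eq_one fun j _ => ?_
    rw [if_neg]
    rintro ⟨h1, h2⟩
    have hi' : (i : ℕ) ≠ k := fun h => hi (Fin.ext h)
    simp only [Equiv.swap_apply_def] at h2
    split_ifs at h2 <;> simp only [Fin.lt_def, Fin.ext_iff] at * <;> omega
  · simp

/-- All the entries of a list of vectors have the recorded degrees. -/
def IsHomogeneous (X : PointedGradedSpace 𝕜 V) (l : List (ℤ × V)) : Prop :=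
  ∀ p ∈ l, p.2 ∈ X.deg p.1

theorem append_swap_eq_ofFn {α : Type*} (u v : List α) (x y : α) :
    u ++ y :: x :: v = ofFn fun i => (u ++ x :: y :: v).get
      (Equiv.swap ⟨u.length, by simp⟩ ⟨u.length + 1, by simp⟩ i) := by
  refine ext_getElem (by simp [add_assoc]) fun i h₁ h₂ => ?_
  simp only [List.getElem_ofFn, Equiv.swap_apply_def, Fin.mk.injEq]
  split_ifs with h h'
  · subst h; simp [getElem_append_right]
  · subst h'; simp [getElem_append_right]
  · rcases lt_or_gt_of_ne h with h | h
    · simp [getElem_append_left h]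
    · obtain ⟨k, rfl⟩ := Nat.exists_eq_add_of_lt h
      rcases k with _ | k
      · simp at h'
      · simp [getElem_append_right, add_assoc]

variable {X : PointedGradedSpace 𝕜 V} {Y : PointedGradedSpace 𝕜 W}

theorem opList_swap (M : ∀ n : ℕ, MultilinearMap 𝕜 (fun _ : Fin n => V) W)
    (hM : ∀ n, 1 ≤ n → IsGradedSymm X Y 0 (M n)) (u v : List (ℤ × V)) (p q : ℤ × V)
    (h : IsHomogeneous X (u ++ p :: q :: v)) :
    opList (ops M) (u ++ p :: q :: v) = koszul p.1 q.1 • opList (ops M) (u ++ q :: p :: v) := by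
  rw [append_swap_eq_ofFn u v p q, opList_ofFn, opList]
  have := (hM (u ++ p :: q :: v).length (by simp; omega)).map_perm
    (Equiv.swap ⟨u.length, by simp⟩ ⟨u.length + 1, by simp⟩)
    (fun i => ((u ++ p :: q :: v).get i).1) (fun i => ((u ++ p :: q :: v).get i).2)
    (fun i => h _ (get_mem _ _))
  rw [permSign_swap] at this
  rw [ops, this]
  congr 1
  simp [getElem_append_right]

theorem opList_mem (M : ∀ n : ℕ, MultilinearMap 𝕜 (fun _ : Fin n => V) W)
    (hM : ∀ n, 1 ≤ n → IsGradedSymm X Y 0 (M n)) (l : List (ℤ × V)) (hl : l ≠ [])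
    (h : IsHomogeneous X l) : opList (ops M) l ∈ Y.deg (listDeg Prod.fst l) := by
  have := (hM l.length (length_pos_iff.2 hl)).map_mem (fun i => (l.get i).1) (fun i => (l.get i).2)
    (fun i => h _ (get_mem _ _))
  rw [add_zero, ← listDeg_ofFn, ofFn_get] at this
  exact this

end

/-! ### The contribution of the one-block partition -/

section

variable {ι W : Type*} [AddCommGroup W] (d : ι → ℤ)

theorem insertFirst_ite_length (a : ι) (f : List ι → W) (P : List (List ι)) (hP : P ≠ []) :
    insertFirst d a (fun P => if P.length = 1 then f P.flatten else 0) P =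
      if P.length = 1 then f (a :: P.flatten) else 0 := by
  rcases P with _ | ⟨B, _ | ⟨C, P⟩⟩
  · simp at hP
  · simp [insertFirst, insertMid_cons]
  · have : insertMid d a (fun P => if P.length = 1 then f P.flatten else 0) (B :: C :: P) = 0 := by
      refine insertMid_eq_zero _ _ _ fun u B' v h => if_neg ?_
      have := congrArg length h
      simp at this ⊢
      omega
    simp [insertFirst, this]

theorem partitionSum_ite_length (f : List ι → W) (l : List ι) (hl : l ≠ []) :
    partitionSum d (fun P => if P.length = 1 then f P.flatten else 0) l = f l := by
  induction l generalizing f with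
  | nil => exact absurd rfl hl
  | cons a l ih =>
    rcases l with _ | ⟨b, l⟩
    · simp
    · rw [partitionSum_cons, ← ih (fun l => f (a :: l)) (by simp)]
      refine partitionSum_congr d fun P hP => insertFirst_ite_length d a f P ?_
      rintro rfl
      have := hP.1.length_eq
      simp at this

/-- Restores the summand with |π| = 1, of sign 1, which the recursive definitions of `descendant`
and `mOps` exclude from their sums. -/
theorem sum_ite_length_eq_one {n : ℕ} (hn : n ≠ 0) (d : Fin n → ℤ) (f : List (Fin n) → W) :
    (∑ π : OrderedFinpartition n, partitionSign d π •
      if π.length = 1 then f (blockList π).flatten else 0) = f (finRange n) := by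
  rw [← partitionSum_ite_length d f (finRange n) (by simpa using hn), ← sum_partitionSign]
  simp [blockList]

end

/-! ### The descendant as a sum over partitions of lists -/

section

variable {V W : Type*} [AddCommGroup V] [AddCommGroup W]

/-- `∑ ± M(b_1, …, b_{i-1}, ℓ(B_i), b_{i+1}, …)`, the sum being over all `i` such that all the other
blocks are singletons `B_j = {b_j}`. The entries `pre` of total degree `k` are put in front. -/
def insertTerms (M : List (ℤ × V) → W) (ℓ : List (ℤ × V) → V) :
    ℤ → List (ℤ × V) → List (List (ℤ × V)) → W
  | _, _, [] => 0
  | k, pre, B :: P =>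
    (if ∀ C ∈ P, C.length = 1 then
      k.negOnePow • M (pre ++ (listDeg Prod.fst B + 1, ℓ B) :: P.map fun C => C.headD (0, 0))
      else 0) +
    if B.length = 1 then
      insertTerms M ℓ (k + listDeg Prod.fst B) (pre ++ [B.headD (0, 0)]) P else 0

theorem insertTerms_ofFn (M : List (ℤ × V) → W) (ℓ : List (ℤ × V) → V) (k : ℤ)
    (pre : List (ℤ × V)) {r : ℕ} (B : Fin r → List (ℤ × V)) :
    insertTerms M ℓ k pre (ofFn B) = ∑ i, if ∀ j, j ≠ i → (B j).length = 1 then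
      (k + ∑ j ∈ Finset.Iio i, listDeg Prod.fst (B j)).negOnePow •
        M (pre ++ ofFn (Function.update (fun j => (B j).headD (0, 0)) i
          (listDeg Prod.fst (B i) + 1, ℓ (B i)))) else 0 := by
  induction r generalizing k pre with
  | zero => simp [insertTerms]
  | succ r ih =>
    rw [ofFn_succ, insertTerms, Fin.sum_univ_succ, sum_Iio_zero]
    congr 1
    · simp [mem_ofFn, Fin.forall_fin_succ, map_ofFn, Function.comp_def]
    · rw [ih]
      split_ifs with h
      · refine Finset.sum_congr rfl fun i _ => ?_
        have e1 : (∀ j, j ≠ i.succ → (B j).length = 1) ↔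
            ∀ j : Fin r, j ≠ i → (B j.succ).length = 1 := by
          simp [Fin.forall_fin_succ, h]
        simp only [e1]
        split_ifs
        · rw [sum_Iio_succ, add_assoc, ofFn_succ, append_assoc, singleton_append,
            Function.update_of_ne (Fin.succ_ne_zero _).symm]
          congr 4
          congr 1
          funext j
          by_cases hj : j = i
          · subst hj; simp
          · rw [Function.update_of_ne hj, Function.update_of_ne (by simpa using hj)]
        · rfl
      · refine (Finset.sum_eq_zero fun i _ => if_neg fun h' => h (h' 0 ?_)).symm
        exact (Fin.succ_ne_zero _).symm

end

theorem sum_partSize {n : ℕ} (π : OrderedFinpartition n) : ∑ i, π.partSize i = n := by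
  have := π.sum_sigma_eq_sum (fun _ => 1)
  simpa using this

/-- The sizes are at least 1 and add up to `n`, so the stated total leaves exactly one element for
each of the other blocks. -/
theorem partSize_add_length_eq_iff {n : ℕ} (π : OrderedFinpartition n) (i : Fin π.length) :
    π.partSize i + π.length = n + 1 ↔ ∀ j, j ≠ i → π.partSize j = 1 := by
  have h1 := sum_partSize π
  rw [← Finset.add_sum_erase _ _ (Finset.mem_univ i)] at h1
  have h2 : ∑ j ∈ Finset.univ.erase i, 1 = π.length - 1 := by simp
  have h3 := i.pos
  have h4 := Finset.sum_eq_sum_iff_of_le (s := Finset.univ.erase i) (f := fun _ => 1)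
    (g := π.partSize) fun j _ => π.partSize_pos j
  simp only [Finset.mem_erase, Finset.mem_univ, and_true] at h4
  rw [h2] at h4
  constructor
  · intro h j hj
    exact (h4.1 (by omega) j hj).symm
  · intro h
    have := h4.2 fun j hj => (h j hj).symm
    omega

section

variable {𝕜 C S : Type*} [Field 𝕜] [AddCommGroup C] [Module 𝕜 C]
  (A : HomotopyProbabilityAlgebra 𝕜 C)

theorem headD_ofFn {α : Type*} {r : ℕ} (a : α) (hr : 0 < r) (f : Fin r → α) :
    (ofFn f).headD a = f ⟨0, hr⟩ := by
  rcases r with _ | r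
  · omega
  · simp [ofFn_succ]

theorem opList_singleton (p : ℤ × C) : opList (ops A.M) [p] = p.2 := A.M_id _

theorem insertTerms_blockList {n : ℕ} (d : Fin n → ℤ) (x : Fin n → C)
    (π : OrderedFinpartition n) :
    insertTerms (opList (ops A.M)) (opList (descendant A)) 0 []
        ((blockList π).map (List.map fun i => (d i, x i))) =
      ∑ i : Fin π.length, if π.partSize i + π.length = n + 1 then
        (∑ j ∈ Finset.Iio i, blockDegree d π j).negOnePow • A.M π.length
          (Function.update (fun j => x (blockHead π j)) i
            (descendant A (π.partSize i) (fun k => d (π.emb i k)) (fun k => x (π.emb i k))))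
        else 0 := by
  rw [blockList, map_ofFn, insertTerms_ofFn]
  refine Finset.sum_congr rfl fun i _ => ?_
  simp only [partSize_add_length_eq_iff, Function.comp_apply, map_ofFn, length_ofFn]
  split_ifs
  · rw [nil_append, opList_ofFn, zero_add, opList_ofFn]
    congr 1
    · congr 1
      refine Finset.sum_congr rfl fun j _ => ?_
      simp [listDeg_ofFn, blockDegree]
    · simp only [ops]
      congr 1
      funext j
      by_cases h : j = i
      · subst h; simp
      · rw [Function.update_of_ne h, Function.update_of_ne h,
          headD_ofFn _ (π.partSize_pos j)]
        rfl
  · rfl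

/-- This is the recursion for `descendant` with the subtracted terms moved back. Being only the
definition, it needs no homogeneity. -/
theorem K_M_eq (l : List (ℤ × C)) (hl : l ≠ []) :
    A.K (opList (ops A.M) l) = partitionSum Prod.fst
      (insertTerms (opList (ops A.M)) (opList (descendant A)) 0 []) l := by
  have hn : l.length ≠ 0 := by simpa using hl
  set d : Fin l.length → ℤ := fun i => (l.get i).1 with hd
  set x : Fin l.length → C := fun i => (l.get i).2 with hx
  have hl' : l = (finRange l.length).map fun i => (d i, x i) := by
    rw [← ofFn_eq_map]
    exact (ofFn_get l).symm
  conv_rhs => rw [hl', partitionSum_comp_map]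
  change _ = partitionSum d _ _
  rw [← sum_partitionSign]
  have h1 := sum_ite_length_eq_one hn d fun w =>
    opList (descendant A) (w.map fun i => (d i, x i))
  have h2 : opList (descendant A) l = A.K (A.M l.length x) -
      ∑ π : OrderedFinpartition l.length, partitionSign d π • if π.length ≠ 1 then
        insertTerms (opList (ops A.M)) (opList (descendant A)) 0 []
          ((blockList π).map (List.map fun i => (d i, x i))) else 0 := by
    rw [opList, descendant]
    congr 1
    refine Finset.sum_congr rfl fun π _ => ?_
    rw [insertTerms_blockList]
    by_cases h : π.length = 1
    · simp [h]
    · rw [if_pos h, Finset.smul_sum]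
      refine Finset.sum_congr rfl fun i _ => ?_
      simp only [ne_eq, h, not_false_eq_true, and_true, dite_eq_ite, smul_ite, smul_zero,
        insertionSign, mul_smul]
      rfl
  rw [← hl'] at h1
  change A.K (A.M l.length x) = _
  rw [sub_eq_iff_eq_add.1 h2.symm, ← h1, ← Finset.sum_add_distrib]
  refine Finset.sum_congr rfl fun π _ => ?_
  rw [← smul_add]
  congr 1
  -- For a single block the insertion term is `M_1` of the descendant of the whole list, and `M_1`
  -- is the identity.
  by_cases h : π.length = 1
  · obtain ⟨B, hB⟩ : ∃ B, blockList π = [B] := length_eq_one_iff.1 (by simpa [blockList] using h)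
    rw [if_pos h, if_neg (by simpa using h), add_zero, hB]
    simp [insertTerms, opList_singleton]
  · rw [if_neg h, if_pos h, zero_add]

variable [AddCommGroup S] [Module 𝕜 S] {A} {X : PointedGradedSpace 𝕜 S} (φ : SLQuasiIso X A)

/-! ### The correlation densities -/

theorem opList_correlationDensity (l : List (ℤ × S)) :
    opList (correlationDensity φ) l = partitionSum Prod.fst
      (fun P => opList (ops A.M) (P.map (blockOp (ops φ.φ)))) l :=
  opList_composeSum _ _ l

/-- The zero structure on the source puts a zero argument into every summand on the right of the
morphism relation. -/
theorem relation_list (l : List (ℤ × S)) (hl : l ≠ []) (h : IsHomogeneous X l) :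
    partitionSum Prod.fst (fun P => opList (descendant A) (P.map (blockOp (ops φ.φ)))) l = 0 := by
  rw [← opList_composeSum, opList, φ.relation _ (length_pos_iff.2 hl) _ _
    (fun i => h _ (get_mem _ _))]
  refine Finset.sum_eq_zero fun π _ => Finset.sum_eq_zero fun i _ => ?_
  split_ifs
  · rw [ops, (φ.φ π.length).map_coord_zero i (by simp), smul_zero]
  · rfl

/-- In a term where `ℓ^K` is applied to the group refining one block of `Q`, the other factors do
not depend on the refinement of that block. Summing over this refinement alone gives zero by
`relation_list`. The accumulators `k` and `pre` are arbitrary so that the induction can pass over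
leading blocks. -/
theorem blockwiseSum_insertTerms (Q : List (List (ℤ × S))) (hQ : ∀ B ∈ Q, B ≠ [])
    (h : ∀ B ∈ Q, IsHomogeneous X B) (k : ℤ) (pre : List (ℤ × C)) :
    blockwiseSum Prod.fst (fun T => insertTerms (opList (ops A.M)) (opList (descendant A)) k pre
      (T.map (List.map (blockOp (ops φ.φ))))) Q = 0 := by
  induction Q generalizing k pre with
  | nil => rfl
  | cons B Q ih =>
    simp only [mem_cons, forall_eq_or_imp] at hQ h
    rw [blockwiseSum_cons]
    simp only [map_cons, insertTerms, blockwiseSum_add]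
    rw [partitionSum_add]
    -- The terms where a later group is under `ℓ^K` are covered by the induction hypothesis, with
    -- the first group moved into `pre`.
    have e2 : ∀ P : List (List (ℤ × S)), blockwiseSum Prod.fst (fun T =>
        if (P.map (blockOp (ops φ.φ))).length = 1 then
          insertTerms (opList (ops A.M)) (opList (descendant A))
            (k + listDeg Prod.fst (P.map (blockOp (ops φ.φ))))
            (pre ++ [(P.map (blockOp (ops φ.φ))).headD (0, 0)])
            (T.map (List.map (blockOp (ops φ.φ)))) else 0) Q = 0 := by
      intro P
      split_ifs
      · exact ih hQ.2 h.2 _ _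
      · exact blockwiseSum_zero _ Q
    simp only [e2, partitionSum_zero, add_zero]
    -- Summation over the refinements of the remaining blocks is additive, so the sum over the
    -- partitions of `B` may be carried out first, at a fixed `T`.
    let g : (List (List (List (ℤ × S))) → C) →+ C :=
      AddMonoidHom.mk' (fun F => blockwiseSum Prod.fst F Q) fun F F' =>
        blockwiseSum_add Prod.fst F F' Q
    refine (partitionSum_map Prod.fst g (fun P T => _) B).trans ?_
    refine (congrArg g (funext fun T => ?_)).trans (map_zero g)
    refine (partitionSum_map Prod.fst (Pi.evalAddMonoidHom (fun _ => C) T) (fun P T => _)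
      B).symm.trans ?_
    simp only [Pi.evalAddMonoidHom_apply, Pi.zero_apply]
    split_ifs
    -- The recorded degree of the slot depends formally on `P`; it is replaced by the dummy value
    -- `0`, so that one linear map serves for all `P`.
    · obtain ⟨g', hg'⟩ := exists_slot A.M pre
        (map (fun C => C.headD (0, 0)) (map (map (blockOp (ops φ.φ))) T)) 0
      have e3 : ∀ P : List (List (ℤ × S)), opList (ops A.M)
          (pre ++ (listDeg Prod.fst (map (blockOp (ops φ.φ)) P) + 1,
            opList (descendant A) (map (blockOp (ops φ.φ)) P)) ::
              map (fun C => C.headD (0, 0)) (map (map (blockOp (ops φ.φ))) T)) =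
          g'.toAddMonoidHom (opList (descendant A) (map (blockOp (ops φ.φ)) P)) := by
        intro P
        refine Eq.trans (opList_ops_congr _ _ _ ?_) (hg' _)
        simp
      simp only [e3]
      rw [partitionSum_smul, partitionSum_map, relation_list φ B hQ.1 h.1, map_zero, smul_zero]
    · exact partitionSum_zero _ B

/-- The correlation densities are closed. -/
theorem K_correlationDensity (l : List (ℤ × S)) (hl : l ≠ []) (h : IsHomogeneous X l) :
    A.K (opList (correlationDensity φ) l) = 0 := by
  have e : ∀ P : List (List (ℤ × S)), IsPartitionOf P l →
      A.K.toAddMonoidHom (opList (ops A.M) (P.map (blockOp (ops φ.φ)))) =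
      partitionSum (listDeg Prod.fst) (fun T => insertTerms (opList (ops A.M))
        (opList (descendant A)) 0 [] (T.map (List.map (blockOp (ops φ.φ))))) P := by
    intro P hP
    refine (K_M_eq A _ ?_).trans (partitionSum_comp_map _ _ _ _)
    rintro e
    rw [map_eq_nil_iff] at e
    subst e
    exact hl (by simpa using hP.1)
  rw [opList_correlationDensity]
  change A.K.toAddMonoidHom _ = 0
  -- Associativity turns groupings of the blocks of a partition into refinements of a coarse
  -- partition, where the sums vanish block by block.
  rw [← partitionSum_map, partitionSum_congr Prod.fst e, partitionSum_partitionSum]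
  refine (partitionSum_congr _ fun Q hQ => ?_).trans (partitionSum_zero Prod.fst l)
  refine blockwiseSum_insertTerms φ Q hQ.2 (fun B hB p hp => h p ?_) 0 []
  exact hQ.1.subset (mem_flatten.2 ⟨B, hB, hp⟩)

end

section

variable {S : Type*} [AddCommGroup S]

/-! ### The recursion for the operations `m_n` -/

theorem mem_blockList {n : ℕ} (π : OrderedFinpartition n) (j : Fin n) :
    j ∈ ofFn (π.emb (π.index j)) := (mem_ofFn' _ _).2 ⟨π.invEmbedding j, by simp⟩

/-- The block of the greatest element has the greatest maximum, hence is the last one. -/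
theorem le_index_last {n : ℕ} (π : OrderedFinpartition (n + 1)) (i : Fin π.length) :
    i ≤ π.index (Fin.last n) := by
  by_contra! h
  have h1 := π.parts_strictMono h
  have h2 : Fin.last n ≤ π.emb (π.index (Fin.last n))
      ⟨π.partSize (π.index (Fin.last n)) - 1, Nat.sub_one_lt_of_lt (π.partSize_pos _)⟩ := by
    conv_lhs => rw [← π.emb_invEmbedding (Fin.last n)]
    refine (π.emb_strictMono _).monotone ?_
    rw [Fin.le_def]
    exact Nat.le_sub_one_of_lt (π.invEmbedding (Fin.last n)).2
  exact absurd (h2.trans_lt h1) (Fin.le_last _).not_gt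

/-- In an increasing list the maximum `y` comes last, and nothing fits between `x` and `y`. -/
theorem exists_eq_append_pair {α : Type*} [LinearOrder α] {x y : α} (hxy : x < y)
    (hx : ∀ c, x < c → y ≤ c) {l : List α} (hl : l.Pairwise (· < ·)) (hlx : x ∈ l) (hly : y ∈ l)
    (hle : ∀ c ∈ l, c ≤ y) : ∃ B, l = B ++ [x, y] := by
  rcases eq_nil_or_concat l with rfl | ⟨l, z, rfl⟩
  · simp at hly
  rw [concat_eq_append] at *
  rw [pairwise_append] at hl
  obtain rfl : z = y := by
    rcases mem_append.1 hly with h | h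
    · exact absurd (hl.2.2 y h z (by simp)) (hle z (by simp)).not_gt
    · exact (mem_singleton.1 h).symm
  have hlx' : x ∈ l := by simpa [hxy.ne] using hlx
  rcases eq_nil_or_concat l with rfl | ⟨l, w, rfl⟩
  · simp at hlx'
  rw [concat_eq_append] at *
  obtain rfl : w = x := by
    rcases mem_append.1 hlx' with h | h
    · have h1 := (pairwise_append.1 hl.1).2.2 x h w (by simp)
      exact absurd (hl.2.2 w (by simp) z (by simp)) (hx w h1).not_gt
    · exact (mem_singleton.1 h).symm
  exact ⟨l, by simp⟩

theorem getElem_blockList {n : ℕ} {π : OrderedFinpartition n} (i : Fin π.length) :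
    (blockList π)[(i : ℕ)]'(by simp [blockList]) = ofFn (π.emb i) := by
  simp [blockList]

theorem getElem_lastBlock_of_lt {ι : Type*} (u C : List ι) (i : ℕ) (h : i < u.length) :
    (lastBlock u C)[i]'(by simp [lastBlock]; omega) = [u[i]] := by
  simp [lastBlock, getElem_append_left, h]

theorem getElem_lastBlock_length {ι : Type*} (u C : List ι) :
    (lastBlock u C)[u.length]'(by simp [lastBlock]) = C := by
  simp [lastBlock]

theorem length_eq_of_blockList {n : ℕ} {π : OrderedFinpartition n} {u C : List (Fin n)}
    (h : blockList π = lastBlock u C) : π.length = u.length + 1 := by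
  simpa [blockList, lastBlock] using congrArg length h

theorem emb_of_blockList_of_lt {n : ℕ} {π : OrderedFinpartition n} {u C : List (Fin n)}
    (h : blockList π = lastBlock u C) (i : Fin π.length) (hi : (i : ℕ) < u.length) :
    ofFn (π.emb i) = [u[(i : ℕ)]] := by
  rw [← getElem_blockList, ← getElem_lastBlock_of_lt u C i hi]
  simp only [h]

theorem emb_of_blockList_of_eq {n : ℕ} {π : OrderedFinpartition n} {u C : List (Fin n)}
    (h : blockList π = lastBlock u C) (i : Fin π.length) (hi : (i : ℕ) = u.length) :
    ofFn (π.emb i) = C := by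
  rw [← getElem_blockList]
  conv_rhs => rw [← getElem_lastBlock_length u C]
  simp only [h, hi]

/-- Converts the side conditions in the recursion for `mOps` into the shape required by
`partitionSum_eq_splitSum`. -/
theorem blockList_eq_lastBlock_iff {n : ℕ} (π : OrderedFinpartition (n + 2)) :
    (∃ u B, blockList π = lastBlock u (B ++ [(Fin.last n).castSucc, Fin.last (n + 1)])) ↔
      π.partSize (π.index (Fin.last (n + 1))) + π.length = n + 3 ∧
        π.index (Fin.last n).castSucc = π.index (Fin.last (n + 1)) := by
  rw [show n + 3 = (n + 2) + 1 from rfl, partSize_add_length_eq_iff]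
  constructor
  · rintro ⟨u, B, h⟩
    have hr := length_eq_of_blockList h
    have hC := emb_of_blockList_of_eq h ⟨u.length, by omega⟩ rfl
    have h1 := index_eq_of_mem π ⟨u.length, by omega⟩ (Fin.last n).castSucc (by rw [hC]; simp)
    have h2 := index_eq_of_mem π ⟨u.length, by omega⟩ (Fin.last (n + 1)) (by rw [hC]; simp)
    rw [h1, h2]
    refine ⟨fun j hj => ?_, rfl⟩
    have hj' : (j : ℕ) ≠ u.length := fun h => hj (Fin.ext h)
    have := congrArg length (emb_of_blockList_of_lt h j (by omega))
    simpa using this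
  · rintro ⟨h1, h2⟩
    set i := π.index (Fin.last (n + 1)) with hi
    have hlast : (i : ℕ) + 1 = π.length := by
      have := le_index_last π ⟨π.length - 1, by have := i.2; omega⟩
      rw [Fin.le_def] at this
      have := i.2
      simp only at *
      omega
    obtain ⟨B, hB⟩ : ∃ B, ofFn (π.emb i) = B ++ [(Fin.last n).castSucc, Fin.last (n + 1)] := by
      refine exists_eq_append_pair (Fin.castSucc_lt_last _) ?_ ?_ ?_ (mem_blockList π _)
        (fun c _ => Fin.le_last c)
      · intro c hc
        rw [Fin.lt_def] at hc
        rw [Fin.le_def]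
        simp at *
        omega
      · rw [pairwise_ofFn]
        exact fun _ _ h => π.emb_strictMono i h
      · rw [← h2]
        exact mem_blockList π _
    refine ⟨ofFn fun j : Fin i => blockHead π ⟨j, by omega⟩, B, ?_⟩
    rw [← hB]
    refine ext_getElem (by simp [blockList, lastBlock, hlast]) fun j hj hj' => ?_
    have hjl : j < π.length := by simpa [blockList] using hj
    rcases lt_or_ge j i with hji | hji
    · rw [getElem_lastBlock_of_lt _ _ _ (by simpa using hji), getElem_blockList ⟨j, hjl⟩]
      have hne : (⟨j, hjl⟩ : Fin π.length) ≠ i := fun e => by simp [← e] at hji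
      refine ext_getElem (by simpa using h1 ⟨j, hjl⟩ hne) fun k hk hk' => ?_
      · obtain rfl : k = 0 := by simpa using hk'
        simp [blockHead]
    · obtain rfl : j = i := by omega
      rw [getElem_blockList i]
      have := getElem_lastBlock_length (ofFn fun j : Fin i => blockHead π ⟨j, by omega⟩)
        (ofFn (π.emb i))
      simp only [length_ofFn] at this
      exact this.symm

omit [AddCommGroup S] in
theorem ofFn_blockHead {n : ℕ} {π : OrderedFinpartition n} {u C : List (Fin n)}
    (h : blockList π = lastBlock u C) (d : Fin n → ℤ) (v : Fin n → S) (i : Fin π.length)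
    (hi : (i : ℕ) = u.length) (z : S) :
    (ofFn fun j => (blockDegree d π j, Function.update (fun j => v (blockHead π j)) i z j)) =
      u.map (fun k => (d k, v k)) ++ [(listDeg d C, z)] := by
  have hr := length_eq_of_blockList h
  have hd : ∀ j, blockDegree d π j = listDeg d (ofFn (π.emb j)) := fun j => by
    rw [listDeg_ofFn, blockDegree]
  refine ext_getElem (by simp [hr]) fun j hj hj' => ?_
  have hjl : j < π.length := by simpa using hj
  rw [List.getElem_ofFn, hd]
  rcases Nat.lt_or_ge j u.length with hju | hju
  · have hne : (⟨j, hjl⟩ : Fin π.length) ≠ i := fun e => by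
      rw [← e] at hi; simp at hi; omega
    have h1 := emb_of_blockList_of_lt h ⟨j, hjl⟩ hju
    have h2 : blockHead π ⟨j, hjl⟩ = u[j] := by
      have := headD_ofFn u[j] (π.partSize_pos ⟨j, hjl⟩) (π.emb ⟨j, hjl⟩)
      rw [h1] at this
      exact this.symm
    rw [Function.update_of_ne hne, h1, h2]
    simp [getElem_append_left, hju]
  · obtain rfl : j = u.length := by omega
    obtain rfl : i = ⟨u.length, hjl⟩ := Fin.ext hi
    rw [Function.update_self, emb_of_blockList_of_eq h _ rfl]
    simp

-- Solving the definition of `mOps` for `M_n` restores the one-block term. The right side is then a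
-- signed sum over all partitions into singletons and a last block containing the two greatest
-- elements, that is, over the splittings of the other elements.
open Classical in
theorem opList_ofFn_eq_splitSum (M : Operations S S) (hM : ∀ p, opList M [p] = p.2) {n : ℕ}
    (f : Fin (n + 2) → ℤ × S) :
    opList M (ofFn f) = splitSum (fun i => (f i).1) (fun u B => opList M (u.map f ++
      [(listDeg (fun i => (f i).1) (B ++ [(Fin.last n).castSucc, Fin.last (n + 1)]),
        opList (mOps M) ((B ++ [(Fin.last n).castSucc, Fin.last (n + 1)]).map f))]))
      ((finRange n).map (Fin.castSucc ∘ Fin.castSucc)) := by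
  set x : Fin (n + 2) := (Fin.last n).castSucc with hx
  set y : Fin (n + 2) := Fin.last (n + 1) with hy
  set d : Fin (n + 2) → ℤ := fun i => (f i).1 with hd
  -- `dropLast` recovers the singletons and `getLastD` the last block. Extension by zero gives a
  -- function on all lists of blocks.
  set Ψ : List (List (Fin (n + 2))) → S := fun P =>
    if ∃ u B, P = lastBlock u (B ++ [x, y]) then opList M (P.dropLast.flatten.map f ++
      [(listDeg d (P.getLastD []), opList (mOps M) ((P.getLastD []).map f))]) else 0 with hΨ
  have hΨ' : ∀ u B, Ψ (lastBlock u (B ++ [x, y])) = opList M (u.map f ++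
      [(listDeg d (B ++ [x, y]), opList (mOps M) ((B ++ [x, y]).map f))]) := by
    intro u B
    have e1 : (u.map fun a => [a]).flatten = u := by
      induction u with
      | nil => rfl
      | cons a u ih => simp [ih]
    rw [hΨ]
    beta_reduce
    rw [if_pos ⟨u, B, rfl⟩, lastBlock, dropLast_concat, getLastD_concat, e1]
  have hrange : finRange (n + 2) = (finRange n).map (Fin.castSucc ∘ Fin.castSucc) ++ [x, y] := by
    rw [finRange_succ_last, finRange_succ_last]
    simp [hx, hy]
  have h1 := sum_ite_length_eq_one (n := n + 2) (by omega) d fun w => opList (mOps M) (w.map f)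
  rw [← ofFn_eq_map] at h1
  have h2 : opList (mOps M) (ofFn f) = opList M (ofFn f) -
      ∑ π : OrderedFinpartition (n + 2), partitionSign d π •
        if π.length ≠ 1 then Ψ (blockList π) else 0 := by
    rw [opList_ofFn (mOps M), opList_ofFn M, mOps]
    congr 1
    refine Finset.sum_congr rfl fun π _ => ?_
    by_cases hl : π.length = 1
    · simp [hl]
    by_cases hf : ∃ u B, blockList π = lastBlock u (B ++ [x, y])
    · have hc := (blockList_eq_lastBlock_iff π).1 hf
      rw [dif_pos ⟨hc.1, hc.2, hl⟩, if_pos hl]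
      obtain ⟨u, B, h⟩ := hf
      have hr := length_eq_of_blockList h
      have hi : π.index y = ⟨u.length, by omega⟩ := by
        refine index_eq_of_mem _ _ _ ?_
        rw [emb_of_blockList_of_eq h _ rfl]
        simp
      have hC := emb_of_blockList_of_eq h (π.index y) (by rw [hi])
      rw [h, hΨ', ← ofFn_blockHead h d (fun i => (f i).2) (π.index y) (by rw [hi]), opList_ofFn,
        ← hC, map_ofFn, opList_ofFn]
      rfl
    · rw [dif_neg fun hc => hf ((blockList_eq_lastBlock_iff π).2 ⟨hc.1, hc.2.1⟩), if_pos hl, hΨ]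
      beta_reduce
      rw [if_neg hf, smul_zero]
  have h3 : opList M (ofFn f) = partitionSum d Ψ (finRange (n + 2)) := by
    rw [sub_eq_iff_eq_add.1 h2.symm, ← h1, ← Finset.sum_add_distrib, ← sum_partitionSign]
    refine Finset.sum_congr rfl fun π _ => ?_
    rw [← smul_add]
    congr 1
    by_cases h : π.length = 1
    · rw [if_pos h, if_neg (by simpa using h), add_zero]
      have hf : ∃ u B, blockList π = lastBlock u (B ++ [x, y]) := by
        refine (blockList_eq_lastBlock_iff π).2 ⟨(partSize_add_length_eq_iff π _).2 fun j hj => ?_, ?_⟩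
        · exact absurd (Fin.ext (by omega)) hj
        · exact Fin.ext (by omega)
      obtain ⟨u, B, hB⟩ := hf
      have hu : u = [] := by
        have := length_eq_of_blockList hB
        exact length_eq_zero_iff.1 (by omega)
      subst hu
      -- With no singletons the summand is `M_1` of `m_n`, which `hM` identifies with `m_n`.
      rw [hB, hΨ']
      simp [hM, lastBlock]
    · rw [if_neg h, if_pos h, zero_add]
  rw [h3, hrange, partitionSum_eq_splitSum]
  · simp only [hΨ']
  · intro P _ hP
    rw [hΨ]
    beta_reduce
    rw [if_neg]
    rintro ⟨u, B, h⟩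
    exact hP u B h
  · simp only [mem_map, not_exists, not_and]
    intro i _ h
    exact (Fin.castSucc_lt_last i).ne (Fin.castSucc_injective _ h)

/-- The recursion which determines the operations `m_n`. -/
theorem eq_splitSum_mOps (M : Operations S S) (hM : ∀ p, opList M [p] = p.2)
    (l : List (ℤ × S)) (x y : ℤ × S) :
    opList M (l ++ [x, y]) = splitSum Prod.fst (fun u B => opList M
      (u ++ [(listDeg Prod.fst (B ++ [x, y]), opList (mOps M) (B ++ [x, y]))])) l := by
  set f : Fin (l.length + 2) → ℤ × S := Fin.snoc (Fin.snoc l.get x : Fin (l.length + 1) → ℤ × S) y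
    with hf
  have h1 : ofFn f = l ++ [x, y] := by
    rw [ofFn_succ_last, ofFn_succ_last]
    simp [hf]
  have h2 : ((finRange l.length).map (Fin.castSucc ∘ Fin.castSucc)).map f = l := by
    rw [map_map, ← ofFn_eq_map]
    conv_rhs => rw [← ofFn_get l]
    congr 1
    funext i
    simp [hf]
  have hx : f (Fin.last l.length).castSucc = x := by simp [hf]
  have hy : f (Fin.last (l.length + 1)) = y := by simp [hf]
  rw [← h1, opList_ofFn_eq_splitSum M hM f]
  conv_rhs => rw [← h2, splitSum_comp_map]
  simp only [listDeg_append, map_append, listDeg_map, map_cons, map_nil, hx, hy, listDeg_cons,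
    listDeg_nil]
  rfl

end

/-! ### Degrees of the operations m_n -/

section

variable {S : Type*} [AddCommGroup S]

theorem mOps_mem {𝕜 : Type*} [Field 𝕜] [Module 𝕜 S] (X : PointedGradedSpace 𝕜 S)
    (M : Operations S S)
    (hM : ∀ n, 1 ≤ n → ∀ (d : Fin n → ℤ) (v : Fin n → S), (∀ i, v i ∈ X.deg (d i)) →
      M n d v ∈ X.deg (∑ i, d i)) (n : ℕ) (d : Fin n → ℤ) (v : Fin n → S)
    (hv : ∀ i, v i ∈ X.deg (d i)) : mOps M n d v ∈ X.deg (∑ i, d i) := by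
  induction n using Nat.strong_induction_on with
  | _ n ih =>
    match n, d, v, hv, ih with
    | 0, d, v, hv, ih => rw [mOps]; exact Submodule.zero_mem _
    | 1, d, v, hv, ih => rw [mOps]; exact Submodule.zero_mem _
    | n + 2, d, v, hv, ih =>
      rw [mOps]
      refine Submodule.sub_mem _ (hM _ (by omega) d v hv) (Submodule.sum_mem _ fun π _ => ?_)
      split_ifs with hc
      · have hpos := (π.index (Fin.last (n + 1))).pos
        rw [Units.smul_def]
        refine zsmul_mem ?_ _
        have hsum : ∑ j, blockDegree d π j = ∑ i, d i := π.sum_sigma_eq_sum d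
        rw [← hsum]
        refine hM _ hpos _ _ fun j => ?_
        by_cases hj : j = π.index (Fin.last (n + 1))
        · subst hj
          rw [Function.update_self]
          exact ih _ (by omega) _ _ fun k => hv _
        · rw [Function.update_of_ne hj]
          have h1 := (partSize_add_length_eq_iff π _).1 hc.1 j hj
          have : blockDegree d π j = d (blockHead π j) := by
            rw [blockDegree, Finset.sum_eq_single ⟨0, π.partSize_pos j⟩]
            · rfl
            · intro k _ hk
              exact absurd (Fin.ext (by have := k.2; simp; omega)) hk
            · simp
          rw [this]
          exact hv _
      · exact Submodule.zero_mem _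

end

section

variable {𝕜 C S J : Type*} [Field 𝕜] [AddCommGroup C] [Module 𝕜 C] [AddCommGroup S] [Module 𝕜 S]
  {A : HomotopyProbabilityAlgebra 𝕜 C} {X : PointedGradedSpace 𝕜 S}

/-! ### Symmetry, unit and expectation of the correlation densities -/

/-- A label of a basis as a vector with its degree. -/
def label (deg : J → ℤ) (e : J → S) (α : J) : ℤ × S := (deg α, e α)

theorem isHomogeneous_map_label {deg : J → ℤ} {e : J → S} (he : ∀ α, e α ∈ X.deg (deg α))
    (l : List J) : IsHomogeneous X (l.map (label deg e)) := by
  intro p hp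
  obtain ⟨α, -, rfl⟩ := mem_map.1 hp
  exact he α

/-- `M_n` is graded symmetric in its arguments and `φ_n` in the entries of a block, so the summand
is block symmetric. -/
theorem isListSymm_correlationDensity (φ : SLQuasiIso X A) {deg : J → ℤ} {e : J → S}
    (he : ∀ α, e α ∈ X.deg (deg α)) :
    IsListSymm deg fun l => opList (correlationDensity φ) (l.map (label deg e)) := by
  classical
  -- No condition is imposed on `φ 0`. The value 0 at the empty block makes `b` homogeneous on every
  -- list, while no partition contains an empty block.
  set b : List J → ℤ × C := fun B =>
    (listDeg deg B, if B = [] then 0 else opList (ops φ.φ) (B.map (label deg e))) with hb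
  have hdeg : ∀ B, (b B).1 = listDeg deg B := fun _ => rfl
  have hmem : ∀ B, (b B).2 ∈ A.deg (b B).1 := by
    intro B
    rw [hb]
    beta_reduce
    split_ifs with h
    · exact Submodule.zero_mem _
    · have := opList_mem φ.φ φ.graded (B.map (label deg e)) (by simpa using h)
        (isHomogeneous_map_label he B)
      rwa [listDeg_map] at this
  have e1 : ∀ l : List J, opList (correlationDensity φ) (l.map (label deg e)) =
      partitionSum deg (fun P => opList (ops A.M) (P.map b)) l := by
    intro l
    rw [opList_correlationDensity, partitionSum_comp_map]
    refine partitionSum_congr deg fun P hP => ?_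
    rw [map_map]
    congr 1
    refine map_congr_left fun B hB => ?_
    simp only [Function.comp_apply, blockOp, listDeg_map, hb, if_neg (hP.2 B hB)]
    rfl
  simp only [e1]
  refine IsBlockSymm.isListSymm ⟨fun u B B' v => ?_, fun u p x y q v => ?_⟩
  · simp only [map_append, map_cons]
    rw [opList_swap A.M A.M_graded]
    intro p hp
    have : p ∈ (u ++ B :: B' :: v).map b := by simpa using hp
    obtain ⟨B, -, rfl⟩ := mem_map.1 this
    exact hmem B
  · have e2 : b (p ++ x :: y :: q) = ((b (p ++ y :: x :: q)).1,
        koszul (deg x) (deg y) • (b (p ++ y :: x :: q)).2) := by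
      refine Prod.ext ?_ ?_
      · exact listDeg_perm deg ((Perm.swap _ _ _).append_left p)
      · simp only [hb, append_eq_nil_iff, reduceCtorEq, and_false, if_false]
        have := opList_swap φ.φ φ.graded (p.map (label deg e)) (q.map (label deg e))
          (label deg e x) (label deg e y) (by
            have := isHomogeneous_map_label he (p ++ x :: y :: q)
            simpa using this)
        simp only [map_append, map_cons]
        exact this
    obtain ⟨g, hg⟩ := exists_slot A.M (u.map b) (v.map b) (b (p ++ y :: x :: q)).1
    have e3 := hg (b (p ++ y :: x :: q)).2
    have e4 := hg (koszul (deg x) (deg y) • (b (p ++ y :: x :: q)).2)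
    rw [← e2] at e4
    simp only [map_append, map_cons] at e3 e4 ⊢
    rw [e4, e3]
    exact map_units_smul' g.toAddMonoidHom _ _

theorem opList_append_singleton {V W : Type*} (ψ : Operations V W) (l : List (ℤ × V))
    (p : ℤ × V) : opList ψ (l ++ [p]) = ψ (l.length + 1)
      (fun i => (Fin.snoc (α := fun _ => ℤ × V) l.get p i).1)
      (Fin.snoc (α := fun _ => V) (fun i => (l.get i).2) p.2) := by
  have : l ++ [p] = ofFn (Fin.snoc (α := fun _ => ℤ × V) l.get p) := by
    rw [ofFn_succ_last]
    simp
  rw [this, opList_ofFn]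
  congr 1
  funext i
  refine Fin.lastCases ?_ (fun i => ?_) i <;> simp

theorem opList_M_append_one (l : List (ℤ × C)) (hl : l ≠ []) (k : ℤ) :
    opList (ops A.M) (l ++ [(k, A.one)]) = opList (ops A.M) l := by
  rw [opList_append_singleton]
  exact A.M_unit _ (length_pos_iff.2 hl) _

theorem opList_correlationDensity_append_one (φ : SLQuasiIso X A) (l : List (ℤ × S)) (hl : l ≠ [])
    (k : ℤ) :
    opList (correlationDensity φ) (l ++ [(k, X.one)]) = opList (correlationDensity φ) l := by
  rw [opList_correlationDensity, opList_correlationDensity, partitionSum_append_singleton]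
  · refine partitionSum_congr _ fun P hP => ?_
    have e1 : blockOp (ops φ.φ) [(k, X.one)] = (k, A.one) := by
      refine Prod.ext (by simp [blockOp]) ?_
      rw [← φ.map_one]
      refine congrArg (φ.φ 1) (funext fun i => ?_)
      simp
    rw [map_append, map_cons, e1, map_nil, opList_M_append_one]
    rw [ne_eq, map_eq_nil_iff]
    rintro rfl
    exact hl (by simpa using hP.1)
  · intro u B v hB
    obtain ⟨g, hg⟩ := exists_slot A.M (u.map (blockOp (ops φ.φ))) (v.map (blockOp (ops φ.φ)))
      (blockOp (ops φ.φ) (B ++ [(k, X.one)])).1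
    have h0 : (blockOp (ops φ.φ) (B ++ [(k, X.one)])).2 = 0 := by
      simp only [blockOp]
      rw [opList_append_singleton]
      exact φ.map_unit _ (length_pos_iff.2 hB) _
    have := hg (blockOp (ops φ.φ) (B ++ [(k, X.one)])).2
    simp only [map_append, map_cons] at this ⊢
    rw [this, h0, map_zero]

theorem opList_correlationDensity_singleton (φ : SLQuasiIso X A) (p : ℤ × S) :
    opList (correlationDensity φ) [p] = φ.linear p.2 := by
  rw [opList_correlationDensity, partitionSum_singleton, map_cons, map_nil, opList_singleton]
  rw [UnitalSLMorphism.linear]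
  refine congrArg (φ.φ 1) (funext fun i => ?_)
  simp

theorem linear_one (φ : SLQuasiIso X A) : φ.linear X.one = A.one := φ.map_one

theorem opList_correlationM {φ : SLQuasiIso X A} (h : HomotopyInverse φ) (l : List (ℤ × S)) :
    opList (correlationM h) l = h.h (opList (correlationDensity φ) l) := rfl

theorem opList_correlationM_singleton {φ : SLQuasiIso X A} (h : HomotopyInverse φ) (p : ℤ × S) :
    opList (correlationM h) [p] = p.2 := by
  rw [opList_correlationM, opList_correlationDensity_singleton, h.left_inv]

theorem opList_correlationM_mem {φ : SLQuasiIso X A} (h : HomotopyInverse φ) (l : List (ℤ × S))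
    (hl : l ≠ []) (hh : IsHomogeneous X l) :
    opList (correlationM h) l ∈ X.deg (listDeg Prod.fst l) := by
  rw [opList_correlationM, opList_correlationDensity]
  refine h.h_mem _ _ (partitionSum_mem Prod.fst (A.deg (listDeg Prod.fst l)).toAddSubgroup _ l
    fun P hP => ?_)
  have e1 : listDeg Prod.fst (P.map (blockOp (ops φ.φ))) = listDeg Prod.fst l := by
    rw [listDeg_map, ← listDeg_perm Prod.fst hP.1, listDeg_flatten]
    rfl
  rw [← e1]
  refine opList_mem A.M A.M_graded _ ?_ ?_
  · rw [ne_eq, map_eq_nil_iff]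
    rintro rfl
    exact hl (by simpa using hP.1)
  · intro p hp
    obtain ⟨B, hB, rfl⟩ := mem_map.1 hp
    refine opList_mem φ.φ φ.graded B (hP.2 B hB) fun q hq => hh q ?_
    exact hP.1.subset (mem_flatten.2 ⟨B, hB, hq⟩)

theorem opList_mOps_mem {φ : SLQuasiIso X A} (h : HomotopyInverse φ) (l : List (ℤ × S))
    (hh : IsHomogeneous X l) :
    opList (mOps (correlationM h)) l ∈ X.deg (listDeg Prod.fst l) := by
  have := mOps_mem X (correlationM h) (fun n hn d v hv => by
    have := opList_correlationM_mem h (ofFn fun i => (d i, v i))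
      (by rw [ne_eq, ofFn_eq_nil_iff]; omega) (by
        intro p hp
        obtain ⟨i, rfl⟩ := (mem_ofFn' _ _).1 hp
        exact hv i)
    rwa [opList_ofFn, listDeg_ofFn] at this) l.length (fun i => (l.get i).1)
    (fun i => (l.get i).2) (fun i => hh _ (get_mem _ _))
  rw [← listDeg_ofFn, ofFn_get] at this
  exact this

/-- The moments are determined by the correlation algebra structure and the expectation on `S`. -/
theorem expectation_correlationDensity {φ : SLQuasiIso X A} (h : HomotopyInverse φ)
    (c : PAlgHom A (ground 𝕜)) (l : List (ℤ × S)) (hl : l ≠ []) (hh : IsHomogeneous X l) :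
    c.toLinearMap (opList (correlationDensity φ) l) = iota c φ (opList (correlationM h) l) := by
  obtain ⟨β, -, hβ⟩ := h.right_inv
  have h0 : ∀ x, c.toLinearMap (A.K x) = 0 := fun x => c.map_K x
  -- In φ_1 h Π = Π + KβΠ + βKΠ the last term vanishes because Π is closed, and `c` annihilates the
  -- image of `K`.
  rw [opList_correlationM, iota, LinearMap.comp_apply, hβ, K_correlationDensity φ l hl hh, map_zero,
    add_zero, map_add, h0, add_zero]

end

section

variable {𝕜 J : Type*} [Field 𝕜] {deg : J → ℤ}

/-! ### Calculus with formal power series -/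

theorem koszul_of_even_left {a b : ℤ} (h : Even a) : koszul a b = 1 :=
  Int.negOnePow_even _ (h.mul_right b)

theorem koszul_of_even_right {a b : ℤ} (h : Even b) : koszul a b = 1 :=
  Int.negOnePow_even _ (h.mul_left a)

theorem koszul_of_odd {a b : ℤ} (ha : ¬ Even a) (hb : ¬ Even b) : koszul a b = -1 :=
  Int.negOnePow_odd _ ((Int.not_even_iff_odd.1 ha).mul (Int.not_even_iff_odd.1 hb))

theorem coord_even {α : J} (h : Even (deg α)) :
    (coord α : Series 𝕜 deg) = MvPowerSeries.X ⟨α, h⟩ := dif_pos h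

theorem coord_odd {α : J} (h : ¬ Even (deg α)) : (coord α : Series 𝕜 deg) =
    MvPowerSeries.C (ExteriorAlgebra.ι 𝕜 (Finsupp.single ⟨α, h⟩ 1)) := dif_neg h

theorem coord_mul_coord (α β : J) : (coord α * coord β : Series 𝕜 deg) =
    koszul (deg α) (deg β) • (coord β * coord α) := by
  by_cases hα : Even (deg α)
  · rw [koszul_of_even_left hα, one_smul, coord_even hα, MvPowerSeries.X_mul]
  by_cases hβ : Even (deg β)
  · rw [koszul_of_even_right hβ, one_smul, coord_even hβ, MvPowerSeries.X_mul]
  rw [koszul_of_odd hα hβ, coord_odd hα, coord_odd hβ, ← RingHom.map_mul, ← RingHom.map_mul,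
    Units.neg_smul, one_smul, ← RingHom.map_neg]
  congr 1
  exact eq_neg_of_add_eq_zero_left (ExteriorAlgebra.ι_add_mul_swap _ _)

theorem coeff_X_mul' {σ R : Type*} [Semiring R] (s : σ) (F : MvPowerSeries σ R) (m : σ →₀ ℕ) :
    MvPowerSeries.coeff m (MvPowerSeries.X s * F) =
      if m s = 0 then 0 else MvPowerSeries.coeff (m - Finsupp.single s 1) F := by
  classical
  rw [MvPowerSeries.X, MvPowerSeries.coeff_monomial_mul, one_mul]
  simp only [Finsupp.single_le_iff]
  by_cases h : m s = 0
  · simp [h]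
  · rw [if_pos (by omega), if_neg h]

theorem coeff_pderiv_even {β : J} (h : Even (deg β)) (F : Series 𝕜 deg)
    (m : {α : J // Even (deg α)} →₀ ℕ) : MvPowerSeries.coeff m (pderiv β F) =
      (m ⟨β, h⟩ + 1) • MvPowerSeries.coeff (m + Finsupp.single ⟨β, h⟩ 1) F := by
  have : pderiv β F = fun m => (m ⟨β, h⟩ + 1) •
    MvPowerSeries.coeff (m + Finsupp.single ⟨β, h⟩ 1) F := dif_pos h
  exact congrFun this m

theorem coeff_pderiv_odd {β : J} (h : ¬ Even (deg β)) (F : Series 𝕜 deg)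
    (m : {α : J // Even (deg α)} →₀ ℕ) : MvPowerSeries.coeff m (pderiv β F) =
      CliffordAlgebra.contractLeft (Finsupp.lapply ⟨β, h⟩ :
        ({α : J // ¬ Even (deg α)} →₀ 𝕜) →ₗ[𝕜] 𝕜) (MvPowerSeries.coeff m F) := by
  have : pderiv β F = fun m => CliffordAlgebra.contractLeft (Finsupp.lapply ⟨β, h⟩ :
    ({α : J // ¬ Even (deg α)} →₀ 𝕜) →ₗ[𝕜] 𝕜) (MvPowerSeries.coeff m F) := dif_neg h
  exact congrFun this m

theorem coeff_smul' (r : 𝕜) (F : Series 𝕜 deg) (m : {α : J // Even (deg α)} →₀ ℕ) :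
    MvPowerSeries.coeff m (r • F) = r • MvPowerSeries.coeff m F := rfl

theorem pderiv_add (β : J) (F G : Series 𝕜 deg) :
    pderiv β (F + G) = pderiv β F + pderiv β G := by
  ext m : 1
  by_cases h : Even (deg β)
  · simp only [coeff_pderiv_even h, map_add, smul_add]
  · simp only [coeff_pderiv_odd h, map_add]

theorem pderiv_smul (β : J) (r : 𝕜) (F : Series 𝕜 deg) :
    pderiv β (r • F) = r • pderiv β F := by
  ext m : 1
  by_cases h : Even (deg β)
  · simp only [coeff_pderiv_even h, coeff_smul']
    rw [smul_comm]
  · simp only [coeff_pderiv_odd h, coeff_smul', map_smul]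

/-- The derivation `∂_β` as a linear map. -/
def pderivLinear (β : J) : Series 𝕜 deg →ₗ[𝕜] Series 𝕜 deg where
  toFun := pderiv β
  map_add' := pderiv_add β
  map_smul' := pderiv_smul β

theorem pderiv_sum {κ : Type*} (β : J) (s : Finset κ) (F : κ → Series 𝕜 deg) :
    pderiv β (∑ i ∈ s, F i) = ∑ i ∈ s, pderiv β (F i) :=
  map_sum (pderivLinear β) F s

theorem pderiv_one (β : J) : pderiv β (1 : Series 𝕜 deg) = 0 := by
  classical
  ext m : 1
  by_cases h : Even (deg β)
  · rw [coeff_pderiv_even h, MvPowerSeries.coeff_one, if_neg, smul_zero, map_zero]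
    intro h0
    have := DFunLike.congr_fun h0 ⟨β, h⟩
    simp at this
  · rw [coeff_pderiv_odd h, MvPowerSeries.coeff_one]
    split_ifs
    · simp [CliffordAlgebra.contractLeft_one]
    · simp

/-- The graded Leibniz rule for a variable. If both variables are odd it is the antiderivation
property of contraction on the exterior algebra; the other parities are computed on coefficients. -/
theorem pderiv_coord_mul [DecidableEq J] (β α : J) (F : Series 𝕜 deg) :
    pderiv β (coord α * F) = (if α = β then F else 0) +
      koszul (deg β) (deg α) • (coord α * pderiv β F) := by
  by_cases hβ : Even (deg β)
  · rw [koszul_of_even_left hβ, one_smul]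
    by_cases hα : Even (deg α)
    · rw [coord_even hα]
      ext m : 1
      rw [map_add, coeff_pderiv_even hβ, coeff_X_mul', coeff_X_mul', coeff_pderiv_even hβ]
      by_cases h : α = β
      -- With F_m the coefficient of `F`, the identity is (m_α + 1) F_m = F_m + m_α F_m. The case
      -- m_α = 0 is separate because subtraction of exponents is truncated.
      · subst h
        by_cases h0 : m ⟨α, hα⟩ = 0
        · simp [h0]
        · have h1 : Finsupp.single ⟨α, hα⟩ 1 ≤ m := by
            rw [Finsupp.single_le_iff]; omega
          have h2 : m ⟨α, hα⟩ - 1 + 1 = m ⟨α, hα⟩ := by omega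
          simp [h0, tsub_add_cancel_of_le h1, h2, add_smul, add_comm]
      · have h' : (⟨α, hα⟩ : {α : J // Even (deg α)}) ≠ ⟨β, hβ⟩ := by simpa using h
        have h1 : m + Finsupp.single ⟨β, hβ⟩ 1 - Finsupp.single ⟨α, hα⟩ 1 =
            m - Finsupp.single ⟨α, hα⟩ 1 + Finsupp.single ⟨β, hβ⟩ 1 := by
          ext γ
          by_cases hγ : γ = ⟨α, hα⟩
          · subst hγ; simp [h'.symm]
          · simp [Finsupp.single_apply, Ne.symm hγ]
        rw [h1]
        simp [h, h', h'.symm]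
    · have hne : α ≠ β := by rintro rfl; exact hα hβ
      rw [coord_odd hα, if_neg hne, zero_add]
      ext m : 1
      rw [coeff_pderiv_even hβ, MvPowerSeries.coeff_C_mul, MvPowerSeries.coeff_C_mul,
        coeff_pderiv_even hβ, mul_smul_comm]
  · by_cases hα : Even (deg α)
    · have hne : α ≠ β := by rintro rfl; exact hβ hα
      rw [koszul_of_even_right hα, one_smul, coord_even hα, if_neg hne, zero_add]
      ext m : 1
      rw [coeff_pderiv_odd hβ, coeff_X_mul', coeff_X_mul', coeff_pderiv_odd hβ]
      split_ifs <;> simp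
    · rw [koszul_of_odd hβ hα, coord_odd hα, Units.neg_smul, one_smul]
      ext m : 1
      rw [coeff_pderiv_odd hβ, MvPowerSeries.coeff_C_mul]
      have := CliffordAlgebra.contractLeft_ι_mul (Q := (0 : QuadraticForm 𝕜 _))
        (d := (Finsupp.lapply ⟨β, hβ⟩ : ({α : J // ¬ Even (deg α)} →₀ 𝕜) →ₗ[𝕜] 𝕜))
        (Finsupp.single ⟨α, hα⟩ 1) (MvPowerSeries.coeff m F)
      refine this.trans ?_
      rw [map_add, map_neg, MvPowerSeries.coeff_C_mul, coeff_pderiv_odd hβ, sub_eq_add_neg]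
      congr 1
      rw [Finsupp.lapply_apply, Finsupp.single_apply]
      by_cases h : α = β
      · subst h; simp
      · simp [h]

end

/-! ### Reversed monomials -/

section

variable {𝕜 J : Type*} [Field 𝕜] {deg : J → ℤ}

/-- The reversed product `t^{a_n} ⋯ t^{a_1}` of a list. -/
def revProd (l : List J) : Series 𝕜 deg := (l.map coord).reverse.prod

@[simp] theorem revProd_nil : (revProd [] : Series 𝕜 deg) = 1 := rfl

theorem revProd_cons (a : J) (l : List J) :
    (revProd (a :: l) : Series 𝕜 deg) = revProd l * coord a := by
  simp [revProd]

theorem revProd_append_singleton (a : J) (l : List J) :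
    (revProd (l ++ [a]) : Series 𝕜 deg) = coord a * revProd l := by
  simp [revProd]

theorem revMonomial_eq {n : ℕ} (ρ : Fin n → J) :
    (revMonomial ρ : Series 𝕜 deg) = revProd (ofFn ρ) := by
  rw [revMonomial, revProd, map_ofFn]
  rfl

theorem revProd_mul_coord (a : J) (l : List J) : (revProd l * coord a : Series 𝕜 deg) =
    koszul (deg a) (listDeg deg l) • (coord a * revProd l) := by
  induction l with
  | nil => simp
  | cons b l ih =>
    rw [revProd_cons, mul_assoc, coord_mul_coord b a, mul_smul_comm, ← mul_assoc, ih,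
      smul_mul_assoc, smul_smul, listDeg_cons, koszul_add_right, koszul_comm (deg b), mul_assoc]

/-! ### Sums over lists of a given length -/

variable [Fintype J]

/-- The sum over all lists of length `n`. -/
def sumLists {W : Type*} [AddCommMonoid W] (n : ℕ) (g : List J → W) : W :=
  ∑ ρ : Fin n → J, g (ofFn ρ)

section

variable {W W' : Type*} [AddCommMonoid W] [AddCommMonoid W']

theorem sumLists_zero (g : List J → W) : sumLists 0 g = g [] := by
  simp [sumLists]

theorem sumLists_succ (n : ℕ) (g : List J → W) :
    sumLists (n + 1) g = ∑ a, sumLists n fun l => g (a :: l) := by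
  rw [sumLists, ← (Fin.consEquiv fun _ => J).sum_comp, Fintype.sum_prod_type]
  simp [sumLists, Fin.consEquiv]

theorem sumLists_succ_last (n : ℕ) (g : List J → W) :
    sumLists (n + 1) g = ∑ a, sumLists n fun l => g (l ++ [a]) := by
  rw [sumLists, ← (Fin.snocEquiv fun _ => J).sum_comp, Fintype.sum_prod_type]
  refine Finset.sum_congr rfl fun a _ => Finset.sum_congr rfl fun ρ _ => ?_
  rw [ofFn_succ_last]
  simp [Fin.snocEquiv]

theorem sumLists_add (n : ℕ) (g g' : List J → W) :
    sumLists n (fun l => g l + g' l) = sumLists n g + sumLists n g' := Finset.sum_add_distrib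

theorem sumLists_map {F : Type*} [FunLike F W W'] [AddMonoidHomClass F W W'] (f : F) (n : ℕ)
    (g : List J → W) : sumLists n (fun l => f (g l)) = f (sumLists n g) := (map_sum f _ _).symm

theorem sumLists_sum {κ : Type*} (s : Finset κ) (n : ℕ) (g : κ → List J → W) :
    sumLists n (fun l => ∑ k ∈ s, g k l) = ∑ k ∈ s, sumLists n (g k) := Finset.sum_comm

theorem sumLists_congr {n : ℕ} {g g' : List J → W} (h : ∀ l : List J, l.length = n → g l = g' l) :
    sumLists n g = sumLists n g' :=
  Finset.sum_congr rfl fun _ _ => h _ length_ofFn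

end

/-- Splitting the labels into two groups. -/
theorem sumLists_splitSum (n : ℕ) (F : List J → List J → Series 𝕜 deg) :
    sumLists n (fun l => revProd l * splitSum deg F l) =
      ∑ p ∈ Finset.HasAntidiagonal.antidiagonal n, n.choose p.1 •
        sumLists p.1 (fun B => sumLists p.2 fun u => revProd B * (revProd u * F u B)) := by
  induction n generalizing F with
  | zero => simp [sumLists_zero, splitSum]
  | succ n ih =>
    have h1 : sumLists (n + 1) (fun l => revProd l * splitSum deg F l) =
        ∑ a, sumLists n (fun l => revProd l * splitSum deg
          (fun u B => coord a * (F (a :: u) B + koszul (deg a) (listDeg deg u) • F u (a :: B)))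
          l) := by
      rw [sumLists_succ]
      refine Finset.sum_congr rfl fun a _ => Finset.sum_congr rfl fun ρ _ => ?_
      beta_reduce
      rw [revProd_cons, mul_assoc, splitSum]
      exact congrArg (revProd (ofFn ρ) * ·)
        (splitSum_map (AddMonoidHom.mulLeft (coord a : Series 𝕜 deg)) _ _).symm
    -- Pascal's rule matches the two choices for the new letter, which enlarges either `u` or `B`.
    rw [h1, Finset.sum_antidiagonal_choose_succ_nsmul
      (fun i j => sumLists i (fun B => sumLists j fun u => revProd B * (revProd u * F u B)))]
    simp only [ih]
    rw [Finset.sum_comm, ← Finset.sum_add_distrib]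
    refine Finset.sum_congr rfl fun p hp => ?_
    rw [← Nat.choose_symm_of_eq_add (Finset.HasAntidiagonal.mem_antidiagonal.1 hp).symm, ← Finset.smul_sum,
      ← smul_add]
    congr 1
    have h2 : ∀ B : List J, sumLists (p.2 + 1) (fun u => revProd B * (revProd u * F u B)) =
        ∑ a, sumLists p.2 fun u => revProd B * (revProd u * (coord a * F (a :: u) B)) := by
      intro B
      rw [sumLists_succ]
      simp only [revProd_cons, mul_assoc]
    simp only [h2]
    rw [sumLists_sum, sumLists_succ, ← Finset.sum_add_distrib]
    refine Finset.sum_congr rfl fun a _ => ?_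
    rw [← sumLists_add]
    refine sumLists_congr fun B _ => ?_
    rw [← sumLists_add]
    refine sumLists_congr fun u _ => ?_
    -- Moving the variable in front of the monomial of `u` produces the sign already present in
    -- `splitSum`, and the two cancel.
    have h3 : revProd u * (coord a * koszul (deg a) (listDeg deg u) • F u (a :: B)) =
        coord a * (revProd u * F u (a :: B)) := by
      rw [mul_smul_comm, mul_smul_comm, ← mul_assoc, revProd_mul_coord, smul_mul_assoc, smul_smul,
        koszul_mul_self, one_smul, mul_assoc]
    rw [mul_add, mul_add, mul_add, h3, revProd_cons, mul_assoc (revProd B)]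

/-! ### Generating series -/

/-- By Leibniz, ∂_β removes one occurrence of t^β from each of the n + 1 places in turn. The
symmetry of `f` brings this label to the end with the sign of the derivation, so all places
contribute equally. -/
theorem sumLists_pderiv [DecidableEq J] (β : J) (n : ℕ) (f : List J → 𝕜) (hf : IsListSymm deg f) :
    sumLists (n + 1) (fun l => f l • pderiv β (revProd l : Series 𝕜 deg)) =
      ((n : 𝕜) + 1) • sumLists n fun l => f (l ++ [β]) • (revProd l : Series 𝕜 deg) := by
  induction n generalizing f with
  | zero =>
    rw [sumLists_succ_last]
    simp only [sumLists_zero, revProd_append_singleton, pderiv_coord_mul, revProd_nil, pderiv_one]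
    simp
  | succ n ih =>
    rw [sumLists_succ_last]
    simp only [revProd_append_singleton, pderiv_coord_mul, smul_add, sumLists_add,
      Finset.sum_add_distrib]
    have h1 : ∑ a, sumLists (n + 1) (fun l => f (l ++ [a]) •
        (if a = β then (revProd l : Series 𝕜 deg) else 0)) =
        sumLists (n + 1) fun l => f (l ++ [β]) • (revProd l : Series 𝕜 deg) := by
      rw [Finset.sum_eq_single β]
      · simp
      · intro a _ ha
        simp [ha, sumLists]
      · simp
    have h2 : ∀ a, sumLists (n + 1) (fun l => f (l ++ [a]) • koszul (deg β) (deg a) •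
        ((coord a : Series 𝕜 deg) * pderiv β (revProd l))) =
        ((n : 𝕜) + 1) • sumLists n fun l => f ((l ++ [a]) ++ [β]) •
          (revProd (l ++ [a]) : Series 𝕜 deg) := by
      intro a
      have h3 := ih (fun l => f (l ++ [a])) (hf.append [a])
      -- This exchange sign cancels the one which ∂_β acquires in passing `coord a`.
      have h4 : ∀ l, f ((l ++ [a]) ++ [β]) =
          koszul (deg a) (deg β) • f ((l ++ [β]) ++ [a]) := fun l => by
        simpa using hf l a β []
      set g : Series 𝕜 deg →+ Series 𝕜 deg :=
        (DistribSMul.toAddMonoidHom _ (koszul (deg β) (deg a))).comp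
          (AddMonoidHom.mulLeft (coord a)) with hg
      have hg' : ∀ (r : 𝕜) F, g (r • F) = r • g F := fun r F => by
        simp only [hg, AddMonoidHom.comp_apply, AddMonoidHom.coe_mulLeft, mul_smul_comm,
          DistribSMul.toAddMonoidHom_apply, smul_comm r]
      have h5 : ∀ F, koszul (deg β) (deg a) • (coord a * F) = g F := fun F => rfl
      simp only [h5, ← hg']
      rw [sumLists_map, h3, hg', ← sumLists_map]
      congr 1
      refine sumLists_congr fun l _ => ?_
      rw [h4, revProd_append_singleton, hg', ← h5, smul_assoc, smul_comm, koszul_comm]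
    simp only [h1, h2, ← Finset.smul_sum]
    rw [← sumLists_succ_last n (fun l => f (l ++ [β]) • (revProd l : Series 𝕜 deg))]
    push_cast
    rw [add_smul ((n : 𝕜) + 1), one_smul, add_comm]

end

section

variable {𝕜 J : Type*} [Field 𝕜] {deg : J → ℤ}

/-! ### Formal sums -/

/-- A sequence of power series whose formal sum makes sense: the coefficient of an exponent
vanishes in the `n`-th series if `n` is large compared to the exponent. -/
def IsTame (F : ℕ → Series 𝕜 deg) : Prop :=
  ∃ N, ∀ n m, N + m.degree < n → MvPowerSeries.coeff m (F n) = 0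

theorem IsTame.coeff_formalSum {F : ℕ → Series 𝕜 deg} {N : ℕ}
    (h : ∀ n m, N + m.degree < n → MvPowerSeries.coeff m (F n) = 0)
    (m : {α : J // Even (deg α)} →₀ ℕ) {B : ℕ} (hB : N + m.degree < B) :
    MvPowerSeries.coeff m (formalSum F) = ∑ n ∈ Finset.range B, MvPowerSeries.coeff m (F n) := by
  refine finsum_eq_finsetSum_of_support_subset _ fun n hn => ?_
  by_contra hn'
  rw [Finset.mem_coe, Finset.mem_range, not_lt] at hn'
  exact hn (h n m (by omega))

theorem formalSum_add {F G : ℕ → Series 𝕜 deg} (hF : IsTame F) (hG : IsTame G) :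
    formalSum (fun n => F n + G n) = formalSum F + formalSum G := by
  obtain ⟨N, hN⟩ := hF
  obtain ⟨N', hN'⟩ := hG
  have h : ∀ n m, N + N' + m.degree < n → MvPowerSeries.coeff m (F n + G n) = 0 := fun n m h => by
    rw [map_add, hN _ _ (by omega), hN' _ _ (by omega), add_zero]
  ext m : 1
  rw [map_add, IsTame.coeff_formalSum h m (Nat.lt_succ_self _),
    IsTame.coeff_formalSum hN m (B := N + N' + m.degree + 1) (by omega),
    IsTame.coeff_formalSum hN' m (B := N + N' + m.degree + 1) (by omega),
    ← Finset.sum_add_distrib]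
  simp only [map_add]

theorem formalSum_smul {F : ℕ → Series 𝕜 deg} (hF : IsTame F) (r : 𝕜) :
    formalSum (fun n => r • F n) = r • formalSum F := by
  obtain ⟨N, hN⟩ := hF
  have h : ∀ n m, N + m.degree < n → MvPowerSeries.coeff m (r • F n) = 0 := fun n m h => by
    rw [coeff_smul', hN _ _ h, smul_zero]
  ext m : 1
  rw [coeff_smul', IsTame.coeff_formalSum h m (Nat.lt_succ_self _),
    IsTame.coeff_formalSum hN m (Nat.lt_succ_self _), Finset.smul_sum]
  simp only [coeff_smul']

theorem formalSum_succ {F : ℕ → Series 𝕜 deg} (hF : IsTame F) :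
    formalSum F = F 0 + formalSum fun n => F (n + 1) := by
  obtain ⟨N, hN⟩ := hF
  have h : ∀ n m, N + m.degree < n → MvPowerSeries.coeff m (F (n + 1)) = 0 := fun n m h =>
    hN _ _ (by omega)
  ext m : 1
  rw [map_add, IsTame.coeff_formalSum h m (Nat.lt_succ_self _),
    IsTame.coeff_formalSum hN m (B := N + m.degree + 1 + 1) (by omega), Finset.sum_range_succ']
  exact add_comm _ _

theorem IsTame.pderiv {F : ℕ → Series 𝕜 deg} (hF : IsTame F) (β : J) :
    IsTame fun n => pderiv β (F n) := by
  obtain ⟨N, hN⟩ := hF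
  -- An even derivative reads a coefficient of degree one higher, hence the shift of the bound.
  refine ⟨N + 1, fun n m h => ?_⟩
  by_cases hβ : Even (deg β)
  · rw [coeff_pderiv_even hβ, hN _ _ (by simp; omega), smul_zero]
  · rw [coeff_pderiv_odd hβ, hN _ _ (by omega), map_zero]

theorem pderiv_formalSum {F : ℕ → Series 𝕜 deg} (hF : IsTame F) (β : J) :
    HoProb.pderiv β (formalSum F) = formalSum fun n => HoProb.pderiv β (F n) := by
  obtain ⟨N', hN'⟩ := hF.pderiv β
  obtain ⟨N, hN⟩ := hF
  ext m : 1
  rw [IsTame.coeff_formalSum hN' m (B := N + N' + m.degree + 2) (by omega)]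
  by_cases hβ : Even (deg β)
  · rw [coeff_pderiv_even hβ,
      IsTame.coeff_formalSum hN _ (B := N + N' + m.degree + 2) (by simp; omega), Finset.smul_sum]
    simp only [coeff_pderiv_even hβ]
  · rw [coeff_pderiv_odd hβ, IsTame.coeff_formalSum hN _ (B := N + N' + m.degree + 2) (by omega),
      map_sum]
    simp only [coeff_pderiv_odd hβ]

/-- At a fixed exponent only finitely many products contribute, so both sides reduce to finite sums
over the same nonzero terms. -/
theorem formalSum_mul {F G : ℕ → Series 𝕜 deg} (hF : IsTame F) (hG : IsTame G) :
    formalSum F * formalSum G =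
      formalSum fun n => ∑ p ∈ Finset.HasAntidiagonal.antidiagonal n, F p.1 * G p.2 := by
  classical
  obtain ⟨N, hN⟩ := hF
  obtain ⟨N', hN'⟩ := hG
  have hzero : ∀ i j m, (N + m.degree < i ∨ N' + m.degree < j) →
      MvPowerSeries.coeff m (F i * G j) = 0 := by
    intro i j m h
    rw [MvPowerSeries.coeff_mul]
    refine Finset.sum_eq_zero fun p hp => ?_
    have hd : p.1.degree + p.2.degree = m.degree := by
      rw [← map_add, Finset.HasAntidiagonal.mem_antidiagonal.1 hp]
    rcases h with h | h
    · rw [hN _ _ (by omega), zero_mul]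
    · rw [hN' _ _ (by omega), mul_zero]
  have h : ∀ n m, N + N' + 2 * m.degree < n → MvPowerSeries.coeff m
      (∑ p ∈ Finset.HasAntidiagonal.antidiagonal n, F p.1 * G p.2) = 0 := by
    intro n m h
    rw [map_sum]
    refine Finset.sum_eq_zero fun p hp => hzero _ _ _ ?_
    have := Finset.HasAntidiagonal.mem_antidiagonal.1 hp
    omega
  ext m : 1
  -- A crude common cutoff: each factor's exponent has degree at most that of `m`, and indices
  -- summing to at least `B` force one factor past its own bound.
  set B := N + N' + 2 * m.degree + 1 with hB
  have h1 : MvPowerSeries.coeff m (formalSum F * formalSum G) =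
      ∑ i ∈ Finset.range B, ∑ j ∈ Finset.range B, MvPowerSeries.coeff m (F i * G j) := by
    simp only [MvPowerSeries.coeff_mul]
    rw [Finset.sum_congr rfl fun i _ => Finset.sum_comm, Finset.sum_comm]
    refine Finset.sum_congr rfl fun p hp => ?_
    have hd : p.1.degree + p.2.degree = m.degree := by
      rw [← map_add, Finset.HasAntidiagonal.mem_antidiagonal.1 hp]
    rw [IsTame.coeff_formalSum hN p.1 (B := B) (by omega),
      IsTame.coeff_formalSum hN' p.2 (B := B) (by omega), Finset.sum_mul_sum]
  have h2 : MvPowerSeries.coeff m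
      (formalSum fun n => ∑ p ∈ Finset.HasAntidiagonal.antidiagonal n, F p.1 * G p.2) =
      ∑ n ∈ Finset.range (B + B), ∑ p ∈ Finset.HasAntidiagonal.antidiagonal n,
        MvPowerSeries.coeff m (F p.1 * G p.2) := by
    refine (finsum_eq_finsetSum_of_support_subset (s := Finset.range (B + B)) _
      fun n hn => ?_).trans ?_
    · by_contra hn'
      rw [Finset.mem_coe, Finset.mem_range, not_lt] at hn'
      exact hn (h n m (by omega))
    · simp only [map_sum]
  rw [h1, h2, ← Finset.sum_product', Finset.sum_sigma']
  refine Finset.sum_bij_ne_zero (fun p _ _ => ⟨p.1 + p.2, p⟩) ?_ ?_ ?_ ?_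
  · intro p hp _
    simp only [Finset.mem_product, Finset.mem_range, Finset.mem_sigma,
      Finset.HasAntidiagonal.mem_antidiagonal] at hp ⊢
    exact ⟨by omega, trivial⟩
  · intro p _ _ q _ _ e
    simp only [Sigma.mk.injEq, heq_eq_eq] at e
    exact e.2
  · rintro ⟨n, p⟩ hp hne
    simp only [Finset.mem_sigma, Finset.HasAntidiagonal.mem_antidiagonal] at hp
    refine ⟨p, ?_, hne, by simp [hp.2]⟩
    simp only [Finset.mem_product, Finset.mem_range]
    by_contra hc
    refine hne (hzero p.1 p.2 m ?_)
    rcases not_and_or.1 hc with h | h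
    · exact Or.inl (by omega)
    · exact Or.inr (by omega)
  · intro p _ _
    rfl

/-! ### Coefficients of monomials -/

/-- The list of the odd labels of a list. -/
def oddPart (deg : J → ℤ) : List J → List {α : J // ¬ Even (deg α)}
  | [] => []
  | a :: l => if h : Even (deg a) then oddPart deg l else ⟨a, h⟩ :: oddPart deg l

/-- By pigeonhole an odd variable is repeated, and an alternating product with a repetition is zero.
-/
theorem prod_ι_eq_zero [Fintype J] (l : List {α : J // ¬ Even (deg α)})
    (h : Fintype.card J < l.length) :
    (l.map fun a => ExteriorAlgebra.ι 𝕜 (Finsupp.single a (1 : 𝕜))).reverse.prod = 0 := by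
  classical
  have h1 : (l.map fun a => ExteriorAlgebra.ι 𝕜 (Finsupp.single a (1 : 𝕜))).reverse =
      ofFn fun i => ExteriorAlgebra.ι 𝕜 (Finsupp.single (l.reverse.get i) (1 : 𝕜)) := by
    rw [← map_reverse]
    conv_lhs => rw [← ofFn_get l.reverse]
    rw [map_ofFn]
    rfl
  rw [h1, ← ExteriorAlgebra.ιMulti_apply]
  refine AlternatingMap.map_eq_zero_of_not_injective _ _ fun hinj => ?_
  have h2 : Function.Injective fun i => ((l.reverse.get i : {α : J // ¬ Even (deg α)}) : J) := by
    intro i j hij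
    exact hinj (by
      beta_reduce
      rw [Subtype.ext hij])
  have := Fintype.card_le_of_injective _ h2
  simp at this
  omega

theorem exists_revProd_eq (l : List J) : ∃ m₀ : {α : J // Even (deg α)} →₀ ℕ,
    m₀.degree + (oddPart deg l).length = l.length ∧ (revProd l : Series 𝕜 deg) =
      MvPowerSeries.monomial m₀ ((oddPart deg l).map
        fun a => ExteriorAlgebra.ι 𝕜 (Finsupp.single a (1 : 𝕜))).reverse.prod := by
  induction l with
  | nil => exact ⟨0, by simp [oddPart], rfl⟩
  | cons a l ih =>
    obtain ⟨m₀, h1, h2⟩ := ih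
    rw [revProd_cons, h2, oddPart]
    by_cases h : Even (deg a)
    · rw [dif_pos h, coord_even h, MvPowerSeries.X, MvPowerSeries.monomial_mul_monomial, mul_one]
      refine ⟨_, ?_, rfl⟩
      simp
      omega
    · rw [dif_neg h, coord_odd h]
      refine ⟨m₀, by simp; omega, ?_⟩
      rw [← MvPowerSeries.monomial_zero_eq_C_apply, MvPowerSeries.monomial_mul_monomial, add_zero]
      simp

theorem coeff_revProd_eq_zero [Fintype J] (l : List J) (m : {α : J // Even (deg α)} →₀ ℕ)
    (h : Fintype.card J + m.degree < l.length) :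
    MvPowerSeries.coeff m (revProd l : Series 𝕜 deg) = 0 := by
  classical
  obtain ⟨m₀, h1, h2⟩ := exists_revProd_eq (𝕜 := 𝕜) (deg := deg) l
  rw [h2, MvPowerSeries.coeff_monomial]
  split_ifs with hm
  · subst hm
    exact prod_ι_eq_zero _ (by omega)
  · rfl

end

section

variable {𝕜 J : Type*} [Field 𝕜] [Fintype J] {deg : J → ℤ}

/-! ### Generating series of functions of lists -/

/-- The sum over all lists of length `n` of basis labels, divided by `n!`. -/
def layer (f : List J → 𝕜) (n : ℕ) : Series 𝕜 deg :=
  (n.factorial : 𝕜)⁻¹ • sumLists n fun l => f l • revProd l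

/-- The exponential generating series of a function of lists of labels. -/
def genSeries (f : List J → 𝕜) : Series 𝕜 deg := formalSum (layer f)

/-- A monomial of length n has at most |J| odd letters unless it vanishes; the remaining letters are
even and make up the degree of its exponent. -/
theorem isTame_layer (f : List J → 𝕜) : IsTame (layer (deg := deg) f) := by
  refine ⟨Fintype.card J, fun n m h => ?_⟩
  rw [layer, coeff_smul', sumLists, map_sum, Finset.sum_eq_zero, smul_zero]
  intro ρ _
  rw [coeff_smul', coeff_revProd_eq_zero _ _ (by rwa [length_ofFn]), smul_zero]

theorem layer_zero (f : List J → 𝕜) : layer (deg := deg) f 0 = f [] • 1 := by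
  simp [layer, sumLists_zero]

/-- `generatingSeries` begins with lists of length one, so the empty list supplies the constant
term. -/
theorem genSeries_eq (f : List J → 𝕜) (a : ∀ n : ℕ, (Fin n → J) → 𝕜)
    (h : ∀ n ρ, a (n + 1) ρ = f (ofFn ρ)) :
    genSeries (deg := deg) f = f [] • 1 + generatingSeries a := by
  rw [genSeries, formalSum_succ (isTame_layer f), layer_zero, generatingSeries]
  simp only [layer, sumLists, h, revMonomial_eq]

theorem layer_add (f g : List J → 𝕜) (n : ℕ) :
    layer (deg := deg) (fun l => f l + g l) n = layer f n + layer g n := by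
  simp only [layer, add_smul, sumLists_add, smul_add]

theorem genSeries_add (f g : List J → 𝕜) :
    genSeries (deg := deg) (fun l => f l + g l) = genSeries f + genSeries g := by
  rw [genSeries, genSeries, genSeries, ← formalSum_add (isTame_layer f) (isTame_layer g)]
  exact congrArg formalSum (funext fun n => layer_add f g n)

theorem genSeries_zero : genSeries (deg := deg) (fun _ : List J => (0 : 𝕜)) = 0 := by
  have := genSeries_add (deg := deg) (fun _ : List J => (0 : 𝕜)) fun _ => 0
  simpa using this

theorem genSeries_smul (r : 𝕜) (f : List J → 𝕜) :
    genSeries (deg := deg) (fun l => r * f l) = r • genSeries f := by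
  rw [genSeries, genSeries, ← formalSum_smul (isTame_layer f)]
  refine congrArg formalSum (funext fun n => ?_)
  rw [layer, layer, smul_comm r, sumLists, sumLists, Finset.smul_sum (r := r)]
  simp only [mul_smul]

theorem genSeries_sum {κ : Type*} (s : Finset κ) (f : κ → List J → 𝕜) :
    genSeries (deg := deg) (fun l => ∑ k ∈ s, f k l) = ∑ k ∈ s, genSeries (f k) := by
  classical
  induction s using Finset.induction_on with
  | empty => simpa using genSeries_zero
  | insert k s hk ih =>
    simp only [Finset.sum_insert hk]
    rw [genSeries_add, ih]

/-- The factor n + 1 from `sumLists_pderiv` turns 1/(n+1)! into 1/n!, and the constant layer is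
killed. -/
theorem pderiv_genSeries [CharZero 𝕜] (β : J) (f : List J → 𝕜) (hf : IsListSymm deg f) :
    pderiv β (genSeries (deg := deg) f) = genSeries fun l => f (l ++ [β]) := by
  classical
  rw [genSeries, pderiv_formalSum (isTame_layer f), formalSum_succ ((isTame_layer f).pderiv β),
    layer_zero, pderiv_smul, pderiv_one, smul_zero, zero_add]
  refine congrArg formalSum (funext fun n => ?_)
  rw [layer, pderiv_smul, sumLists, pderiv_sum]
  simp only [pderiv_smul]
  have := sumLists_pderiv (𝕜 := 𝕜) β n f hf
  rw [sumLists] at this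
  rw [this, layer, smul_smul]
  congr 1
  have h1 : ((n : 𝕜) + 1) ≠ 0 := Nat.cast_add_one_ne_zero n
  rw [Nat.factorial_succ]
  push_cast
  rw [mul_inv, mul_assoc, mul_comm, mul_assoc, mul_inv_cancel₀ h1, mul_one]

/-- The binomial coefficient counting the splittings turns 1/n! into the product of the two inverse
factorials. The first factor takes the second sublist `B` because the monomials are reversed. -/
theorem genSeries_mul [CharZero 𝕜] (f g : List J → 𝕜) :
    genSeries (deg := deg) f * genSeries g =
      genSeries fun l => splitSum deg (fun u B => f B * g u) l := by
  rw [genSeries, genSeries, genSeries, formalSum_mul (isTame_layer f) (isTame_layer g)]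
  refine congrArg formalSum (funext fun n => ?_)
  have e1 : ∀ l : List J, splitSum deg (fun u B => f B * g u) l • (revProd l : Series 𝕜 deg) =
      revProd l * splitSum deg (fun u B => algebraMap 𝕜 (Series 𝕜 deg) (f B * g u)) l := by
    intro l
    have := splitSum_map (d := deg) (algebraMap 𝕜 (Series 𝕜 deg)).toAddMonoidHom
      (fun u B => f B * g u) l
    simp only [RingHom.toAddMonoidHom_eq_coe, AddMonoidHom.coe_coe] at this
    rw [this, ← Algebra.commutes, ← Algebra.smul_def]
  simp only [layer, e1]
  rw [sumLists_splitSum, Finset.smul_sum]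
  refine Finset.sum_congr rfl fun p hp => ?_
  have e2 : ∀ B u : List J, (revProd B * (revProd u * algebraMap 𝕜 (Series 𝕜 deg) (f B * g u)) :
      Series 𝕜 deg) = (f B • revProd B) * (g u • revProd u) := by
    intro B u
    rw [← Algebra.commutes, ← Algebra.smul_def, mul_smul_comm, smul_mul_smul_comm]
  simp only [e2]
  have e3 : (sumLists p.1 fun B => sumLists p.2 fun u =>
      (f B • revProd B) * (g u • revProd u : Series 𝕜 deg)) =
      (sumLists p.1 fun B => f B • revProd B) * sumLists p.2 fun u => g u • revProd u := by
    simp only [sumLists, Finset.sum_mul_sum]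
  rw [e3, smul_mul_smul_comm, ← Nat.cast_smul_eq_nsmul 𝕜, smul_smul]
  congr 1
  have hp' := Finset.HasAntidiagonal.mem_antidiagonal.1 hp
  have h1 : (p.1.factorial : 𝕜) ≠ 0 := Nat.cast_ne_zero.2 (Nat.factorial_ne_zero _)
  have h2 : (p.2.factorial : 𝕜) ≠ 0 := Nat.cast_ne_zero.2 (Nat.factorial_ne_zero _)
  have h3 : (n.factorial : 𝕜) ≠ 0 := Nat.cast_ne_zero.2 (Nat.factorial_ne_zero _)
  have h4 : (n.choose p.1 : 𝕜) * p.1.factorial * p.2.factorial = n.factorial := by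
    have := Nat.choose_mul_factorial_mul_factorial (n := n) (k := p.1) (by omega)
    rw [show n - p.1 = p.2 by omega] at this
    exact_mod_cast this
  have h5 : (n.choose p.1 : 𝕜) ≠ 0 := Nat.cast_ne_zero.2 (Nat.choose_pos (by omega)).ne'
  rw [← h4]
  field_simp

end

section

variable {𝕜 U V W : Type*} [Field 𝕜] [AddCommGroup U] [Module 𝕜 U] [AddCommGroup V] [Module 𝕜 V]
  [AddCommGroup W] [Module 𝕜 W]

/-! ### Linearity of the correlation densities -/

/-- An argument belongs to exactly one block, so changing it affects only the value of `φ` at that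
block. -/
theorem blocks_update (φ : ∀ n : ℕ, MultilinearMap 𝕜 (fun _ : Fin n => U) V) {n : ℕ}
    (π : OrderedFinpartition n) (i : Fin n) (x : Fin n → U) (z : U) :
    (fun j => φ (π.partSize j) fun k => Function.update x i z (π.emb j k)) =
      Function.update (fun j => φ (π.partSize j) fun k => x (π.emb j k)) (π.index i)
        (φ (π.partSize (π.index i))
          (Function.update (fun k => x (π.emb (π.index i) k)) (π.invEmbedding i) z)) := by
  funext j
  by_cases h : j = π.index i
  · subst h
    rw [Function.update_self]
    congr 1
    have := Function.update_comp_eq_of_injective x (π.emb_strictMono (π.index i)).injective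
      (π.invEmbedding i) z
    rw [π.emb_invEmbedding] at this
    exact this
  · rw [Function.update_of_ne h]
    congr 1
    refine Function.update_comp_eq_of_notMem_range _ _ fun ⟨k, hk⟩ => ?_
    have hd : Disjoint (Set.range (π.emb j)) (Set.range (π.emb (π.index i))) :=
      π.disjoint (Set.mem_univ j) (Set.mem_univ _) h
    exact Set.disjoint_left.1 hd ⟨k, hk⟩ ⟨_, π.emb_invEmbedding i⟩

theorem exists_composeSum_update (M : ∀ n : ℕ, MultilinearMap 𝕜 (fun _ : Fin n => V) W)
    (φ : ∀ n : ℕ, MultilinearMap 𝕜 (fun _ : Fin n => U) V) (n : ℕ) (d : Fin n → ℤ)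
    (x : Fin n → U) (i : Fin n) :
    ∃ g : U →ₗ[𝕜] W, ∀ z, composeSum (ops M) (ops φ) n d (Function.update x i z) = g z := by
  refine ⟨∑ π : OrderedFinpartition n, ((partitionSign d π : ℤ)) •
    ((M π.length).toLinearMap (fun j => φ (π.partSize j) fun k => x (π.emb j k))
      (π.index i)).comp ((φ (π.partSize (π.index i))).toLinearMap
        (fun k => x (π.emb (π.index i) k)) (π.invEmbedding i)), fun z => ?_⟩
  rw [composeSum, LinearMap.sum_apply]
  refine Finset.sum_congr rfl fun π _ => ?_
  rw [LinearMap.smul_apply, LinearMap.comp_apply, MultilinearMap.toLinearMap_apply,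
    MultilinearMap.toLinearMap_apply, Units.smul_def, ← blocks_update]
  rfl

end

/-! ### Expansion in a homogeneous basis -/

section

variable {𝕜 C S J : Type*} [Field 𝕜] [AddCommGroup C] [Module 𝕜 C] [AddCommGroup S] [Module 𝕜 S]
  {A : HomotopyProbabilityAlgebra 𝕜 C} {X : PointedGradedSpace 𝕜 S}

theorem exists_correlationDensity_append (φ : SLQuasiIso X A) (l : List (ℤ × S)) (k : ℤ) :
    ∃ g : S →ₗ[𝕜] C, ∀ z, opList (correlationDensity φ) (l ++ [(k, z)]) = g z := by
  obtain ⟨g, hg⟩ := exists_composeSum_update A.M φ.φ (l.length + 1)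
    (fun i => (Fin.snoc (α := fun _ => ℤ × S) l.get (k, 0) i).1)
    (Fin.snoc (α := fun _ => S) (fun i => (l.get i).2) 0) (Fin.last _)
  refine ⟨g, fun z => ?_⟩
  rw [← hg, opList_append_singleton, Fin.update_snoc_last]
  have : (fun i => (Fin.snoc (α := fun _ => ℤ × S) l.get (k, z) i).1) =
      fun i => (Fin.snoc (α := fun _ => ℤ × S) l.get (k, 0) i).1 := by
    funext i
    refine Fin.lastCases ?_ (fun i => ?_) i <;> simp
  rw [this]
  rfl

/-- Projection to degree `k` kills the basis vectors of other degrees, so it is invisible to their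
coordinates on `v`. -/
theorem repr_eq_zero {deg : J → ℤ} (e : Module.Basis J 𝕜 S) (he : ∀ α, e α ∈ X.deg (deg α))
    {k : ℤ} {v : S} (hv : v ∈ X.deg k) (γ : J) (hγ : deg γ ≠ k) : e.repr v γ = 0 := by
  obtain ⟨p, hp1, hp2, hp3⟩ := X.exists_proj
  have key : ∀ w, e.coord γ (p k w) = 0 := by
    intro w
    have : (e.coord γ).comp (p k) = 0 := by
      refine e.ext fun β => ?_
      rw [LinearMap.comp_apply, LinearMap.zero_apply]
      by_cases hβ : deg β = k
      · have h1 := hp2 (deg β) _ (he β)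
        rw [hβ] at h1
        rw [h1, e.coord_apply, e.repr_self, Finsupp.single_eq_of_ne]
        rintro rfl
        exact hγ hβ
      · rw [hp3 _ _ _ (he β) hβ, map_zero]
    exact LinearMap.congr_fun this w
  have := key v
  rwa [hp2 k v hv] at this

/-! ### The moments as a function of lists of labels -/

/-- The moments `μ_n(e_{ρ_1}, …, e_{ρ_n})` as a function of the list of labels, with `μ_0 = 1`. -/
def momentList (deg : J → ℤ) (e : J → S) (c : PAlgHom A (ground 𝕜)) (φ : SLQuasiIso X A)
    (l : List J) : 𝕜 :=
  if l = [] then 1 else c.toLinearMap (opList (correlationDensity φ) (l.map (label deg e)))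

theorem momentList_of_ne_nil (deg : J → ℤ) (e : J → S) (c : PAlgHom A (ground 𝕜))
    (φ : SLQuasiIso X A) {l : List J} (hl : l ≠ []) : momentList deg e c φ l =
      c.toLinearMap (opList (correlationDensity φ) (l.map (label deg e))) := if_neg hl

theorem isListSymm_momentList {deg : J → ℤ} {e : J → S} (he : ∀ α, e α ∈ X.deg (deg α))
    (c : PAlgHom A (ground 𝕜)) (φ : SLQuasiIso X A) : IsListSymm deg (momentList deg e c φ) := by
  intro u a b v
  rw [momentList_of_ne_nil _ _ _ _ (by simp), momentList_of_ne_nil _ _ _ _ (by simp)]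
  exact (isListSymm_correlationDensity φ he).map c.toLinearMap.toAddMonoidHom u a b v

/-- For the empty list this is c(φ_1(1)) = 1, in agreement with the convention μ_0 = 1. -/
theorem momentList_append_one {deg : J → ℤ} {e : J → S} (c : PAlgHom A (ground 𝕜))
    (φ : SLQuasiIso X A) {o : J} (ho : e o = X.one) (l : List J) :
    momentList deg e c φ (l ++ [o]) = momentList deg e c φ l := by
  rw [momentList_of_ne_nil _ _ _ _ (by simp), map_append, map_cons, map_nil, label, ho]
  by_cases hl : l = []
  · subst hl
    rw [map_nil, nil_append, opList_correlationDensity_singleton, linear_one, c.map_one]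
    rfl
  · rw [opList_correlationDensity_append_one _ _ (by simpa using hl),
      momentList_of_ne_nil _ _ _ _ hl]

section

variable {φ : SLQuasiIso X A} {deg : J → ℤ} (e : Module.Basis J 𝕜 S)

theorem momentList_eq_iota (h : HomotopyInverse φ) (he : ∀ α, e α ∈ X.deg (deg α))
    (c : PAlgHom A (ground 𝕜)) {l : List J} (hl : l ≠ []) : momentList deg e c φ l =
      iota c φ (opList (correlationM h) (l.map (label deg e))) := by
  rw [momentList_of_ne_nil _ _ _ _ hl,
    expectation_correlationDensity h c _ (by simpa using hl) (isHomogeneous_map_label he l)]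

variable [Fintype J]

/-- The last argument of a moment expanded in the basis. -/
theorem iota_correlationM_append (h : HomotopyInverse φ) (he : ∀ α, e α ∈ X.deg (deg α))
    (c : PAlgHom A (ground 𝕜)) (u : List J) {k : ℤ} {v : S} (hv : v ∈ X.deg k) :
    iota c φ (opList (correlationM h) (u.map (label deg e) ++ [(k, v)])) =
      ∑ γ, e.repr v γ * momentList deg e c φ (u ++ [γ]) := by
  obtain ⟨g, hg⟩ := exists_correlationDensity_append φ (u.map (label deg e)) k
  rw [opList_correlationM, hg]
  conv_lhs => rw [← e.sum_repr v]
  simp only [map_sum, map_smul, smul_eq_mul]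
  refine Finset.sum_congr rfl fun γ _ => ?_
  -- The density is linear only for a fixed recorded degree `k`. Basis vectors of degree `k` carry
  -- the correct label, and the others have coefficient zero.
  by_cases hγ : deg γ = k
  · rw [momentList_eq_iota e h he c (by simp), map_append, map_cons, map_nil, label, hγ,
      opList_correlationM, hg]
  · rw [repr_eq_zero e he hv γ hγ, zero_mul, zero_mul]

/-- The coefficient form of the second order equation: ι is applied to the recursion for `m`, whose
value is homogeneous of the recorded degree and can be expanded in the basis. -/
theorem momentList_append_pair (h : HomotopyInverse φ) (he : ∀ α, e α ∈ X.deg (deg α))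
    (c : PAlgHom A (ground 𝕜)) (l : List J) (α β : J) :
    momentList deg e c φ (l ++ [α, β]) = ∑ γ, splitSum deg (fun u B =>
      e.repr (opList (mOps (correlationM h)) ((B ++ [α, β]).map (label deg e))) γ *
        momentList deg e c φ (u ++ [γ])) l := by
  rw [momentList_eq_iota e h he c (by simp), map_append, map_cons, map_cons, map_nil,
    eq_splitSum_mOps _ (opList_correlationM_singleton h), splitSum_comp_map, ← splitSum_sum]
  have := splitSum_map (d := deg) (iota c φ).toAddMonoidHom (fun u B => opList (correlationM h)
    (u.map (label deg e) ++ [(listDeg Prod.fst (B.map (label deg e) ++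
      [label deg e α, label deg e β]), opList (mOps (correlationM h)) (B.map (label deg e) ++
      [label deg e α, label deg e β]))])) l
  refine this.symm.trans (splitSum_congr fun u B _ => ?_)
  have hB : B.map (label deg e) ++ [label deg e α, label deg e β] =
      (B ++ [α, β]).map (label deg e) := by simp
  rw [hB]
  exact iota_correlationM_append e h he c u
    (opList_mOps_mem h _ (isHomogeneous_map_label he _))

/-! ### The generating series -/

theorem momentGeneratingFunction_eq (c : PAlgHom A (ground 𝕜)) :
    momentGeneratingFunction deg e c φ = genSeries (momentList deg e c φ) := by
  rw [genSeries_eq (momentList deg e c φ) fun n ρ =>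
    moment c φ n (fun i => deg (ρ i)) (fun i => e (ρ i))]
  · rw [momentGeneratingFunction, momentList, if_pos rfl, one_smul]
  · intro n ρ
    rw [momentList_of_ne_nil _ _ _ _ (by simp), map_ofFn, opList_ofFn]
    rfl

theorem flatCoordinate_eq (h : HomotopyInverse φ) (γ : J) :
    flatCoordinate deg e h γ = genSeries fun l => if l = [] then 0 else
      e.repr (opList (correlationM h) (l.map (label deg e))) γ := by
  rw [genSeries_eq _ fun n ρ => structureConstant deg e (correlationM h) n ρ γ]
  · rw [flatCoordinate, if_pos rfl, zero_smul, zero_add]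
  · intro n ρ
    rw [if_neg (by simp), map_ofFn, opList_ofFn]
    rfl

theorem connection_eq (h : HomotopyInverse φ) (α β γ : J) :
    connection deg e h α β γ = genSeries fun l =>
      e.repr (opList (mOps (correlationM h)) ((l ++ [α, β]).map (label deg e))) γ := by
  have hpair : [α, β] = ofFn ![α, β] := by simp
  rw [genSeries_eq _ fun n ρ =>
    structureConstant deg e (mOps (correlationM h)) (n + 2) (Fin.append ρ ![α, β]) γ]
  · rw [connection, nil_append, hpair, map_ofFn, opList_ofFn, Algebra.algebraMap_eq_smul_one]
    rfl
  · intro n ρ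
    rw [hpair, ← ofFn_fin_append, map_ofFn, opList_ofFn]
    rfl

end

end

end HoProb

end

/-! ### The main theorem -/

theorem mainTheorem10 {𝕜 C S J : Type*} [Field 𝕜] [CharZero 𝕜]
    [AddCommGroup C] [Module 𝕜 C] [AddCommGroup S] [Module 𝕜 S] [Fintype J]
    (P : HomotopyProbabilitySpace 𝕜 C)
    (c : PAlgHom P.algebra (ground 𝕜)) (hc : Quot.mk _ c = P.expectation)
    (Sp : CompleteRVSpace P.algebra S)
    (φ : SLQuasiIso Sp.space P.algebra) (hφ : Quot.mk _ φ = Sp.homotopyType)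
    (h : HomotopyInverse φ)
    (deg : J → ℤ) (e : Module.Basis J 𝕜 S) (he : ∀ α, e α ∈ Sp.space.deg (deg α))
    (o : J) (ho : e o = Sp.space.one) :
    momentGeneratingFunction deg e c φ =
        1 + ∑ γ, iota c φ (e γ) • flatCoordinate deg e h γ ∧
    (∀ c' : PAlgHom P.algebra (ground 𝕜), (∀ γ, iota c' φ (e γ) = iota c φ (e γ)) →
      momentGeneratingFunction deg e c' φ = momentGeneratingFunction deg e c φ) ∧
    (∀ α β, pderiv α (pderiv β (momentGeneratingFunction deg e c φ)) -
        ∑ γ, connection deg e h α β γ * pderiv γ (momentGeneratingFunction deg e c φ) = 0) ∧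
    pderiv o (momentGeneratingFunction deg e c φ) - momentGeneratingFunction deg e c φ = 0 := by
  -- Proved for every expectation at once: the right side involves `c` only through the values of ι
  -- on the basis, which also gives the second claim.
  have hZ : ∀ c : PAlgHom P.algebra (ground 𝕜), momentGeneratingFunction deg e c φ =
      1 + ∑ γ, iota c φ (e γ) • flatCoordinate deg e h γ := by
    intro c
    -- The indicator of the empty list has generating series 1.
    have h1 : momentList deg e c φ = fun l => (if l = [] then 1 else 0) +
        ∑ γ, iota c φ (e γ) * if l = [] then 0 else
          e.repr (opList (correlationM h) (l.map (label deg e))) γ := by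
      funext l
      by_cases hl : l = []
      · simp [hl, momentList]
      · rw [momentList_eq_iota e h he c hl]
        simp only [if_neg hl, zero_add]
        conv_lhs => rw [← e.sum_repr (opList (correlationM h) _)]
        simp only [map_sum, map_smul, smul_eq_mul, mul_comm]
    rw [momentGeneratingFunction_eq, h1, genSeries_add, genSeries_sum]
    simp only [genSeries_smul, ← flatCoordinate_eq]
    rw [genSeries_eq (fun l : List J => if l = [] then (1 : 𝕜) else 0) (fun _ _ => 0)
      (fun n ρ => by simp), if_pos rfl, one_smul]
    have h0 : generatingSeries (deg := deg) (fun n (_ : Fin n → J) => (0 : 𝕜)) = 0 := by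
      have := genSeries_eq (deg := deg) (fun _ : List J => (0 : 𝕜)) (fun _ _ => 0) fun _ _ => rfl
      rw [genSeries_zero, zero_smul, zero_add] at this
      exact this.symm
    rw [h0, add_zero]
  have hsymm := isListSymm_momentList he c φ
  refine ⟨hZ c, fun c' hc' => ?_, fun α β => ?_, ?_⟩
  · rw [hZ, hZ]
    simp only [hc']
  -- ∂_β acts first and appends β; ∂_α then inserts α before it, which is the order of the last two
  -- arguments of `m`.
  · rw [momentGeneratingFunction_eq, pderiv_genSeries β _ hsymm,
      pderiv_genSeries α _ (hsymm.append [β])]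
    simp only [pderiv_genSeries _ _ hsymm, connection_eq, genSeries_mul]
    rw [← genSeries_sum, sub_eq_zero]
    refine congrArg genSeries (funext fun l => ?_)
    rw [← momentList_append_pair e h he c l α β, List.append_assoc]
    rfl
  · rw [momentGeneratingFunction_eq, pderiv_genSeries o _ hsymm, sub_eq_zero]
    exact congrArg genSeries (funext fun l => momentList_append_one c φ ho l)
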